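/- Let $S$ be a compact connected smooth surface without boundary (for instance a closed oriented surface with $\chi(S)<0$), let $h$ be a hyperbolic metric on $S$, i.e. a smooth Riemannian metric locally isometric to the hyperbolic plane, with area measure $\omega_h$, and let $\pi:\widetilde S\to S$ be a smooth universal cover, with $\pi_1(S)$ identified with the group of deck transformations. Let $\rho:\pi_1(S)\to \mathrm{PSL}_2(\mathbb C)=\mathrm{Isom}^+(\mathbb H^3)$ be a representation, let $\tilde f:\widetilde S\to\mathbb H^3$ be a smooth $\rho$-equivariant map, i.e. $\tilde f\circ\gamma=\rho(\gamma)\circ\tilde f$ for all $\gamma\in\pi_1(S)$, and let $\tilde X$ be a smooth $\rho$-invariant section of $\tilde f^*T\mathbb H^3$, i.e. $\tilde X(\gamma \tilde p)=d\rho(\gamma)\,\tilde X(\tilde p)$ for all $\gamma,\tilde p$. (These sections are exactly the variational fields of deformations of $\tilde f$ with fixed monodromy $\rho$.) The geodesic displacement of $\tilde f$ along $\tilde X$ is $$\tilde f_{\tilde X,t}(\tilde p):=\exp_{\tilde f(\tilde p)}\bigl(t\,\tilde X(\tilde p)\bigr),\qquad t\in\mathbb R .$$ For a linear map $L$ between finite-dimensional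 Euclidean spaces let $\|L\|_1:=\mathrm{tr}\sqrt{L^TL}$. For a smooth $\rho$-equivariant map $\tilde g:\widetilde S\to\mathbb H^3$ let $\|dg\|_1:S\to\mathbb R_{\ge0}$ be the function whose value at $x$ is $\|d\tilde g_{\tilde p}\|_1$ for any lift $\tilde p$ of $x$, computed with respect to $\pi^*h$ and the hyperbolic metric of $\mathbb H^3$, and let $$F(\tilde g):=\int_S\|dg\|_1\,\omega_h$$ be its $1$-Schatten energy. Then, for every $t\in\mathbb R$, the map $\tilde f_{\tilde X,t}$ is smooth and $\rho$-equivariant and its $1$-Schatten norm is $\omega_h$-integrable on $S$; moreover (i) the function $t\mapsto F(\tilde f_{\tilde X,t})$ is convex on $\mathbb R$; (ii) if $\tilde f$ is an immersion and $\tilde X$ is not identically zero, then $t\mapsto F(\tilde f_{\tilde X,t})$ is differentiable near $t=0$ and twice differentiable at $t=0$, and $$\frac{d^2}{dt^2}F(\tilde f_{\tilde X,t})\Big|_{t=0}>0 .$$ -/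

import Mathlib

open Set Filter Topology MeasureTheory
open scoped Manifold ContDiff Matrix MatrixGroups

noncomputable section

namespace SchattenEnergy

/-! ### Linear algebra: the `1`-Schatten norm -/

section Schatten

variable {V : Type*} [AddCommGroup V] [Module ℝ V]

/-- `b` is the nonnegative `g`-self-adjoint endomorphism of `V` with `g (b v) (b w) = q v w`.
If `q` is the pull-back of a scalar product by a linear map `L`, this says `b = √(Lᵀ L)`. -/
structure IsPolarFactor (g q : V → V → ℝ) (b : V →ₗ[ℝ] V) : Prop where
  selfAdjoint : ∀ v w, g (b v) w = g v (b w)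
  nonneg : ∀ v, 0 ≤ g (b v) v
  pullback : ∀ v w, g (b v) (b w) = q v w

open Classical in
/-- The `1`-Schatten norm `tr √(Lᵀ L)` of a linear map `L` from `(V, g)` to a Euclidean space,
where `q` is the pull-back by `L` of the scalar product of the target. The polar factor exists and
is unique, see `existsUnique_isPolarFactor`. -/
def schattenOne (g q : V → V → ℝ) : ℝ :=
  if hb : ∃ b : V →ₗ[ℝ] V, IsPolarFactor g q b then LinearMap.trace ℝ V hb.choose else 0

theorem existsUnique_isPolarFactor_inner {V : Type*} [NormedAddCommGroup V] [InnerProductSpace ℝ V]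
    [FiniteDimensional ℝ V] (q : V →ₗ[ℝ] V →ₗ[ℝ] ℝ)
    (hqs : ∀ v w, q v w = q w v) (hqp : ∀ v, 0 ≤ q v v) :
    ∃! b : V →ₗ[ℝ] V, IsPolarFactor (fun v w => inner ℝ v w) (fun v w => q v w) b := by
  obtain ⟨T, hT⟩ : ∃ T : V →ₗ[ℝ] V, ∀ v w, inner ℝ (T v) w = q v w := by
    refine ⟨(InnerProductSpace.toDual ℝ V).symm.toLinearEquiv.toLinearMap ∘ₗ
      LinearMap.toContinuousLinearMap.toLinearMap ∘ₗ q, fun v w => ?_⟩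
    simp
  have hTs : T.IsSymmetric := fun v w => by
    rw [hT, real_inner_comm, hT, hqs]
  let e := hTs.eigenvectorBasis rfl
  let l := hTs.eigenvalues rfl
  have hTe : ∀ i, T (e i) = l i • e i := fun i => hTs.apply_eigenvectorBasis rfl i
  have hl : ∀ i, 0 ≤ l i := fun i => by
    have h1 : inner ℝ (T (e i)) (e i) = l i := by
      rw [hTe, real_inner_smul_left, real_inner_self_eq_norm_sq]
      simp
    rw [← h1, hT]; exact hqp _
  have key : ∀ b : V →ₗ[ℝ] V, IsPolarFactor (fun v w => inner ℝ v w) (fun v w => q v w) b →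
      ∀ i, b (e i) = √(l i) • e i := by
    intro b hb i
    set m := √(l i) with hm
    have hm2 : m * m = l i := Real.mul_self_sqrt (hl i)
    have hm0 : 0 ≤ m := Real.sqrt_nonneg _
    have hbb : b (b (e i)) = l i • e i := by
      rw [← hTe]
      refine ext_inner_right ℝ fun w => ?_
      have h1 := hb.selfAdjoint (b (e i)) w
      have h2 := hb.pullback (e i) w
      rw [hT]
      exact h1.trans h2
    set u := b (e i) - m • e i with hu
    have hbu : b u = -(m • u) := by
      rw [hu, map_sub, map_smul, hbb, ← hm2]
      module
    have h3 := hb.nonneg u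
    simp only [hbu, inner_neg_left, real_inner_smul_left] at h3
    have hu0 : u = 0 := by
      rcases hm0.eq_or_lt with h0 | h0
      · have h4 := hb.pullback (e i) (e i)
        rw [← hT, hTe] at h4
        have h5 : l i = 0 := by
          rw [← hm2, ← h0]; simp
        have h6 : b (e i) = 0 := by
          rw [← inner_self_eq_zero (𝕜 := ℝ)]
          exact h4.trans (by simp [h5])
        rw [hu, h6, ← h0]; simp
      · rw [← inner_self_eq_zero (𝕜 := ℝ)]
        have h7 : 0 ≤ inner ℝ u u := real_inner_self_nonneg
        nlinarith
    exact sub_eq_zero.1 hu0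
  have ex : ∃ b : V →ₗ[ℝ] V, ∀ i, b (e i) = √(l i) • e i :=
    ⟨e.toBasis.constr ℝ fun i => √(l i) • e i, fun i => by
      have := e.toBasis.constr_basis ℝ (fun i => √(l i) • e i) i
      rwa [OrthonormalBasis.coe_toBasis] at this⟩
  obtain ⟨b, hb⟩ := ex
  have bs : ∀ v w, inner ℝ (b v) w = ∑ i, √(l i) * (inner ℝ (e i) v * inner ℝ (e i) w) := by
    intro v w
    conv_lhs => rw [← e.sum_repr' v]
    rw [map_sum, sum_inner]
    refine Finset.sum_congr rfl fun i _ => ?_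
    rw [map_smul, hb, real_inner_smul_left, real_inner_smul_left]; ring
  refine ⟨b, ⟨fun v w => ?_, fun v => ?_, fun v w => ?_⟩, fun b' hb' => ?_⟩
  · rw [bs, real_inner_comm, bs]
    exact Finset.sum_congr rfl fun i _ => by ring
  · rw [bs]
    exact Finset.sum_nonneg fun i _ => mul_nonneg (Real.sqrt_nonneg _) (mul_self_nonneg _)
  · rw [← hT, bs]
    have h1 : ∀ i, inner ℝ (e i) (b w) = √(l i) * inner ℝ (e i) w := by
      intro i
      rw [real_inner_comm, bs, Finset.sum_eq_single i]
      · simp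
      · intro j _ hj
        simp [e.inner_eq_zero hj]
      · simp
    conv_rhs => rw [← e.sum_repr' v]
    rw [map_sum, sum_inner]
    refine Finset.sum_congr rfl fun i _ => ?_
    rw [h1, map_smul, hTe, real_inner_smul_left, real_inner_smul_left]
    have := Real.mul_self_sqrt (hl i)
    linear_combination (inner ℝ (e i) v * inner ℝ (e i) w) * this
  · refine e.toBasis.ext fun i => ?_
    simp only [OrthonormalBasis.coe_toBasis]
    rw [hb, key b' hb']

/-- Existence and uniqueness of the polar factor. -/
theorem existsUnique_isPolarFactor [FiniteDimensional ℝ V] (g q : V →ₗ[ℝ] V →ₗ[ℝ] ℝ)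
    (hgs : ∀ v w, g v w = g w v) (hgp : ∀ v, v ≠ 0 → 0 < g v v)
    (hqs : ∀ v w, q v w = q w v) (hqp : ∀ v, 0 ≤ q v v) :
    ∃! b : V →ₗ[ℝ] V, IsPolarFactor (fun v w => g v w) (fun v w => q v w) b := by
  let c : InnerProductSpace.Core ℝ V :=
    { inner := fun v w => g v w
      conj_inner_symm := fun v w => by simp [hgs v w]
      re_inner_nonneg := fun v => by
        by_cases hv : v = 0
        · simp [hv]
        · simpa using (hgp v hv).le
      add_left := fun u v w => by simp
      smul_left := fun u v r => by simp
      definite := fun v hv => by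
        by_contra h0
        exact (hgp v h0).ne' hv }
  let _ : NormedAddCommGroup V := c.toNormedAddCommGroup
  let _ : InnerProductSpace ℝ V := InnerProductSpace.ofCore c.toCore
  exact existsUnique_isPolarFactor_inner q hqs hqp

end Schatten

/-! ### Hyperbolic space and its orientation-preserving isometries -/

/-- The ambient space of complex `2 × 2` matrices. -/
abbrev Mat : Type := Matrix (Fin 2) (Fin 2) ℂ

/-- The ambient space as a normed space. -/
abbrev Entries : Type := Fin 2 → Fin 2 → ℂ

/-- The entries of a matrix. -/
def entries (X : Mat) : Entries := fun i j => X i j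

/-- The polarization of `-det`; on Hermitian matrices it is the Minkowski form. -/
def mink (X Y : Mat) : ℝ := ((X * Y).trace - X.trace * Y.trace).re / 2

/-- Hyperbolic 3-space as the upper sheet of the unit hyperboloid in the Minkowski space of
Hermitian `2 × 2` matrices with the form `-det`. Its Riemannian metric is the restriction of
`mink` to the tangent spaces. -/
abbrev H3 : Type :=
  {X : Mat // X.IsHermitian ∧ X.det = 1 ∧ 0 < X.trace.re}

/-- The tangent space of hyperbolic 3-space at `x`. -/
def H3.tangent (x : H3) : Submodule ℝ Mat where
  carrier := {v | v.IsHermitian ∧ mink x v = 0}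
  add_mem' := by
    rintro a b ⟨ha, ha'⟩ ⟨hb, hb'⟩
    refine ⟨ha.add hb, ?_⟩
    simp only [mink, Matrix.trace_add, mul_add, Complex.add_re,
      Complex.sub_re] at *
    linarith
  zero_mem' := by simp [mink]
  smul_mem' := by
    rintro r a ⟨ha, ha'⟩
    refine ⟨?_, ?_⟩
    · rw [Matrix.IsHermitian, Matrix.conjTranspose_smul, ha.eq]; simp
    · have : mink x (r • a) = r * mink x a := by
        simp [mink, Matrix.trace_smul, Complex.mul_re]
        ring
      rw [this, ha', mul_zero]

/-- `sinh r / r`, extended by `1` at `r = 0`. -/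
def sinhc (r : ℝ) : ℝ := if r = 0 then 1 else Real.sinh r / r

/-- The hyperbolic norm of a tangent vector. -/
def tnorm (v : Mat) : ℝ := √(mink v v)

theorem hermitian_coords {X : Mat} (h : X.IsHermitian) :
    ∃ a b c d : ℝ, X = !![((a + b : ℝ) : ℂ), ⟨c, d⟩; ⟨c, -d⟩, ((a - b : ℝ) : ℂ)] := by
  have h00 : (X 0 0).im = 0 := by
    have := congrArg Complex.im (h.apply 0 0)
    simp at this; linarith
  have h11 : (X 1 1).im = 0 := by
    have := congrArg Complex.im (h.apply 1 1)
    simp at this; linarith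
  have h10 : X 1 0 = star (X 0 1) := (h.apply 1 0).symm
  refine ⟨((X 0 0).re + (X 1 1).re) / 2, ((X 0 0).re - (X 1 1).re) / 2,
    (X 0 1).re, (X 0 1).im, ?_⟩
  ext i j
  fin_cases i <;> fin_cases j <;> apply Complex.ext <;> simp [h00, h11, h10] <;> ring

theorem tnorm_sq (x : H3) {v : Mat} (hv : v ∈ x.tangent) :
    0 ≤ mink v v := by
  obtain ⟨x, hx, hd, ht⟩ := x
  obtain ⟨hv, ho⟩ := hv
  obtain ⟨a, b, c, d, rfl⟩ := hermitian_coords hx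
  obtain ⟨a', b', c', d', rfl⟩ := hermitian_coords hv
  have hd' := congrArg Complex.re hd
  simp [mink, Matrix.det_fin_two, Matrix.trace_fin_two] at *
  ring_nf at *
  have e1 : a ^ 2 = 1 + b ^ 2 + c ^ 2 + d ^ 2 := by linarith
  have e2 : a' * a = b * b' + c * c' + d * d' := by linarith
  have cs : (a' * a) ^ 2 ≤ (b ^ 2 + c ^ 2 + d ^ 2) * (b' ^ 2 + c' ^ 2 + d' ^ 2) := by
    rw [e2]
    nlinarith [sq_nonneg (b * c' - c * b'), sq_nonneg (b * d' - d * b'),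
      sq_nonneg (c * d' - d * c')]
  by_contra hlt
  push Not at hlt
  have e3 : b' ^ 2 + c' ^ 2 + d' ^ 2 < a' ^ 2 := by linarith
  nlinarith [mul_pow a' a 2, sq_nonneg a', sq_nonneg b, sq_nonneg c, sq_nonneg d,
    mul_nonneg (add_nonneg (add_nonneg (sq_nonneg b) (sq_nonneg c)) (sq_nonneg d))
      (sub_nonneg.2 e3.le)]

theorem sinhc_mul (r : ℝ) : sinhc r * r = Real.sinh r := by
  unfold sinhc
  split_ifs with h
  · simp [h]
  · field_simp

theorem exp_mem (x : H3) (v : x.tangent) :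
    (Real.cosh (tnorm v) • (x : Mat) + sinhc (tnorm v) • (v : Mat)).IsHermitian ∧
    (Real.cosh (tnorm v) • (x : Mat) + sinhc (tnorm v) • (v : Mat)).det = 1 ∧
    0 < (Real.cosh (tnorm v) • (x : Mat) + sinhc (tnorm v) • (v : Mat)).trace.re := by
  have hsq : tnorm v ^ 2 = mink v v := Real.sq_sqrt (tnorm_sq x v.2)
  have hr0 : 0 ≤ tnorm v := Real.sqrt_nonneg _
  have hs := sinhc_mul (tnorm v)
  have hcs := Real.cosh_sq (tnorm v)
  have hc := Real.cosh_pos (tnorm v)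
  generalize tnorm v = r at *
  generalize sinhc r = s at *
  generalize Real.cosh r = C at *
  generalize Real.sinh r = Sh at *
  obtain ⟨v, hv, ho⟩ := v
  obtain ⟨x, hx, hd, ht⟩ := x
  refine ⟨?_, ?_, ?_⟩
  · rw [Matrix.IsHermitian, Matrix.conjTranspose_add, Matrix.conjTranspose_smul,
      Matrix.conjTranspose_smul, hx.eq, hv.eq]; simp
  all_goals
    obtain ⟨a, b, c, d, rfl⟩ := hermitian_coords hx
    obtain ⟨a', b', c', d', rfl⟩ := hermitian_coords hv
    have hd' := congrArg Complex.re hd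
    simp [mink, Matrix.det_fin_two, Matrix.trace_fin_two] at hd' ho ht hsq
    ring_nf at hd' ho ht hsq
    have e1 : a ^ 2 = 1 + b ^ 2 + c ^ 2 + d ^ 2 := by linarith
    have e2 : a * a' = b * b' + c * c' + d * d' := by linarith
    have e3 : r ^ 2 = b' ^ 2 + c' ^ 2 + d' ^ 2 - a' ^ 2 := by linarith
  · apply Complex.ext
    · simp [Matrix.det_fin_two]
      subst hs
      linear_combination hcs + C ^ 2 * e1 + 2 * C * s * e2 + s ^ 2 * e3
    · simp [Matrix.det_fin_two]
      ring
  · simp [Matrix.trace_fin_two]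
    have ha : 0 < a := by linarith
    have cs : (a * a') ^ 2 ≤ (b ^ 2 + c ^ 2 + d ^ 2) * (b' ^ 2 + c' ^ 2 + d' ^ 2) := by
      rw [e2]
      nlinarith [sq_nonneg (b * c' - c * b'), sq_nonneg (b * d' - d * b'),
        sq_nonneg (c * d' - d * c')]
    have e4 : a' ^ 2 ≤ r ^ 2 * (a ^ 2 - 1) := by
      have : b ^ 2 + c ^ 2 + d ^ 2 = a ^ 2 - 1 := by linarith
      rw [this] at cs
      have : b' ^ 2 + c' ^ 2 + d' ^ 2 = r ^ 2 + a' ^ 2 := by linarith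
      rw [this] at cs
      nlinarith
    have e5 : (s * a') ^ 2 < (C * a) ^ 2 := by
      have h1 : (s * a') ^ 2 ≤ Sh ^ 2 * (a ^ 2 - 1) := by
        rw [← hs, mul_pow, mul_pow, mul_assoc]
        exact mul_le_mul_of_nonneg_left e4 (sq_nonneg s)
      have h2 : (C * a) ^ 2 = Sh ^ 2 * (a ^ 2 - 1) + Sh ^ 2 + a ^ 2 := by
        rw [mul_pow, hcs]; ring
      nlinarith [sq_nonneg Sh, sq_pos_of_pos ha]
    have e6 := abs_lt_of_sq_lt_sq e5 (mul_pos hc ha).le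
    have e7 := (abs_lt.1 (abs_lt_of_sq_lt_sq e5 (mul_pos hc ha).le)).1
    linarith

/-- The Riemannian exponential map of hyperbolic 3-space in the hyperboloid model. -/
def H3.exp (x : H3) (v : x.tangent) : H3 :=
  ⟨Real.cosh (tnorm v) • (x : Mat) + sinhc (tnorm v) • (v : Mat), exp_mem x v⟩

theorem mink_add_smul (x v : Mat) (a b : ℝ) :
    mink (a • x + b • v) (a • x + b • v) =
      a ^ 2 * mink x x + 2 * (a * b) * mink x v + b ^ 2 * mink v v := by
  simp [mink, Matrix.trace_fin_two, Matrix.mul_apply, Fin.sum_univ_two]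
  ring

theorem mink_self (x : H3) : mink x x = -1 := by
  have h := congrArg Complex.re x.2.2.1
  simp [mink, Matrix.trace_fin_two, Matrix.mul_apply, Fin.sum_univ_two, Matrix.det_fin_two] at *
  linarith

theorem H3.exp_smul (x : H3) (v : x.tangent) (t : ℝ) :
    (x.exp (t • v) : Mat) = Real.cosh (t * tnorm v) • (x : Mat) +
      (t * sinhc (t * tnorm v)) • (v : Mat) := by
  have h1 : tnorm (t • v : x.tangent) = |t| * tnorm v := by
    have := mink_add_smul 0 (v : Mat) 0 t
    simp at this
    rw [tnorm, Submodule.coe_smul, this, Real.sqrt_mul (sq_nonneg t), Real.sqrt_sq_eq_abs]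
    rfl
  have h2 : ∀ a r : ℝ, Real.cosh (|a| * r) = Real.cosh (a * r) ∧
      sinhc (|a| * r) = sinhc (a * r) := by
    intro a r
    rcases abs_choice a with h | h <;> rw [h] <;> simp [sinhc, neg_div_neg_eq]
  change Real.cosh (tnorm (t • v : x.tangent)) • (x : Mat) +
    sinhc (tnorm (t • v : x.tangent)) • (t • (v : Mat)) = _
  rw [h1, (h2 t _).1, (h2 t _).2, smul_smul, mul_comm (sinhc _) t]

/-- The curves `t ↦ exp (t v)` are the geodesics of the hyperboloid: they satisfy
`c'' = ⟨c', c'⟩ c`, `c 0 = x`, `c' 0 = v`. -/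
theorem H3.exp_isGeodesic (x : H3) (v : x.tangent) :
    ∃ c' : ℝ → Mat,
      (∀ t i j, HasDerivAt (fun t => (x.exp (t • v) : Mat) i j) (c' t i j) t) ∧
      (∀ t i j, HasDerivAt (fun t => c' t i j)
        (mink (c' t) (c' t) • (x.exp (t • v) : Mat) i j) t) ∧
      (x.exp ((0 : ℝ) • v) : Mat) = x ∧ c' 0 = v := by
  have hr2 : tnorm v ^ 2 = mink v v := Real.sq_sqrt (tnorm_sq x v.2)
  have hE : ∀ t : ℝ, t * sinhc (t * tnorm v) =
      if tnorm v = 0 then t else Real.sinh (t * tnorm v) / tnorm v := by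
    intro t
    split_ifs with h
    · simp [h, sinhc]
    · rw [eq_div_iff h, ← sinhc_mul]; ring
  have hd : ∀ t : ℝ, HasDerivAt (fun t => t * sinhc (t * tnorm v)) (Real.cosh (t * tnorm v)) t := by
    intro t
    simp only [hE]
    split_ifs with h
    · simpa [h] using hasDerivAt_id' t
    · have := (((hasDerivAt_id t).mul_const (tnorm v)).sinh).div_const (tnorm v)
      simpa [h] using this
  have hc : ∀ t : ℝ, HasDerivAt (fun t => Real.cosh (t * tnorm v))
      (Real.sinh (t * tnorm v) * tnorm v) t := by
    intro t
    simpa using ((hasDerivAt_id t).mul_const (tnorm v)).cosh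
  have hs : ∀ t : ℝ, HasDerivAt (fun t => Real.sinh (t * tnorm v) * tnorm v)
      (Real.cosh (t * tnorm v) * mink v v) t := by
    intro t
    have := ((hasDerivAt_id' t).mul_const (tnorm v)).sinh.mul_const (tnorm v)
    rw [← hr2]
    refine this.congr_deriv ?_
    ring
  refine ⟨fun t => (Real.sinh (t * tnorm v) * tnorm v) • (x : Mat) +
    Real.cosh (t * tnorm v) • (v : Mat), fun t i j => ?_, fun t i j => ?_, ?_, ?_⟩
  · simp only [H3.exp_smul]
    exact ((hc t).smul_const ((x : Mat) i j)).add ((hd t).smul_const ((v : Mat) i j))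
  · rw [mink_add_smul, mink_self, v.2.2, H3.exp_smul]
    have e : (Real.sinh (t * tnorm v) * tnorm v) ^ 2 * -1 +
        2 * (Real.sinh (t * tnorm v) * tnorm v * Real.cosh (t * tnorm v)) * 0 +
        Real.cosh (t * tnorm v) ^ 2 * mink v v = mink v v := by
      rw [← hr2, Real.cosh_sq]; ring
    rw [e]
    have := ((hs t).smul_const ((x : Mat) i j)).add ((hc t).smul_const ((v : Mat) i j))
    refine this.congr_deriv ?_
    have h3 := sinhc_mul (t * tnorm v)
    rw [Matrix.add_apply, Matrix.smul_apply, Matrix.smul_apply, smul_add, smul_smul, smul_smul,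
      ← h3, ← hr2]
    congr 2 <;> ring
  · rw [H3.exp_smul]; simp
  · simp

/-- `A ∈ SL(2, ℂ)` acts linearly by `X ↦ A X Aᴴ`. -/
def slAction : SL(2, ℂ) →* Module.End ℝ Mat where
  toFun A :=
    { toFun := fun X => (A : Mat) * X * (A : Mat)ᴴ
      map_add' := fun X Y => by simp [Matrix.mul_add, Matrix.add_mul]
      map_smul' := fun r X => by simp }
  map_one' := by ext1 X; simp
  map_mul' A B := by ext1 X; simp [Matrix.mul_assoc]

/-- `PSL(2, ℂ)` as the group of orientation-preserving isometries of hyperbolic 3-space; each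
element acts through a linear map of the ambient space, so that the same map describes
the isometry and its differential. -/
def pslAction : Matrix.ProjectiveSpecialLinearGroup (Fin 2) ℂ →* Module.End ℝ Mat :=
  QuotientGroup.lift _ slAction fun A hA => by
    obtain ⟨r, hr, hA⟩ := Matrix.SpecialLinearGroup.mem_center_iff.1 hA
    have hr' : r = 1 ∨ r = -1 := by simpa using hr
    ext1 X
    change (A : Mat) * X * (A : Mat)ᴴ = X
    rw [← hA]
    rcases hr' with rfl | rfl
    · simp
    · ext i j
      simp [Matrix.diagonal_mul, Matrix.mul_diagonal]

/-! ### The surface, its metric and its universal cover -/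

/-- The model plane. -/
abbrev E2 : Type := EuclideanSpace ℝ (Fin 2)

section Surface

variable {S : Type*} [TopologicalSpace S] [ChartedSpace E2 S] [IsManifold (𝓡 2) ∞ S]
variable {St : Type*} [TopologicalSpace St] [ChartedSpace E2 St] [IsManifold (𝓡 2) ∞ St]

variable (S) in
/-- Smooth Riemannian metrics on the surface `S`. -/
abbrev Metric : Type _ :=
  Bundle.ContMDiffRiemannianMetric (𝓡 2) ∞ E2 (fun x : S => TangentSpace (𝓡 2) x)

/-- The Poincaré metric `(dx² + dy²) / y²` of the upper half-plane at `z`. -/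
def poincare (z a b : ℂ) : ℝ := (a.re * b.re + a.im * b.im) / z.im ^ 2

/-- The metric is hyperbolic: around each point there is a smooth map to the upper half-plane
that pulls the Poincaré metric back to it. -/
def IsHyperbolic (h : Metric S) : Prop :=
  ∀ x : S, ∃ U : Set S, IsOpen U ∧ x ∈ U ∧ ∃ φ : S → ℂ,
    ContMDiffOn (𝓡 2) 𝓘(ℝ, ℂ) ∞ φ U ∧
    ∀ y ∈ U, 0 < (φ y).im ∧ ∀ v w : TangentSpace (𝓡 2) y,
      h.inner y v w = poincare (φ y) (mfderiv (𝓡 2) 𝓘(ℝ, ℂ) φ y v) (mfderiv (𝓡 2) 𝓘(ℝ, ℂ) φ y w)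

/-- The coefficients of the metric in the preferred chart at `x`, at the coordinate point `y`. -/
def gram (h : Metric S) (x : S) (y : E2) : Matrix (Fin 2) (Fin 2) ℝ :=
  Matrix.of fun i j =>
    h.inner ((chartAt E2 x).symm y)
      (mfderiv (𝓡 2) (𝓡 2) (chartAt E2 x).symm y (EuclideanSpace.single i (1 : ℝ) : E2))
      (mfderiv (𝓡 2) (𝓡 2) (chartAt E2 x).symm y (EuclideanSpace.single j (1 : ℝ) : E2))

/-- The area measure `√(det g) dy₁ dy₂` of the domain of the preferred chart at `x`. -/
def chartArea [MeasurableSpace S] (h : Metric S) (x : S) : Measure S :=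
  ((volume.restrict (chartAt E2 x).target).withDensity
    fun y => ENNReal.ofReal √((gram h x y).det)).map (chartAt E2 x).symm

/-- The area measure of `(S, h)`: the supremum of the (mutually compatible) area measures
of the chart domains. -/
def area [MeasurableSpace S] (h : Metric S) : Measure S := ⨆ x : S, chartArea h x

/-- `π` is a smooth universal covering map. -/
structure IsUniversalCover (π : St → S) : Prop where
  isCoveringMap : IsCoveringMap π
  isLocalDiffeomorph : IsLocalDiffeomorph (𝓡 2) (𝓡 2) ∞ π
  surjective : Function.Surjective π
  simplyConnected : SimplyConnectedSpace St


/-- The group of deck transformations of `π`, that is, the fundamental group of `S`. -/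
def deckGroup (π : St → S) : Subgroup (St ≃ₜ St) where
  carrier := {γ | ∀ p, π (γ p) = π p}
  mul_mem' {a b} ha hb p := by
    change π (a (b p)) = π p
    rw [ha, hb]
  one_mem' _ := rfl
  inv_mem' {a} ha p := by
    have h1 := ha (a⁻¹ p)
    have h2 : a (a⁻¹ p) = p := a.apply_symm_apply p
    rw [h2] at h1
    exact h1.symm

/-! ### Equivariant maps, their energy and geodesic displacements -/

/-- The differential at `p` of a map into hyperbolic 3-space, with values in the ambient space. -/
def diff (f : St → H3) (p : St) (v : TangentSpace (𝓡 2) p) : Mat :=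
  Matrix.of (mfderiv (𝓡 2) 𝓘(ℝ, Entries) (fun p => entries (f p)) p v : Entries)

/-- `f` is a smooth `ρ`-equivariant map from the universal cover to hyperbolic 3-space. -/
structure IsEquivariantMap (π : St → S)
    (ρ : deckGroup π →* Matrix.ProjectiveSpecialLinearGroup (Fin 2) ℂ) (f : St → H3) : Prop where
  smooth : ContMDiff (𝓡 2) 𝓘(ℝ, Entries) ∞ fun p => entries (f p)
  equivariant : ∀ (γ : deckGroup π) (p : St), (f (γ.1 p) : Mat) = pslAction (ρ γ) (f p : Mat)

/-- `X` is a smooth `ρ`-invariant section of the pull-back by `f` of the tangent bundle of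
hyperbolic 3-space. -/
structure IsInvariantSection (π : St → S)
    (ρ : deckGroup π →* Matrix.ProjectiveSpecialLinearGroup (Fin 2) ℂ) (f : St → H3)
    (X : ∀ p : St, (f p).tangent) : Prop where
  smooth : ContMDiff (𝓡 2) 𝓘(ℝ, Entries) ∞ fun p => entries (X p)
  invariant : ∀ (γ : deckGroup π) (p : St), (X (γ.1 p) : Mat) = pslAction (ρ γ) (X p : Mat)

/-- The `1`-Schatten norm of the differential of `f` at `p`, for the metric on the tangent space
at `p` pulled back from `h` by `π` and the hyperbolic metric on the target. -/
def schattenNormUp (h : Metric S) (π : St → S) (f : St → H3) (p : St) : ℝ :=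
  schattenOne (V := TangentSpace (𝓡 2) p)
    (fun v w => h.inner (π p) (mfderiv (𝓡 2) (𝓡 2) π p v) (mfderiv (𝓡 2) (𝓡 2) π p w))
    (fun v w => mink (diff f p v) (diff f p w))

/-- The `1`-Schatten norm as a function on `S`: its value at `x` is the `1`-Schatten norm at a lift
of `x` (for an equivariant map, at any lift). -/
def schattenNorm (h : Metric S) {π : St → S} (hπ : IsUniversalCover π) (f : St → H3) (x : S) : ℝ :=
  schattenNormUp h π f (Function.surjInv hπ.surjective x)

/-- The `1`-Schatten energy. -/
def energy [MeasurableSpace S] (h : Metric S) {π : St → S} (hπ : IsUniversalCover π)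
    (f : St → H3) : ℝ :=
  ∫ x, schattenNorm h hπ f x ∂(area h)

/-- The geodesic displacement of `f` along `X` at time `t`. -/
def displacement {A : Type*} (f : A → H3) (X : ∀ p : A, (f p).tangent) (t : ℝ) (p : A) : H3 :=
  (f p).exp (t • X p)

/-- `f` is an immersion. -/
def IsImmersionMap (f : St → H3) : Prop := ∀ p, Function.Injective (diff f p)

end Surface

end SchattenEnergy

end

/-! The statement is pointwise on the surface; the energy inherits it by integration. Fix a point
and put `r = |X|` there. In a parallel frame along the geodesic `t ↦ exp (t X)` whose first vector
is tangent to it, the columns of the displaced differential are Jacobi fields: the first coordinate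
is affine in `t`, the other two solve `y'' = r² y` (`mink_diff_displacement`). After
orthonormalizing the source, the `1`-Schatten norm is the trace norm `N(t)` of a `3 × 2` matrix
`J(t)` of such fields (`exists_jacobi`).

Convexity. At `a s + b t` with `a + b = 1`, an affine function is interpolated with weights `a, b`,
whereas a solution of `y'' = r² y` is interpolated with smaller nonnegative weights `m ≤ a`, `n ≤ b`
(`exists_interpolation`). Hence `J(a s + b t)` is the sum of `diag(a, m, m) J(s)` and `diag(b, n, n)
J(t)`. The triangle inequality and the fact that such a stretch multiplies the trace norm by at most
`a` give convexity (`convexOn_traceNorm_jacobi`). The triangle inequality comes from writing the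
trace norm of `(u, v)` as the maximum over unit vectors `n` of the quaternion norm `|u + v n|`.

Positivity. `J(t) + J(-t) = 2 diag(1, C, C) J(0)` with `C = cosh (t r)`. Testing against the unit
normal of `J(0)` gives `N(t) + N(-t) - 2 N(0) ≥ 2 (√(N(0)² + r² A t²) - N(0))`, where `A` is the
area factor of `J(0)` (`traceNorm_jacobi_second_difference`). For an immersion `A > 0`, so near a
point with `X ≠ 0` this is at least `c t²` with a uniform `c > 0`; elsewhere the second difference
is nonnegative by convexity. Integrating, the energy has a symmetric second difference of at least
`c' t²`.

Regularity. For an immersion the norm is a smooth function of `t` and of chart coordinates near `t =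
0`, since the square roots in `gramNorm` stay away from zero. Compactness allows differentiation
under the integral twice, and the lower bound on the second difference passes to the second
derivative. -/

namespace SchattenEnergy

set_option linter.unusedSectionVars false

/-! ### Entire functions of the square of the distance -/

/-- The entire function `u ↦ ∑ uⁿ / (2n)!`, equal to `cosh √u` for `u ≥ 0`. -/
noncomputable def coshSqrt : ℝ → ℝ :=
  FormalMultilinearSeries.ofScalarsSum (fun n : ℕ => (((2 * n).factorial : ℕ) : ℝ)⁻¹)

/-- The entire function `u ↦ ∑ uⁿ / (2n+1)!`, equal to `sinh √u / √u` for `u > 0`. -/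
noncomputable def sinhcSqrt : ℝ → ℝ :=
  FormalMultilinearSeries.ofScalarsSum (fun n : ℕ => (((2 * n + 1).factorial : ℕ) : ℝ)⁻¹)

/-- Consecutive coefficients have ratio at most `1 / (n + 1)`, so the radius of convergence is
infinite. Power series in the squared length are needed because `tnorm` itself is not smooth at `0`,
and `X` may vanish. -/
theorem contDiff_ofScalarsSum {c : ℕ → ℝ} (hc : ∀ n, 0 < c n)
    (hc' : ∀ n : ℕ, ((n : ℝ) + 1) * c (n + 1) ≤ c n) :
    ContDiff ℝ ∞ (FormalMultilinearSeries.ofScalarsSum (E := ℝ) c) := by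
  have h : (FormalMultilinearSeries.ofScalars ℝ c).radius = ⊤ := by
    refine FormalMultilinearSeries.ofScalars_radius_eq_top_of_tendsto ℝ _
      (Eventually.of_forall fun n => (hc n).ne') ?_
    refine squeeze_zero (fun n => by positivity) (fun n => ?_)
      (tendsto_one_div_add_atTop_nhds_zero_nat (𝕜 := ℝ))
    rw [Nat.succ_eq_add_one, Real.norm_of_nonneg (hc _).le, Real.norm_of_nonneg (hc _).le,
      div_le_div_iff₀ (hc n) (by positivity)]
    linarith [hc' n]
  have h1 := (FormalMultilinearSeries.ofScalars ℝ c).hasFPowerSeriesOnBall (h ▸ ENNReal.coe_lt_top)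
  have h2 := h1.analyticOnNhd
  rw [h] at h2
  simp only [Metric.eball_top] at h2
  exact h2.contDiff

theorem mul_inv_factorial_le (n m k : ℕ) (h : k = m + 2) (hn : n ≤ m) :
    ((n : ℝ) + 1) * ((k.factorial : ℕ) : ℝ)⁻¹ ≤ ((m.factorial : ℕ) : ℝ)⁻¹ := by
  subst h
  have h0 : (0 : ℝ) < (m.factorial : ℝ) := by positivity
  have h1 : (n : ℝ) ≤ m := by exact_mod_cast hn
  rw [Nat.factorial_succ, Nat.factorial_succ]
  push_cast
  rw [← div_eq_mul_inv, ← one_div, div_le_div_iff₀ (by positivity) h0]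
  nlinarith [mul_nonneg (Nat.cast_nonneg (α := ℝ) n) (Nat.cast_nonneg (α := ℝ) m),
    mul_nonneg h0.le (sub_nonneg.2 h1), mul_nonneg h0.le (Nat.cast_nonneg (α := ℝ) m),
    mul_nonneg h0.le (mul_nonneg (Nat.cast_nonneg (α := ℝ) m) (Nat.cast_nonneg (α := ℝ) m))]

theorem contDiff_coshSqrt : ContDiff ℝ ∞ coshSqrt :=
  contDiff_ofScalarsSum (fun n => by positivity)
    fun n => mul_inv_factorial_le n (2 * n) _ (by ring) (by omega)

theorem contDiff_sinhcSqrt : ContDiff ℝ ∞ sinhcSqrt :=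
  contDiff_ofScalarsSum (fun n => by positivity)
    fun n => mul_inv_factorial_le n (2 * n + 1) _ (by ring) (by omega)

theorem coshSqrt_sq (r : ℝ) : coshSqrt (r ^ 2) = Real.cosh r := by
  rw [coshSqrt, FormalMultilinearSeries.ofScalars_sum_eq, ← (Real.hasSum_cosh r).tsum_eq]
  exact tsum_congr fun n => by rw [smul_eq_mul, ← pow_mul, div_eq_inv_mul]

theorem sinhcSqrt_sq_mul (r : ℝ) : sinhcSqrt (r ^ 2) * r = Real.sinh r := by
  rw [sinhcSqrt, FormalMultilinearSeries.ofScalars_sum_eq, ← (Real.hasSum_sinh r).tsum_eq,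
    ← tsum_mul_right]
  exact tsum_congr fun n => by rw [smul_eq_mul, ← pow_mul, div_eq_inv_mul, mul_assoc, pow_succ]

theorem sinhcSqrt_zero : sinhcSqrt 0 = 1 := by
  simp [sinhcSqrt]

theorem sinhcSqrt_sq (r : ℝ) : sinhcSqrt (r ^ 2) = sinhc r := by
  by_cases h : r = 0
  · simp [h, sinhc, sinhcSqrt_zero]
  · rw [sinhc, if_neg h, eq_div_iff h, sinhcSqrt_sq_mul]

theorem hasDerivAt_coshSqrt (u : ℝ) : HasDerivAt coshSqrt (deriv coshSqrt u) u :=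
  (contDiff_coshSqrt.differentiable (by simp) u).hasDerivAt

theorem hasDerivAt_sinhcSqrt (u : ℝ) : HasDerivAt sinhcSqrt (deriv sinhcSqrt u) u :=
  (contDiff_sinhcSqrt.differentiable (by simp) u).hasDerivAt

/-- Differentiate `coshSqrt (r ^ 2) = cosh r`. Keeping the factor `2 * r` on the left avoids a case
distinction at `r = 0`. -/
theorem two_mul_deriv_coshSqrt (r : ℝ) : 2 * r * deriv coshSqrt (r ^ 2) = Real.sinh r := by
  have h1 : HasDerivAt (fun r : ℝ => coshSqrt (r ^ 2)) (deriv coshSqrt (r ^ 2) * (2 * r)) r :=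
    ((hasDerivAt_coshSqrt (r ^ 2)).comp r (hasDerivAt_pow 2 r)).congr_deriv (by simp)
  simp only [coshSqrt_sq] at h1
  rw [← h1.unique (Real.hasDerivAt_cosh r)]
  ring

theorem two_mul_deriv_sinhcSqrt (r : ℝ) :
    2 * r ^ 2 * deriv sinhcSqrt (r ^ 2) = Real.cosh r - sinhc r := by
  have h1 : HasDerivAt (fun r : ℝ => sinhcSqrt (r ^ 2) * r)
      (deriv sinhcSqrt (r ^ 2) * (2 * r) * r + sinhcSqrt (r ^ 2) * 1) r :=
    (((hasDerivAt_sinhcSqrt (r ^ 2)).comp r (hasDerivAt_pow 2 r)).mul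
      (hasDerivAt_id' r)).congr_deriv (by simp [sinhcSqrt])
  simp only [sinhcSqrt_sq_mul] at h1
  rw [← h1.unique (Real.hasDerivAt_sinh r), sinhcSqrt_sq]
  ring

/-! ### Hyperbolic functions -/

/-- Convexity of `sinh` on the half-line together with `sinh 0 = 0`. This is where negative
curvature enters the convexity of the energy. -/
theorem sinh_mul_le {c x : ℝ} (hc : 0 ≤ c) (hc1 : c ≤ 1) (hx : 0 ≤ x) :
    Real.sinh (c * x) ≤ c * Real.sinh x := by
  have h : ConvexOn ℝ (Ici (0 : ℝ)) Real.sinh := by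
    refine convexOn_of_deriv2_nonneg (convex_Ici 0) Real.continuous_sinh.continuousOn
      Real.differentiable_sinh.differentiableOn ?_ ?_
    · rw [Real.deriv_sinh]; exact Real.differentiable_cosh.differentiableOn
    · intro y hy
      rw [interior_Ici] at hy
      simp only [Function.iterate_succ, Function.iterate_zero, Function.comp, Real.deriv_sinh,
        Real.deriv_cosh, id]
      exact Real.sinh_nonneg_iff.2 (le_of_lt hy)
  have := h.2 (mem_Ici.2 le_rfl) (mem_Ici.2 hx) (sub_nonneg.2 hc1) hc (by ring)
  simpa using this

theorem one_add_sq_div_two_le_cosh (x : ℝ) : 1 + x ^ 2 / 2 ≤ Real.cosh x := by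
  have h1 : Real.cosh x = 1 + 2 * Real.sinh (x / 2) ^ 2 := by
    have := Real.cosh_two_mul (x / 2)
    rw [mul_div_cancel₀ x (two_ne_zero)] at this
    rw [this, Real.cosh_sq]; ring
  have h2 : ∀ y : ℝ, y ^ 2 ≤ Real.sinh y ^ 2 := by
    intro y
    rcases le_total 0 y with h | h
    · have := Real.self_le_sinh_iff.2 h; nlinarith
    · have := Real.sinh_le_self_iff.2 h; nlinarith
  have := h2 (x / 2)
  rw [h1]; nlinarith

theorem mul_sinhc_mul {r : ℝ} (hr : r ≠ 0) (t : ℝ) : t * sinhc (t * r) = Real.sinh (t * r) / r := by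
  rw [eq_div_iff hr, ← sinhc_mul]; ring

/-- Solutions of `y'' = r² y` at a convex combination of two points. -/
theorem exists_interpolation {r s t a b : ℝ} (hr : 0 ≤ r) (hst : s < t) (ha : 0 ≤ a) (hb : 0 ≤ b)
    (hab : a + b = 1) : ∃ m n : ℝ, 0 ≤ m ∧ m ≤ a ∧ 0 ≤ n ∧ n ≤ b ∧
      Real.cosh ((a * s + b * t) * r) = m * Real.cosh (s * r) + n * Real.cosh (t * r) ∧
      (a * s + b * t) * sinhc ((a * s + b * t) * r) =
        m * (s * sinhc (s * r)) + n * (t * sinhc (t * r)) := by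
  rcases hr.eq_or_lt with rfl | hr
  · exact ⟨a, b, ha, le_rfl, hb, le_rfl, by simp [hab], by simp [sinhc]⟩
  set d := (t - s) * r with hd
  have hd0 : 0 < d := mul_pos (sub_pos.2 hst) hr
  have hS : 0 < Real.sinh d := Real.sinh_pos_iff.2 hd0
  have key : ∀ c, 0 ≤ c → c ≤ 1 →
      0 ≤ Real.sinh (c * d) / Real.sinh d ∧ Real.sinh (c * d) / Real.sinh d ≤ c := fun c h0 h1 =>
    ⟨div_nonneg (Real.sinh_nonneg_iff.2 (mul_nonneg h0 hd0.le)) hS.le,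
      (div_le_iff₀ hS).2 (sinh_mul_le h0 h1 hd0.le)⟩
  have e1 : (a * s + b * t) * r = s * r + b * d := by
    rw [hd]; linear_combination (s * r) * hab
  have e2 : t * r = s * r + d := by rw [hd]; ring
  have e3 : a * d = d - b * d := by linear_combination d * hab
  -- For `r > 0` a solution of `y'' = r² y` is determined by its values at `s` and `t`; these
  -- quotients are the interpolation weights, common to all solutions, and `sinh_mul_le` bounds them
  -- by `a` and `b`.
  refine ⟨Real.sinh (a * d) / Real.sinh d, Real.sinh (b * d) / Real.sinh d,
    (key a ha (by linarith)).1, (key a ha (by linarith)).2,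
    (key b hb (by linarith)).1, (key b hb (by linarith)).2, ?_, ?_⟩
  · rw [e1, e2, e3, Real.sinh_sub, Real.cosh_add, Real.cosh_add]
    field_simp
    ring
  · rw [mul_sinhc_mul hr.ne', mul_sinhc_mul hr.ne', mul_sinhc_mul hr.ne', e1, e2, e3,
      Real.sinh_sub, Real.sinh_add, Real.sinh_add]
    field_simp
    ring

/-! ### The trace norm of a pair of vectors in Euclidean 3-space -/

/-- The squared area of the parallelogram spanned by two vectors. -/
def areaSq (u v : Fin 3 → ℝ) : ℝ := (u ⬝ᵥ u) * (v ⬝ᵥ v) - (u ⬝ᵥ v) ^ 2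

/-- The trace norm of the `3 × 2` matrix with columns `u` and `v`. -/
noncomputable def traceNorm (u v : Fin 3 → ℝ) : ℝ := √(u ⬝ᵥ u + v ⬝ᵥ v + 2 * √(areaSq u v))

/-- The quaternion `u + v n`, where `u`, `v`, `n` are regarded as imaginary quaternions. -/
def quat (n u v : Fin 3 → ℝ) : Quaternion ℝ :=
  ⟨-(v ⬝ᵥ n), u 0 + (v 1 * n 2 - v 2 * n 1), u 1 + (v 2 * n 0 - v 0 * n 2),
    u 2 + (v 0 * n 1 - v 1 * n 0)⟩

theorem quat_add (n u v u' v' : Fin 3 → ℝ) :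
    quat n (u + u') (v + v') = quat n u v + quat n u' v' := by
  ext
  · rw [Quaternion.re_add]; simp only [quat, Matrix.vec3_dotProduct, Pi.add_apply]; ring
  · rw [Quaternion.imI_add]; simp only [quat, Pi.add_apply]; ring
  · rw [Quaternion.imJ_add]; simp only [quat, Pi.add_apply]; ring
  · rw [Quaternion.imK_add]; simp only [quat, Pi.add_apply]; ring

/-- The triple product `⟨n, u × v⟩`. -/
def triple (n u v : Fin 3 → ℝ) : ℝ := n ⬝ᵥ crossProduct u v

theorem triple_eq (n u v : Fin 3 → ℝ) : triple n u v =
    n 0 * (u 1 * v 2 - u 2 * v 1) + n 1 * (u 2 * v 0 - u 0 * v 2) +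
      n 2 * (u 0 * v 1 - u 1 * v 0) := by
  rw [triple, Matrix.vec3_dotProduct]
  simp [cross_apply]

theorem areaSq_eq (u v : Fin 3 → ℝ) : areaSq u v =
    (u 1 * v 2 - u 2 * v 1) ^ 2 + (u 2 * v 0 - u 0 * v 2) ^ 2 + (u 0 * v 1 - u 1 * v 0) ^ 2 := by
  simp only [areaSq, Matrix.vec3_dotProduct]; ring

theorem areaSq_nonneg (u v : Fin 3 → ℝ) : 0 ≤ areaSq u v := by
  rw [areaSq_eq]; positivity

theorem dotProduct_self_nonneg' (u : Fin 3 → ℝ) : 0 ≤ u ⬝ᵥ u := by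
  rw [Matrix.vec3_dotProduct]; nlinarith [sq_nonneg (u 0), sq_nonneg (u 1), sq_nonneg (u 2)]

/-- Right multiplication by a unit imaginary quaternion is an isometry, so only the cross term `2
⟨u, v × n⟩` is added to `|u|² + |v|²`. -/
theorem norm_quat_sq {n : Fin 3 → ℝ} (hn : n ⬝ᵥ n = 1) (u v : Fin 3 → ℝ) :
    ‖quat n u v‖ ^ 2 = u ⬝ᵥ u + v ⬝ᵥ v + 2 * triple n u v := by
  rw [sq, ← Quaternion.normSq_eq_norm_mul_self, Quaternion.normSq_def']
  rw [triple_eq]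
  simp only [quat, Matrix.vec3_dotProduct] at *
  linear_combination (v 0 ^ 2 + v 1 ^ 2 + v 2 ^ 2) * hn

theorem traceNorm_nonneg (u v : Fin 3 → ℝ) : 0 ≤ traceNorm u v := Real.sqrt_nonneg _

theorem traceNorm_sq (u v : Fin 3 → ℝ) :
    traceNorm u v ^ 2 = u ⬝ᵥ u + v ⬝ᵥ v + 2 * √(areaSq u v) :=
  Real.sq_sqrt (by
    have := dotProduct_self_nonneg' u
    have := dotProduct_self_nonneg' v
    positivity)

/-- Cauchy–Schwarz for `n` and `u × v`, in the form of Lagrange's identity, since `areaSq u v = |u ×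
v|²`. -/
theorem triple_le {n : Fin 3 → ℝ} (hn : n ⬝ᵥ n = 1) (u v : Fin 3 → ℝ) :
    triple n u v ≤ √(areaSq u v) := by
  apply Real.le_sqrt_of_sq_le
  rw [areaSq_eq, triple_eq]
  rw [Matrix.vec3_dotProduct] at hn
  generalize u 1 * v 2 - u 2 * v 1 = a
  generalize u 2 * v 0 - u 0 * v 2 = b
  generalize u 0 * v 1 - u 1 * v 0 = c
  have : a ^ 2 + b ^ 2 + c ^ 2 - (n 0 * a + n 1 * b + n 2 * c) ^ 2 =
      (n 0 * b - n 1 * a) ^ 2 + (n 0 * c - n 2 * a) ^ 2 + (n 1 * c - n 2 * b) ^ 2 := by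
    linear_combination (-(a ^ 2 + b ^ 2 + c ^ 2)) * hn
  nlinarith [sq_nonneg (n 0 * b - n 1 * a), sq_nonneg (n 0 * c - n 2 * a),
    sq_nonneg (n 1 * c - n 2 * b)]

/-- With `exists_norm_quat_eq` this makes `traceNorm` a maximum of Euclidean norms of linear
functions of `(u, v)`, whence its triangle inequality. The individual bounds also serve as lower
bounds for `traceNorm`. -/
theorem norm_quat_le {n : Fin 3 → ℝ} (hn : n ⬝ᵥ n = 1) (u v : Fin 3 → ℝ) :
    ‖quat n u v‖ ≤ traceNorm u v := by
  refine abs_le_of_sq_le_sq' ?_ (traceNorm_nonneg u v) |>.2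
  rw [norm_quat_sq hn, traceNorm_sq]
  linarith [triple_le hn u v]

/-- The unit normal, which realizes the trace norm. -/
theorem exists_normal (u v : Fin 3 → ℝ) : ∃ n : Fin 3 → ℝ, n ⬝ᵥ n = 1 ∧
    √(areaSq u v) • n = crossProduct u v := by
  by_cases h : areaSq u v = 0
  -- When the area vanishes, so does the cross product, and any unit vector serves.
  · refine ⟨![1, 0, 0], by simp, ?_⟩
    rw [areaSq_eq] at h
    rw [areaSq_eq, h]
    have h0 : u 1 * v 2 - u 2 * v 1 = 0 := by
      nlinarith [sq_nonneg (u 1 * v 2 - u 2 * v 1), sq_nonneg (u 2 * v 0 - u 0 * v 2),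
        sq_nonneg (u 0 * v 1 - u 1 * v 0)]
    have h1 : u 2 * v 0 - u 0 * v 2 = 0 := by
      nlinarith [sq_nonneg (u 1 * v 2 - u 2 * v 1), sq_nonneg (u 2 * v 0 - u 0 * v 2),
        sq_nonneg (u 0 * v 1 - u 1 * v 0)]
    have h2 : u 0 * v 1 - u 1 * v 0 = 0 := by
      nlinarith [sq_nonneg (u 1 * v 2 - u 2 * v 1), sq_nonneg (u 2 * v 0 - u 0 * v 2),
        sq_nonneg (u 0 * v 1 - u 1 * v 0)]
    rw [cross_apply, h0, h1, h2]
    ext i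
    fin_cases i <;> simp
  · have hp : 0 < areaSq u v := lt_of_le_of_ne (areaSq_nonneg u v) (Ne.symm h)
    have hs : √(areaSq u v) ≠ 0 := (Real.sqrt_pos.2 hp).ne'
    refine ⟨(√(areaSq u v))⁻¹ • crossProduct u v, ?_, ?_⟩
    · have h1 : crossProduct u v ⬝ᵥ crossProduct u v = areaSq u v := by
        rw [areaSq_eq]
        simp [cross_apply]; ring
      rw [smul_dotProduct, dotProduct_smul, h1, smul_eq_mul, smul_eq_mul]
      nth_rewrite 3 [← Real.mul_self_sqrt hp.le]
      field_simp
    · rw [smul_smul, mul_inv_cancel₀ hs, one_smul]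

theorem exists_norm_quat_eq (u v : Fin 3 → ℝ) : ∃ n : Fin 3 → ℝ, n ⬝ᵥ n = 1 ∧
    ‖quat n u v‖ = traceNorm u v := by
  obtain ⟨n, hn, h⟩ := exists_normal u v
  refine ⟨n, hn, ?_⟩
  rw [← sq_eq_sq₀ (norm_nonneg _) (traceNorm_nonneg u v), norm_quat_sq hn, traceNorm_sq, triple,
    ← h, dotProduct_smul, hn, smul_eq_mul, mul_one]

theorem traceNorm_add_le (u v u' v' : Fin 3 → ℝ) :
    traceNorm (u + u') (v + v') ≤ traceNorm u v + traceNorm u' v' := by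
  obtain ⟨n, hn, h⟩ := exists_norm_quat_eq (u + u') (v + v')
  rw [← h, quat_add]
  exact (norm_add_le _ _).trans (add_le_add (norm_quat_le hn _ _) (norm_quat_le hn _ _))

/-- The vector `u` with the last two coordinates scaled by `m` and the first one by `a`. -/
def stretch (a m : ℝ) (u : Fin 3 → ℝ) : Fin 3 → ℝ := ![a * u 0, m * u 1, m * u 2]

/-- The squared lengths grow by at most `a²`. The components of the cross product are multiplied by
`m²`, `a m`, `a m`, so the area also grows by at most `a²`. -/
theorem traceNorm_stretch_le {a m : ℝ} (hm : 0 ≤ m) (hma : m ≤ a) (u v : Fin 3 → ℝ) :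
    traceNorm (stretch a m u) (stretch a m v) ≤ a * traceNorm u v := by
  have ha := hm.trans hma
  have hmm : m ^ 2 ≤ a ^ 2 := pow_le_pow_left₀ hm hma 2
  have h1 : ∀ w, stretch a m w ⬝ᵥ stretch a m w ≤ a ^ 2 * (w ⬝ᵥ w) := by
    intro w
    simp only [stretch, Matrix.vec3_dotProduct]
    simp
    nlinarith [mul_nonneg (sub_nonneg.2 hmm) (sq_nonneg (w 1)),
      mul_nonneg (sub_nonneg.2 hmm) (sq_nonneg (w 2))]
  have h2 : areaSq (stretch a m u) (stretch a m v) ≤ (a ^ 2) ^ 2 * areaSq u v := by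
    rw [areaSq_eq, areaSq_eq]
    have e1 : (m ^ 2) ^ 2 ≤ (a ^ 2) ^ 2 := pow_le_pow_left₀ (sq_nonneg _) hmm 2
    have e2 : m ^ 2 * a ^ 2 ≤ (a ^ 2) ^ 2 := by nlinarith [sq_nonneg a]
    simp [stretch]
    nlinarith [mul_nonneg (sub_nonneg.2 e1) (sq_nonneg (u 1 * v 2 - u 2 * v 1)),
      mul_nonneg (sub_nonneg.2 e2) (sq_nonneg (u 2 * v 0 - u 0 * v 2)),
      mul_nonneg (sub_nonneg.2 e2) (sq_nonneg (u 0 * v 1 - u 1 * v 0))]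
  refine abs_le_of_sq_le_sq' ?_ (mul_nonneg ha (traceNorm_nonneg u v)) |>.2
  rw [mul_pow, traceNorm_sq, traceNorm_sq]
  have h3 : √(areaSq (stretch a m u) (stretch a m v)) ≤ a ^ 2 * √(areaSq u v) := by
    refine (Real.sqrt_le_sqrt h2).trans_eq ?_
    rw [Real.sqrt_mul (by positivity), Real.sqrt_sq (sq_nonneg a)]
  linarith [h1 u, h1 v]

/-! ### Jacobi fields -/

/-- The coordinates in a parallel frame of the Jacobi field along a geodesic of speed `r` with
initial values `a` and `b`; the first vector of the frame is tangent to the geodesic. -/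
noncomputable def jacobi (r t : ℝ) (a b : Fin 3 → ℝ) : Fin 3 → ℝ :=
  ![a 0 + t * b 0, Real.cosh (t * r) * a 1 + t * sinhc (t * r) * b 1,
    Real.cosh (t * r) * a 2 + t * sinhc (t * r) * b 2]

/-- At a convex combination of times the fields are sums of stretched fields at the end times: the
affine coordinate keeps the weights `x, y`, the normal ones get the smaller weights of
`exists_interpolation`. -/
theorem convexOn_traceNorm_jacobi {r : ℝ} (hr : 0 ≤ r) (a b c d : Fin 3 → ℝ) :
    ConvexOn ℝ univ fun t => traceNorm (jacobi r t a b) (jacobi r t c d) := by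
  refine LinearOrder.convexOn_of_lt convex_univ fun s _ t _ hst x y hx hy hxy => ?_
  obtain ⟨m, n, hm, hmx, hn, hny, e1, e2⟩ := exists_interpolation hr hst hx.le hy.le hxy
  have key : ∀ a b, jacobi r (x • s + y • t) a b =
      stretch x m (jacobi r s a b) + stretch y n (jacobi r t a b) := by
    intro a b
    simp only [smul_eq_mul, jacobi, e1, e2]
    ext i
    fin_cases i
    · simp [stretch]; linear_combination (-(a 0)) * hxy
    · simp [stretch]; ring
    · simp [stretch]; ring
  simp only [key]
  exact (traceNorm_add_le _ _ _ _).trans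
    (add_le_add (traceNorm_stretch_le hm hmx _ _) (traceNorm_stretch_le hn hny _ _))

theorem jacobi_zero (r : ℝ) (a b : Fin 3 → ℝ) : jacobi r 0 a b = a := by
  ext i; fin_cases i <;> simp [jacobi]

theorem sinhc_neg (r : ℝ) : sinhc (-r) = sinhc r := by
  simp [sinhc, neg_div_neg_eq]

/-- The parts of the Jacobi fields that are odd in `t` cancel in the sum over `t` and `-t`, so `b`
and `d` disappear from the bound. The test vector `n` is the unit normal at time `0` and is used at
both times. -/
theorem traceNorm_jacobi_second_difference (r t : ℝ) (a b c d : Fin 3 → ℝ) :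
    2 * (√(traceNorm a c ^ 2 + r ^ 2 * √(areaSq a c) * t ^ 2) - traceNorm a c) ≤
      traceNorm (jacobi r t a b) (jacobi r t c d) +
        traceNorm (jacobi r (-t) a b) (jacobi r (-t) c d) - 2 * traceNorm a c := by
  obtain ⟨n, hn, hq⟩ := exists_normal a c
  set C := Real.cosh (t * r)
  have hC : 1 + (t * r) ^ 2 / 2 ≤ C := one_add_sq_div_two_le_cosh _
  have hC1 : 1 ≤ C := by nlinarith [sq_nonneg (t * r)]
  have hsum : ∀ a b, jacobi r t a b + jacobi r (-t) a b = stretch 1 C a + stretch 1 C a := by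
    intro a b
    ext i
    fin_cases i <;> simp [jacobi, stretch, neg_mul, sinhc_neg, C] <;> ring
  have h1 : 2 * ‖quat n (stretch 1 C a) (stretch 1 C c)‖ ≤
      traceNorm (jacobi r t a b) (jacobi r t c d) +
        traceNorm (jacobi r (-t) a b) (jacobi r (-t) c d) := by
    have h2 : (2 : ℝ) * ‖quat n (stretch 1 C a) (stretch 1 C c)‖ =
        ‖quat n (stretch 1 C a) (stretch 1 C c) + quat n (stretch 1 C a) (stretch 1 C c)‖ := by
      rw [← two_smul ℝ (quat n (stretch 1 C a) (stretch 1 C c)), norm_smul]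
      norm_num
    rw [h2, ← quat_add, ← hsum a b, ← hsum c d, quat_add]
    exact (norm_add_le _ _).trans (add_le_add (norm_quat_le hn _ _) (norm_quat_le hn _ _))
  have h3 : √(traceNorm a c ^ 2 + r ^ 2 * √(areaSq a c) * t ^ 2) ≤
      ‖quat n (stretch 1 C a) (stretch 1 C c)‖ := by
    refine Real.sqrt_le_iff.2 ⟨norm_nonneg _, ?_⟩
    rw [norm_quat_sq hn, traceNorm_sq, triple_eq]
    have hs := Real.sqrt_nonneg (areaSq a c)
    set s := √(areaSq a c)
    have q0 : a 1 * c 2 - a 2 * c 1 = s * n 0 := by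
      have := congrFun hq 0; simp [cross_apply] at this; linarith
    have q1 : a 2 * c 0 - a 0 * c 2 = s * n 1 := by
      have := congrFun hq 1; simp [cross_apply] at this; linarith
    have q2 : a 0 * c 1 - a 1 * c 0 = s * n 2 := by
      have := congrFun hq 2; simp [cross_apply] at this; linarith
    have hn' : n 0 ^ 2 + n 1 ^ 2 + n 2 ^ 2 = 1 := by
      rw [Matrix.vec3_dotProduct] at hn; linarith
    have e : ∀ w, w ⬝ᵥ w ≤ stretch 1 C w ⬝ᵥ stretch 1 C w := by
      intro w
      simp [stretch, Matrix.vec3_dotProduct]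
      nlinarith [mul_nonneg (by nlinarith : 0 ≤ C ^ 2 - 1) (sq_nonneg (w 1)),
        mul_nonneg (by nlinarith : 0 ≤ C ^ 2 - 1) (sq_nonneg (w 2))]
    -- The stretch multiplies the first component of `a × c = s n` by `C²` and the other two by `C`;
    -- `|n| = 1` then collects the terms.
    have f : n 0 * (stretch 1 C a 1 * stretch 1 C c 2 - stretch 1 C a 2 * stretch 1 C c 1) +
        n 1 * (stretch 1 C a 2 * stretch 1 C c 0 - stretch 1 C a 0 * stretch 1 C c 2) +
        n 2 * (stretch 1 C a 0 * stretch 1 C c 1 - stretch 1 C a 1 * stretch 1 C c 0) =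
        s * C + s * (C ^ 2 - C) * n 0 ^ 2 := by
      simp [stretch]
      linear_combination n 0 * C ^ 2 * q0 + n 1 * C * q1 + n 2 * C * q2 + s * C * hn'
    rw [f]
    have g1 : 0 ≤ s * (C ^ 2 - C) * n 0 ^ 2 :=
      mul_nonneg (mul_nonneg hs (by nlinarith)) (sq_nonneg _)
    nlinarith [e a, e c, mul_le_mul_of_nonneg_left hC hs]
  linarith

/-! ### The trace norm in terms of Gram matrices -/

/-- The trace norm in terms of the Gram matrices `G` of the scalar product and `Q` of its pull-back
in a basis of the plane. -/
noncomputable def gramNorm (G Q : Matrix (Fin 2) (Fin 2) ℝ) : ℝ :=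
  √((G 1 1 * Q 0 0 + G 0 0 * Q 1 1 - 2 * G 0 1 * Q 0 1) / G.det + 2 * √(Q.det / G.det))

theorem quadratic_nonneg {A B C : ℝ} (h : ∀ x y : ℝ, 0 ≤ A * x ^ 2 + 2 * B * (x * y) + C * y ^ 2) :
    0 ≤ A * C - B ^ 2 := by
  have hA : 0 ≤ A := by simpa using h 1 0
  rcases hA.eq_or_lt with h0 | h0
  -- If `A = 0`, this test vector gives `-(C + 2) B² ≥ 0`, which together with `C ≥ 0` forces `B =
  -- 0`.
  · have h1 := h (-(C + 1)) B
    have h2 := h 0 1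
    subst h0
    nlinarith [sq_nonneg B]
  · have h1 := h (-B) A
    by_contra hlt
    nlinarith

/-- Strict Cauchy–Schwarz: the vector `g₀₁ e₀ - g₀₀ e₁` is nonzero and its squared length is `g₀₀`
times the determinant. -/
theorem gram_det_pos {V : Type*} [AddCommGroup V] [Module ℝ V] (g : V →ₗ[ℝ] V →ₗ[ℝ] ℝ)
    (hgs : ∀ v w, g v w = g w v) (hgp : ∀ v, v ≠ 0 → 0 < g v v) {e : Fin 2 → V}
    (he : LinearIndependent ℝ e) : 0 < (Matrix.of fun i j => g (e i) (e j)).det := by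
  rw [Matrix.det_fin_two]
  simp only [Matrix.of_apply]
  have h0 : 0 < g (e 0) (e 0) := hgp _ (he.ne_zero 0)
  have hne : g (e 0) (e 1) • e 0 + (-(g (e 0) (e 0))) • e 1 ≠ 0 := fun h => by
    have := LinearIndependent.pair_iff.1 (show LinearIndependent ℝ ![e 0, e 1] by
      convert he using 1; ext i; fin_cases i <;> rfl) _ _ h
    linarith [this.2]
  have h1 := hgp _ hne
  simp only [map_add, map_smul, LinearMap.add_apply, LinearMap.smul_apply, smul_eq_mul] at h1
  rw [hgs (e 1) (e 0)] at h1 ⊢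
  by_contra hlt
  nlinarith

/-- In dimension two, `(tr b)² = tr (b²) + 2 det b`. For the polar factor `b`, `tr (b²) = tr (G⁻¹
Q)` and `(det b)² = det Q / det G`. Nonnegativity of `b` fixes the signs of both square roots. -/
theorem schattenOne_eq_gramNorm {V : Type*} [AddCommGroup V] [Module ℝ V]
    (g q : V →ₗ[ℝ] V →ₗ[ℝ] ℝ)
    (hgs : ∀ v w, g v w = g w v) (hgp : ∀ v, v ≠ 0 → 0 < g v v)
    (hqs : ∀ v w, q v w = q w v) (hqp : ∀ v, 0 ≤ q v v) (e : Module.Basis (Fin 2) ℝ V) :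
    schattenOne (fun v w => g v w) (fun v w => q v w) =
      gramNorm (Matrix.of fun i j => g (e i) (e j)) (Matrix.of fun i j => q (e i) (e j)) := by
  have : FiniteDimensional ℝ V := Module.Basis.finiteDimensional_of_finite e
  have hb := (existsUnique_isPolarFactor g q hgs hgp hqs hqp).exists
  have hD := gram_det_pos g hgs hgp e.linearIndependent
  have hg0 : 0 < g (e 0) (e 0) := hgp _ (e.ne_zero 0)
  have hB := hb.choose_spec
  rw [schattenOne, dif_pos hb]
  set b := hb.choose
  rw [LinearMap.trace_eq_matrix_trace ℝ e, Matrix.trace_fin_two, gramNorm]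
  set B := LinearMap.toMatrix e e b with hBdef
  have hbe : ∀ j, b (e j) = B 0 j • e 0 + B 1 j • e 1 := by
    intro j
    rw [← e.sum_repr (b (e j)), Fin.sum_univ_two]
    simp [hBdef, LinearMap.toMatrix_apply]
  have hq00 := hB.pullback (e 0) (e 0)
  have hq01 := hB.pullback (e 0) (e 1)
  have hq11 := hB.pullback (e 1) (e 1)
  have hsa := hB.selfAdjoint (e 0) (e 1)
  have hnn : ∀ x y : ℝ, 0 ≤ g (b (x • e 0 + y • e 1)) (x • e 0 + y • e 1) :=
    fun x y => hB.nonneg _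
  simp only [map_add, map_smul, LinearMap.add_apply, LinearMap.smul_apply, smul_eq_mul, hbe,
    hgs (e 1) (e 0)] at hq00 hq01 hq11 hsa hnn
  simp only [Matrix.det_fin_two, Matrix.of_apply, hgs (e 1) (e 0), hqs (e 1) (e 0)] at hD ⊢
  rw [← hq00, ← hq01, ← hq11]
  generalize g (e 0) (e 0) = G0 at *
  generalize g (e 0) (e 1) = G1 at *
  generalize g (e 1) (e 1) = G2 at *
  generalize B 0 0 = α at *
  generalize B 1 0 = γ at *
  generalize B 0 1 = β at *
  generalize B 1 1 = δ at *
  have hm : ∀ x y : ℝ, 0 ≤ (α * G0 + γ * G1) * x ^ 2 + 2 * (α * G1 + γ * G2) * (x * y) +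
      (β * G1 + δ * G2) * y ^ 2 := fun x y => by
    have := hnn x y
    linear_combination this - (x * y) * hsa
  have hdet : 0 ≤ α * δ - β * γ := by
    have h1 := quadratic_nonneg hm
    have h2 : (α * G0 + γ * G1) * (β * G1 + δ * G2) - (α * G1 + γ * G2) ^ 2 =
        (α * δ - β * γ) * (G0 * G2 - G1 * G1) := by
      linear_combination (-(α * G1 + γ * G2)) * hsa
    rw [h2] at h1
    exact nonneg_of_mul_nonneg_left h1 hD
  -- The trace is read off in the orthogonal basis `e₀`, `-G1 e₀ + G0 e₁`, whose second vector has
  -- squared length `G0` times the Gram determinant; both diagonal values of the form `g (b v) v`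
  -- are nonnegative.
  have htr : 0 ≤ α + δ := by
    have h1 := hm 1 0
    have h2 := hm (-G1) G0
    have h3 : G0 * ((α + δ) * (G0 * G2 - G1 * G1)) =
        (G0 * G2 - G1 * G1) * ((α * G0 + γ * G1) * 1 ^ 2 + 2 * (α * G1 + γ * G2) * (1 * 0) +
          (β * G1 + δ * G2) * 0 ^ 2) + ((α * G0 + γ * G1) * (-G1) ^ 2 +
          2 * (α * G1 + γ * G2) * (-G1 * G0) + (β * G1 + δ * G2) * G0 ^ 2) := by
      linear_combination (G0 * G1) * hsa
    have h4 : 0 ≤ G0 * ((α + δ) * (G0 * G2 - G1 * G1)) := by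
      rw [h3]; exact add_nonneg (mul_nonneg hD.le h1) h2
    exact nonneg_of_mul_nonneg_left (nonneg_of_mul_nonneg_right h4 hg0) hD
  have e1 : (G2 * (α * (α * G0 + γ * G1) + γ * (α * G1 + γ * G2)) +
      G0 * (β * (β * G0 + δ * G1) + δ * (β * G1 + δ * G2)) -
      2 * G1 * (β * (α * G0 + γ * G1) + δ * (α * G1 + γ * G2))) / (G0 * G2 - G1 * G1) =
      (α + δ) ^ 2 - 2 * (α * δ - β * γ) := by
    rw [div_eq_iff hD.ne']
    linear_combination (α * G1 + γ * G2 - (β * G0 + δ * G1)) * hsa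
  have e2 : ((α * (α * G0 + γ * G1) + γ * (α * G1 + γ * G2)) *
      (β * (β * G0 + δ * G1) + δ * (β * G1 + δ * G2)) -
      (β * (α * G0 + γ * G1) + δ * (α * G1 + γ * G2)) *
      (β * (α * G0 + γ * G1) + δ * (α * G1 + γ * G2))) / (G0 * G2 - G1 * G1) =
      (α * δ - β * γ) ^ 2 := by
    rw [div_eq_iff hD.ne']
    ring
  rw [e1, e2, Real.sqrt_sq hdet, sub_add_cancel, Real.sqrt_sq htr]

/-- The trace norm in terms of Gram matrices, computed in an orthonormal basis. -/
theorem gramNorm_eq_traceNorm {G Q : Matrix (Fin 2) (Fin 2) ℝ} (hG : G 1 0 = G 0 1)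
    (hG0 : 0 < G 0 0) (hD : 0 < G.det) {u v : Fin 3 → ℝ} (h00 : Q 0 0 = u ⬝ᵥ u)
    (h01 : Q 0 1 = u ⬝ᵥ v) (h10 : Q 1 0 = u ⬝ᵥ v) (h11 : Q 1 1 = v ⬝ᵥ v) :
    gramNorm G Q = traceNorm ((√(G 0 0))⁻¹ • u)
      ((√(G.det / G 0 0))⁻¹ • (v - (G 0 1 / G 0 0) • u)) ∧
    areaSq ((√(G 0 0))⁻¹ • u) ((√(G.det / G 0 0))⁻¹ • (v - (G 0 1 / G 0 0) • u)) =
      Q.det / G.det := by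
  -- The arguments of `traceNorm` are the images of the Gram–Schmidt basis; this quotient is the
  -- squared length of the second basis vector after subtracting its projection on the first.
  have hp : 0 < G.det / G 0 0 := div_pos hD hG0
  have s1 := Real.sqrt_pos.2 hG0
  have s2 := Real.sqrt_pos.2 hp
  have q1 := Real.sq_sqrt hG0.le
  have q2 := Real.sq_sqrt hp.le
  have huv : v ⬝ᵥ u = u ⬝ᵥ v := dotProduct_comm _ _
  have e1 : ((√(G 0 0))⁻¹ • u) ⬝ᵥ ((√(G 0 0))⁻¹ • u) = Q 0 0 / G 0 0 := by
    rw [smul_dotProduct, dotProduct_smul, smul_eq_mul, smul_eq_mul, ← h00]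
    nth_rewrite 3 [← q1]
    field_simp
  have e2 : ((√(G.det / G 0 0))⁻¹ • (v - (G 0 1 / G 0 0) • u)) ⬝ᵥ
      ((√(G.det / G 0 0))⁻¹ • (v - (G 0 1 / G 0 0) • u)) =
      (Q 1 1 - 2 * (G 0 1 / G 0 0) * Q 0 1 + (G 0 1 / G 0 0) ^ 2 * Q 0 0) / (G.det / G 0 0) := by
    rw [smul_dotProduct, dotProduct_smul, sub_dotProduct, dotProduct_sub, dotProduct_sub,
      smul_dotProduct, smul_dotProduct, dotProduct_smul, dotProduct_smul, h00, h01, h11, huv]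
    simp only [smul_eq_mul]
    generalize √(G.det / G 0 0) = s at *
    rw [← q2]
    generalize G 0 1 / G 0 0 = c
    field_simp
    ring
  have e3 : (((√(G 0 0))⁻¹ • u) ⬝ᵥ
      ((√(G.det / G 0 0))⁻¹ • (v - (G 0 1 / G 0 0) • u))) ^ 2 =
      (Q 0 1 - (G 0 1 / G 0 0) * Q 0 0) ^ 2 / (G 0 0 * (G.det / G 0 0)) := by
    rw [smul_dotProduct, dotProduct_smul, dotProduct_sub, dotProduct_smul, h00, h01]
    simp only [smul_eq_mul]
    generalize √(G.det / G 0 0) = s at *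
    generalize G 0 1 / G 0 0 = c
    rw [← q2]
    generalize √(G 0 0) = r at *
    rw [← q1]
    field_simp
  have hA : areaSq ((√(G 0 0))⁻¹ • u) ((√(G.det / G 0 0))⁻¹ • (v - (G 0 1 / G 0 0) • u)) =
      Q.det / G.det := by
    rw [areaSq, e1, e2, e3, Matrix.det_fin_two Q, h10, ← h01]
    field_simp
    ring
  refine ⟨?_, hA⟩
  rw [gramNorm, traceNorm, hA, e1, e2]
  congr 2
  have hD' := hD.ne'
  field_simp
  rw [Matrix.det_fin_two, hG]
  ring

/-! ### Parallel frames -/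

theorem mink_coords (a b c d a' b' c' d' : ℝ) :
    mink !![((a + b : ℝ) : ℂ), ⟨c, d⟩; ⟨c, -d⟩, ((a - b : ℝ) : ℂ)]
      !![((a' + b' : ℝ) : ℂ), ⟨c', d'⟩; ⟨c', -d'⟩, ((a' - b' : ℝ) : ℂ)] =
      -(a * a') + b * b' + c * c' + d * d' := by
  simp [mink, Matrix.trace_fin_two]
  ring

theorem mink_comm (A B : Mat) : mink A B = mink B A := by
  rw [mink, mink, Matrix.trace_mul_comm, mul_comm]

theorem mink_add_left (A B C : Mat) : mink (A + B) C = mink A C + mink B C := by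
  simp only [mink, Matrix.trace_add, add_mul, Complex.add_re, Complex.sub_re]; ring

theorem mink_smul_left (r : ℝ) (A C : Mat) : mink (r • A) C = r * mink A C := by
  simp [mink, Matrix.trace_smul]; ring

theorem mink_add_right (A B C : Mat) : mink A (B + C) = mink A B + mink A C := by
  rw [mink_comm, mink_add_left, mink_comm B, mink_comm C]

theorem mink_smul_right (r : ℝ) (A C : Mat) : mink A (r • C) = r * mink A C := by
  rw [mink_comm, mink_smul_left, mink_comm]

/-- The coordinates of a Hermitian matrix in which `mink` is diagonal. -/
noncomputable def pauli : Mat →ₗ[ℝ] (Fin 4 → ℝ) where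
  toFun A := ![((A 0 0).re + (A 1 1).re) / 2, ((A 0 0).re - (A 1 1).re) / 2, (A 0 1).re, (A 0 1).im]
  map_add' A B := by ext i; fin_cases i <;> simp <;> ring
  map_smul' r A := by ext i; fin_cases i <;> simp <;> ring

theorem mink_eq_pauli {A B : Mat} (hA : A.IsHermitian) (hB : B.IsHermitian) :
    mink A B = -(pauli A 0 * pauli B 0) + pauli A 1 * pauli B 1 + pauli A 2 * pauli B 2 +
      pauli A 3 * pauli B 3 := by
  obtain ⟨a, b, c, d, rfl⟩ := hermitian_coords hA
  obtain ⟨a', b', c', d', rfl⟩ := hermitian_coords hB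
  rw [mink_coords]
  simp [pauli]

/-- The coordinates with respect to the frame at `x` obtained from the standard frame at the base
point by a boost. -/
noncomputable def boost (x : Mat) : Mat →ₗ[ℝ] (Fin 3 → ℝ) :=
  LinearMap.pi fun k : Fin 3 =>
    (LinearMap.proj k.succ ∘ₗ pauli) - (pauli x k.succ) • (LinearMap.proj 0 ∘ₗ pauli) +
      (pauli x k.succ / (1 + pauli x 0)) •
        (∑ j : Fin 3, (pauli x j.succ) • (LinearMap.proj j.succ ∘ₗ pauli))

theorem boost_apply (x A : Mat) (k : Fin 3) : boost x A k =
    pauli A k.succ - pauli x k.succ * pauli A 0 + pauli x k.succ / (1 + pauli x 0) *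
      (pauli x 1 * pauli A 1 + pauli x 2 * pauli A 2 + pauli x 3 * pauli A 3) := by
  simp [boost, Fin.sum_univ_three]
  ring

/-- The boost is a Lorentz transformation carrying `x` to the base point. It turns `-mink x A` into
the time coordinate of `A` and `boost x A` into its space part. -/
theorem mink_eq_boost (x : H3) {A B : Mat} (hA : A.IsHermitian) (hB : B.IsHermitian) :
    mink A B = boost x A ⬝ᵥ boost x B - mink x A * mink x B := by
  have hx := mink_self x
  have h0 : 0 < pauli x 0 := by
    have := x.2.2.2
    simp [Matrix.trace_fin_two, pauli] at this ⊢
    linarith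
  rw [mink_eq_pauli x.2.1 x.2.1] at hx
  rw [mink_eq_pauli hA hB, mink_eq_pauli x.2.1 hA, mink_eq_pauli x.2.1 hB,
    Matrix.vec3_dotProduct]
  simp only [boost_apply]
  have e1 : (0 : Fin 3).succ = 1 := rfl
  have e2 : (1 : Fin 3).succ = 2 := rfl
  have e3 : (2 : Fin 3).succ = 3 := rfl
  rw [e1, e2, e3]
  generalize pauli x 0 = a at *
  generalize pauli x 1 = b at *
  generalize pauli x 2 = c at *
  generalize pauli x 3 = d at *
  generalize pauli A 0 = a' at *
  generalize pauli B 0 = a'' at *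
  generalize pauli A 1 = b' at *
  generalize pauli B 1 = b'' at *
  generalize pauli A 2 = c' at *
  generalize pauli B 2 = c'' at *
  generalize pauli A 3 = d' at *
  generalize pauli B 3 = d'' at *
  set P := b * b' + c * c' + d * d' with hP
  set P' := b * b'' + c * c'' + d * d'' with hP'
  have ha : 1 + a ≠ 0 := by linarith
  have hs : b ^ 2 + c ^ 2 + d ^ 2 = (a - 1) * (1 + a) := by linarith
  have : ∀ b b' b'' : ℝ, (b' - b * a' + b / (1 + a) * P) * (b'' - b * a'' + b / (1 + a) * P') =
      b' * b'' - a'' * (b * b') - a' * (b * b'') + P' / (1 + a) * (b * b') +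
      P / (1 + a) * (b * b'') + b ^ 2 * ((P / (1 + a) - a') * (P' / (1 + a) - a'')) := by
    intros; ring
  rw [this, this, this]
  have h1 : (b ^ 2 + c ^ 2 + d ^ 2) * ((P / (1 + a) - a') * (P' / (1 + a) - a'')) =
      (a - 1) / (1 + a) * ((P - a' * (1 + a)) * (P' - a'' * (1 + a))) := by
    rw [hs]; field_simp
  have h2 : P / (1 + a) * (1 + a) = P := div_mul_cancel₀ _ ha
  have h3 : -(a' * a'') + b' * b'' + c' * c'' + d' * d'' =
      (b' * b'' + c' * c'' + d' * d'') - a'' * P - a' * P' + P' / (1 + a) * P + P / (1 + a) * P' +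
      (b ^ 2 + c ^ 2 + d ^ 2) * ((P / (1 + a) - a') * (P' / (1 + a) - a'')) -
      (P - a * a') * (P' - a * a'') := by
    rw [h1]; field_simp; ring
  rw [show -(a * a') + b * b' + c * c' + d * d' = P - a * a' by rw [hP]; ring,
    show -(a * a'') + b * b'' + c * c'' + d * d'' = P' - a * a'' by rw [hP']; ring, h3, hP, hP']
  ring

/-- Coordinates with respect to an orthonormal frame at `x` whose first vector has the direction
of `X`. -/
theorem exists_frame (x : H3) (X : x.tangent) : ∃ K : Mat →ₗ[ℝ] (Fin 3 → ℝ),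
    (∀ A B : Mat, A.IsHermitian → B.IsHermitian →
      mink A B = K A ⬝ᵥ K B - mink x A * mink x B) ∧ K X = ![tnorm X, 0, 0] := by
  let w : EuclideanSpace ℝ (Fin 3) := WithLp.toLp 2 (boost x X)
  have hw : ‖w‖ = tnorm X := by
    rw [EuclideanSpace.norm_eq, tnorm, mink_eq_boost x X.2.1 X.2.1, X.2.2,
      Matrix.vec3_dotProduct, Fin.sum_univ_three]
    simp [w, sq]
  obtain ⟨b, hb⟩ : ∃ b : OrthonormalBasis (Fin 3) ℝ (EuclideanSpace ℝ (Fin 3)),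
      w = tnorm (X : Mat) • b 0 := by
    by_cases h : w = 0
    · refine ⟨EuclideanSpace.basisFun _ _, ?_⟩
      rw [← hw, h]; simp
    · have hn : ‖w‖ ≠ 0 := norm_ne_zero_iff.2 h
      have ho : Orthonormal ℝ (({0} : Set (Fin 3)).domRestrict fun _ => ‖w‖⁻¹ • w) := by
        refine ⟨fun i => ?_, fun i j hij => (hij (Subsingleton.elim i j)).elim⟩
        change ‖‖w‖⁻¹ • w‖ = 1
        rw [norm_smul, norm_inv, norm_norm, inv_mul_cancel₀ hn]
      obtain ⟨b, hb⟩ := ho.exists_orthonormalBasis_extension_of_card_eq (by simp)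
      refine ⟨b, ?_⟩
      rw [hb 0 rfl, ← hw, smul_smul, mul_inv_cancel₀ hn, one_smul]
  let K : Mat →ₗ[ℝ] (Fin 3 → ℝ) :=
    (WithLp.linearEquiv 2 ℝ (Fin 3 → ℝ)).toLinearMap ∘ₗ b.repr.toLinearEquiv.toLinearMap ∘ₗ
      (WithLp.linearEquiv 2 ℝ (Fin 3 → ℝ)).symm.toLinearMap ∘ₗ boost x
  have hK : ∀ A, K A = (b.repr (WithLp.toLp 2 (boost x A))).ofLp := fun A => rfl
  refine ⟨K, fun A B hA hB => ?_, ?_⟩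
  · rw [mink_eq_boost x hA hB, hK, hK]
    congr 1
    have := b.repr.inner_map_map (WithLp.toLp 2 (boost x A)) (WithLp.toLp 2 (boost x B))
    rw [EuclideanSpace.inner_eq_star_dotProduct, EuclideanSpace.inner_eq_star_dotProduct] at this
    simp only [star_trivial] at this
    rw [dotProduct_comm, ← this, dotProduct_comm]
  · rw [hK]
    change (b.repr w).ofLp = _
    rw [hb, map_smul, b.repr_self]
    ext i
    fin_cases i <;> simp

/-! ### The geodesic displacement in ambient coordinates -/

/-- The form `mink` as a continuous bilinear form on the space of entries. -/
noncomputable def minkL : Entries →L[ℝ] Entries →L[ℝ] ℝ :=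
  (LinearMap.mk₂ ℝ (fun u w : Entries => mink (Matrix.of u) (Matrix.of w))
    (fun _ _ _ => mink_add_left _ _ _) (fun _ _ _ => mink_smul_left _ _ _)
    (fun _ _ _ => mink_add_right _ _ _) (fun _ _ _ => mink_smul_right _ _ _)).toContinuousBilinearMap

theorem minkL_apply (u w : Entries) : minkL u w = mink (Matrix.of u) (Matrix.of w) := rfl

theorem minkL_comm (u w : Entries) : minkL u w = minkL w u := mink_comm _ _

/-- The geodesic displacement in ambient coordinates. -/
noncomputable def geoMap (t : ℝ) (z : Entries × Entries) : Entries :=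
  coshSqrt (t ^ 2 * minkL z.2 z.2) • z.1 + (t * sinhcSqrt (t ^ 2 * minkL z.2 z.2)) • z.2

theorem contDiff_geoMap {n : WithTop ℕ∞} (hn : n ≤ ∞) :
    ContDiff ℝ n fun z : ℝ × (Entries × Entries) => geoMap z.1 z.2 := by
  have h1 : ContDiff ℝ n fun z : ℝ × (Entries × Entries) => z.1 ^ 2 * minkL z.2.2 z.2.2 :=
    (contDiff_fst.pow 2).mul
      ((minkL.contDiff.comp (contDiff_snd.comp contDiff_snd)).clm_apply
        (contDiff_snd.comp contDiff_snd))
  have h2 := (contDiff_coshSqrt.of_le hn).comp h1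
  have h3 := (contDiff_sinhcSqrt.of_le hn).comp h1
  exact (h2.smul (contDiff_fst.comp contDiff_snd)).add
    ((contDiff_fst.mul h3).smul (contDiff_snd.comp contDiff_snd))

theorem entries_displacement {A : Type*} (f : A → H3) (X : ∀ p : A, (f p).tangent) (t : ℝ) (p : A) :
    entries (displacement f X t p) = geoMap t (entries (f p), entries (X p)) := by
  have hr2 : tnorm (X p) ^ 2 = mink (X p) (X p) := Real.sq_sqrt (tnorm_sq _ (X p).2)
  have h1 : t ^ 2 * minkL (entries (X p)) (entries (X p)) = (t * tnorm (X p)) ^ 2 := by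
    rw [mul_pow, hr2]; rfl
  have h2 : (displacement f X t p : Mat) = _ := H3.exp_smul (f p) (X p) t
  simp only [geoMap, h1, coshSqrt_sq, sinhcSqrt_sq, h2]
  rfl

/-- The derivative of `geoMap t`. -/
noncomputable def geoMapDeriv (t : ℝ) (z u : Entries × Entries) : Entries :=
  (2 * t ^ 2 * minkL z.2 u.2 * deriv coshSqrt (t ^ 2 * minkL z.2 z.2)) • z.1 +
    coshSqrt (t ^ 2 * minkL z.2 z.2) • u.1 +
    (t * (2 * t ^ 2 * minkL z.2 u.2 * deriv sinhcSqrt (t ^ 2 * minkL z.2 z.2))) • z.2 +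
    (t * sinhcSqrt (t ^ 2 * minkL z.2 z.2)) • u.2

theorem hasFDerivAt_geoMap (t : ℝ) (z : Entries × Entries) :
    ∃ L : Entries × Entries →L[ℝ] Entries, HasFDerivAt (geoMap t) L z ∧
      ∀ u, L u = geoMapDeriv t z u := by
  have h0 : HasFDerivAt (fun z : Entries × Entries => z.2) (ContinuousLinearMap.snd ℝ _ _) z :=
    hasFDerivAt_snd
  have h0' : HasFDerivAt (fun z : Entries × Entries => z.1) (ContinuousLinearMap.fst ℝ _ _) z :=
    hasFDerivAt_fst
  have h1 := (minkL.hasFDerivAt_of_bilinear h0 h0).const_mul (t ^ 2)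
  have h2 := (hasDerivAt_coshSqrt (t ^ 2 * minkL z.2 z.2)).comp_hasFDerivAt z h1
  have h3 := ((hasDerivAt_sinhcSqrt (t ^ 2 * minkL z.2 z.2)).comp_hasFDerivAt z h1).const_mul t
  refine ⟨_, (h2.smul h0').add (h3.smul h0), fun u => ?_⟩
  have e : t ^ 2 * minkL z.2 u.2 + t ^ 2 * minkL u.2 z.2 = 2 * t ^ 2 * minkL z.2 u.2 := by
    rw [minkL_comm u.2]; ring
  rw [geoMapDeriv, ← e]
  simp [smul_smul]
  module

/-! ### Derivatives of sections along a map, and the Jacobi field formula -/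

section Manifold

variable {M : Type*} [TopologicalSpace M] [ChartedSpace E2 M]

theorem mfderiv_congr_fun {F : Type*} [NormedAddCommGroup F] [NormedSpace ℝ F] {u w : M → F}
    (h : u = w) (p : M) (v : TangentSpace (𝓡 2) p) :
    (mfderiv (𝓡 2) 𝓘(ℝ, F) u p v : F) = (mfderiv (𝓡 2) 𝓘(ℝ, F) w p v : F) := by
  subst h; rfl

theorem mfderiv_comp_pair {F : Type*} [NormedAddCommGroup F] [NormedSpace ℝ F]
    {u w : M → Entries} {p : M} (hu : MDifferentiableAt (𝓡 2) 𝓘(ℝ, Entries) u p)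
    (hw : MDifferentiableAt (𝓡 2) 𝓘(ℝ, Entries) w p) {Ψ : Entries × Entries → F}
    {Ψ' : Entries × Entries →L[ℝ] F} (hΨ : HasFDerivAt Ψ Ψ' (u p, w p))
    (v : TangentSpace (𝓡 2) p) :
    (mfderiv (𝓡 2) 𝓘(ℝ, F) (fun q => Ψ (u q, w q)) p v : F) =
      Ψ' ((mfderiv (𝓡 2) 𝓘(ℝ, Entries) u p v : Entries),
        (mfderiv (𝓡 2) 𝓘(ℝ, Entries) w p v : Entries)) := by
  have h1 : HasMFDerivAt (𝓡 2) 𝓘(ℝ, Entries × Entries) (fun q => (u q, w q)) p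
      ((mfderiv (𝓡 2) 𝓘(ℝ, Entries) u p).prod (mfderiv (𝓡 2) 𝓘(ℝ, Entries) w p)) :=
    ⟨hu.hasMFDerivAt.1.prodMk hw.hasMFDerivAt.1, hu.hasMFDerivAt.2.prodMk hw.hasMFDerivAt.2⟩
  have h2 := HasMFDerivAt.comp p hΨ.hasMFDerivAt h1
  have h3 := h2.mfderiv
  exact congrArg (fun L : TangentSpace (𝓡 2) p →L[ℝ] F => L v) h3

variable {f : M → H3} {X : ∀ p : M, (f p).tangent} {p : M}

/-- The differential at `p` of a section of the tangent bundle of hyperbolic 3-space along `f`,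
with values in the ambient space. -/
noncomputable def diffSection (X : ∀ p : M, (f p).tangent) (p : M) (v : TangentSpace (𝓡 2) p) :
    Mat :=
  Matrix.of (mfderiv (𝓡 2) 𝓘(ℝ, Entries) (fun p => entries (X p)) p v : Entries)

theorem diff_displacement (hf : MDifferentiableAt (𝓡 2) 𝓘(ℝ, Entries) (fun p => entries (f p)) p)
    (hX : MDifferentiableAt (𝓡 2) 𝓘(ℝ, Entries) (fun p => entries (X p)) p) (t : ℝ)
    (v : TangentSpace (𝓡 2) p) :
    diff (displacement f X t) p v =
      (2 * t ^ 2 * mink (X p) (diffSection X p v) * deriv coshSqrt ((t * tnorm (X p)) ^ 2)) •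
        (f p : Mat) + Real.cosh (t * tnorm (X p)) • diff f p v +
      (t * (2 * t ^ 2 * mink (X p) (diffSection X p v) *
        deriv sinhcSqrt ((t * tnorm (X p)) ^ 2))) • (X p : Mat) +
      (t * sinhc (t * tnorm (X p))) • diffSection X p v := by
  obtain ⟨L, hL, hL'⟩ := hasFDerivAt_geoMap t (entries (f p), entries (X p))
  have h := mfderiv_comp_pair hf hX hL v
  rw [hL'] at h
  have hr2 : tnorm (X p) ^ 2 = mink (X p) (X p) := Real.sq_sqrt (tnorm_sq _ (X p).2)
  have h1 : t ^ 2 * minkL (entries (X p)) (entries (X p)) = (t * tnorm (X p)) ^ 2 := by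
    rw [mul_pow, hr2]; rfl
  rw [geoMapDeriv] at h
  simp only [h1, coshSqrt_sq, sinhcSqrt_sq] at h
  exact congrArg Matrix.of ((mfderiv_congr_fun
    (funext fun q => entries_displacement f X t q) p v).trans h)

/-- Every identity satisfied by all pairs `(f, X)` differentiates to a linear constraint on `(df,
dX)`. It is applied to `⟨f, f⟩ = -1`, to `⟨f, X⟩ = 0` and to hermiticity. -/
theorem mfderiv_pair_eq_zero
    (hf : MDifferentiableAt (𝓡 2) 𝓘(ℝ, Entries) (fun p => entries (f p)) p)
    (hX : MDifferentiableAt (𝓡 2) 𝓘(ℝ, Entries) (fun p => entries (X p)) p)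
    {F : Type*} [NormedAddCommGroup F] [NormedSpace ℝ F] {Ψ : Entries × Entries → F}
    {Ψ' : Entries × Entries →L[ℝ] F} (hΨ : HasFDerivAt Ψ Ψ' (entries (f p), entries (X p)))
    {c : F} (hc : ∀ q, Ψ (entries (f q), entries (X q)) = c) (v : TangentSpace (𝓡 2) p) :
    Ψ' (Matrix.of.symm (diff f p v), Matrix.of.symm (diffSection X p v)) = 0 := by
  have h := mfderiv_comp_pair hf hX hΨ v
  rw [mfderiv_congr_fun (funext hc)] at h
  refine Eq.trans h.symm ?_
  exact congrArg (fun L : TangentSpace (𝓡 2) p →L[ℝ] F => L v) mfderiv_const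

theorem mink_diff_eq_zero
    (hf : MDifferentiableAt (𝓡 2) 𝓘(ℝ, Entries) (fun p => entries (f p)) p)
    (hX : MDifferentiableAt (𝓡 2) 𝓘(ℝ, Entries) (fun p => entries (X p)) p)
    (v : TangentSpace (𝓡 2) p) : mink (f p) (diff f p v) = 0 := by
  have h0 : HasFDerivAt (fun z : Entries × Entries => z.1) (ContinuousLinearMap.fst ℝ _ _)
    (entries (f p), entries (X p)) := hasFDerivAt_fst
  have h := mfderiv_pair_eq_zero hf hX (minkL.hasFDerivAt_of_bilinear h0 h0) (c := -1)
    (fun q => mink_self (f q)) v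
  have h' : mink (f p) (diff f p v) + mink (diff f p v) (f p) = 0 := h
  rw [mink_comm (diff f p v)] at h'
  linarith

theorem mink_diffSection
    (hf : MDifferentiableAt (𝓡 2) 𝓘(ℝ, Entries) (fun p => entries (f p)) p)
    (hX : MDifferentiableAt (𝓡 2) 𝓘(ℝ, Entries) (fun p => entries (X p)) p)
    (v : TangentSpace (𝓡 2) p) :
    mink (f p) (diffSection X p v) + mink (X p) (diff f p v) = 0 := by
  have h0 : HasFDerivAt (fun z : Entries × Entries => z.1) (ContinuousLinearMap.fst ℝ _ _)
    (entries (f p), entries (X p)) := hasFDerivAt_fst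
  have h1 : HasFDerivAt (fun z : Entries × Entries => z.2) (ContinuousLinearMap.snd ℝ _ _)
    (entries (f p), entries (X p)) := hasFDerivAt_snd
  have h := mfderiv_pair_eq_zero hf hX (minkL.hasFDerivAt_of_bilinear h0 h1) (c := 0)
    (fun q => (X q).2.2) v
  have h' : mink (f p) (diffSection X p v) + mink (diff f p v) (X p) = 0 := h
  rwa [mink_comm (diff f p v)] at h'

/-- Twice the skew-Hermitian part. -/
noncomputable def skewL : Entries →L[ℝ] Entries :=
  LinearMap.toContinuousLinearMap
    { toFun := fun u i j => u i j - star (u j i)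
      map_add' := fun u w => by ext i j; simp; ring
      map_smul' := fun r u => by ext i j; simp; ring }

theorem skewL_eq_zero {A : Mat} : skewL (Matrix.of.symm A) = 0 ↔ A.IsHermitian := by
  constructor
  · intro h
    ext i j
    have := congrFun (congrFun h i) j
    exact (sub_eq_zero.1 this).symm
  · intro h
    ext i j
    exact sub_eq_zero.2 (h.apply i j).symm

theorem isHermitian_diff
    (hf : MDifferentiableAt (𝓡 2) 𝓘(ℝ, Entries) (fun p => entries (f p)) p)
    (hX : MDifferentiableAt (𝓡 2) 𝓘(ℝ, Entries) (fun p => entries (X p)) p)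
    (v : TangentSpace (𝓡 2) p) : (diff f p v).IsHermitian :=
  skewL_eq_zero.1 (mfderiv_pair_eq_zero hf hX (skewL.hasFDerivAt.comp _ hasFDerivAt_fst) (c := 0)
    (fun q => skewL_eq_zero.2 (f q).2.1) v)

theorem isHermitian_diffSection
    (hf : MDifferentiableAt (𝓡 2) 𝓘(ℝ, Entries) (fun p => entries (f p)) p)
    (hX : MDifferentiableAt (𝓡 2) 𝓘(ℝ, Entries) (fun p => entries (X p)) p)
    (v : TangentSpace (𝓡 2) p) : (diffSection X p v).IsHermitian :=
  skewL_eq_zero.1 (mfderiv_pair_eq_zero hf hX (skewL.hasFDerivAt.comp _ hasFDerivAt_snd) (c := 0)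
    (fun q => skewL_eq_zero.2 (X q).2.1) v)

/-- The scalar products of the differential of a geodesic displacement: in a parallel frame the
columns of the differential are Jacobi fields. -/
theorem mink_diff_displacement
    (hf : MDifferentiableAt (𝓡 2) 𝓘(ℝ, Entries) (fun p => entries (f p)) p)
    (hX : MDifferentiableAt (𝓡 2) 𝓘(ℝ, Entries) (fun p => entries (X p)) p)
    {K : Mat →ₗ[ℝ] (Fin 3 → ℝ)} (hK : ∀ A B : Mat, A.IsHermitian → B.IsHermitian →
      mink A B = K A ⬝ᵥ K B - mink (f p) A * mink (f p) B) (hKX : K (X p) = ![tnorm (X p), 0, 0])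
    (t : ℝ) (v w : TangentSpace (𝓡 2) p) :
    mink (diff (displacement f X t) p v) (diff (displacement f X t) p w) =
      jacobi (tnorm (X p)) t (K (diff f p v)) (K (diffSection X p v)) ⬝ᵥ
        jacobi (tnorm (X p)) t (K (diff f p w)) (K (diffSection X p w)) := by
  have hKf : K (f p) = 0 := by
    have h1 := hK (f p) (f p) (f p).2.1 (f p).2.1
    rw [mink_self, Matrix.vec3_dotProduct] at h1
    have h2 : ∀ i, K (f p) i = 0 := by
      intro i
      fin_cases i <;> simp <;> nlinarith [sq_nonneg (K (f p) 0), sq_nonneg (K (f p) 1),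
        sq_nonneg (K (f p) 2)]
    exact funext h2
  set r := tnorm (X p) with hr
  have hb : ∀ v, mink (X p) (diffSection X p v) = r * K (diffSection X p v) 0 := by
    intro v
    rw [hK _ _ (X p).2.1 (isHermitian_diffSection hf hX v), hKX, (X p).2.2, Matrix.vec3_dotProduct]
    simp
  have ha : ∀ v, mink (X p) (diff f p v) = r * K (diff f p v) 0 := by
    intro v
    rw [hK _ _ (X p).2.1 (isHermitian_diff hf hX v), hKX, (X p).2.2, Matrix.vec3_dotProduct]
    simp
  have hc := two_mul_deriv_coshSqrt (t * r)
  have hs := two_mul_deriv_sinhcSqrt (t * r)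
  have hsc := sinhc_mul (t * r)
  have hcs := Real.cosh_sq (t * r)
  -- The frame `K` sits at `f p`, not at the displaced point. The tangential Jacobi coordinate
  -- therefore appears turned by the hyperbolic angle `t * r` in the plane of `f p` and `X p`: its
  -- two components carry the factors `sinh` and `cosh`, which recombine at the end by `cosh² -
  -- sinh² = 1`.
  have hx : ∀ v, mink (f p) (diff (displacement f X t) p v) =
      -(Real.sinh (t * r) * (K (diff f p v) 0 + t * K (diffSection X p v) 0)) := by
    intro v
    have h1 := mink_diffSection hf hX v
    rw [ha] at h1
    rw [diff_displacement hf hX, mink_add_right, mink_add_right, mink_add_right, mink_smul_right,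
      mink_smul_right, mink_smul_right, mink_smul_right, mink_self, mink_diff_eq_zero hf hX,
      (X p).2.2, hb]
    linear_combination t * sinhc (t * r) * h1 - t * K (diffSection X p v) 0 * hc -
      (K (diff f p v) 0) * hsc
  have hk : ∀ v, K (diff (displacement f X t) p v) =
      ![Real.cosh (t * r) * (K (diff f p v) 0 + t * K (diffSection X p v) 0),
        Real.cosh (t * r) * K (diff f p v) 1 + t * sinhc (t * r) * K (diffSection X p v) 1,
        Real.cosh (t * r) * K (diff f p v) 2 + t * sinhc (t * r) * K (diffSection X p v) 2] := by
    intro v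
    rw [diff_displacement hf hX, map_add, map_add, map_add, map_smul, map_smul, map_smul, map_smul,
      hKf, hKX, hb]
    funext i
    simp only [Pi.add_apply, Pi.smul_apply, Pi.zero_apply, smul_eq_mul]
    fin_cases i
    · simp
      linear_combination (t * K (diffSection X p v) 0) * hs
    · simp [hr]
    · simp [hr]
  have hherm : ∀ v, (diff (displacement f X t) p v).IsHermitian := by
    intro v
    have hsm : ∀ (c : ℝ) {A : Mat}, A.IsHermitian → (c • A).IsHermitian := fun c A hA => by
      rw [Matrix.IsHermitian, Matrix.conjTranspose_smul, hA.eq]; simp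
    rw [diff_displacement hf hX]
    exact (((hsm _ (f p).2.1).add (hsm _ (isHermitian_diff hf hX v))).add
      (hsm _ (X p).2.1)).add (hsm _ (isHermitian_diffSection hf hX v))
  rw [hK _ _ (hherm v) (hherm w), hx, hx, hk, hk, Matrix.vec3_dotProduct, Matrix.vec3_dotProduct]
  simp only [jacobi]
  simp
  linear_combination (K (diff f p v) 0 + t * K (diffSection X p v) 0) *
    (K (diff f p w) 0 + t * K (diffSection X p w) 0) * hcs

end Manifold

/-! ### The Schatten norm along a geodesic displacement -/

section Pointwise

variable {S : Type*} [TopologicalSpace S] [ChartedSpace E2 S] [IsManifold (𝓡 2) ∞ S]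
variable {St : Type*} [TopologicalSpace St] [ChartedSpace E2 St]

theorem displacement_zero {A : Type*} (f : A → H3) (X : ∀ p : A, (f p).tangent) :
    displacement f X 0 = f := by
  funext p
  apply Subtype.ext
  change ((f p).exp ((0 : ℝ) • X p) : Mat) = _
  rw [H3.exp_smul]; simp

theorem diff_mem_tangent {f : St → H3} {p : St}
    (hf : MDifferentiableAt (𝓡 2) 𝓘(ℝ, Entries) (fun p => entries (f p)) p)
    (v : TangentSpace (𝓡 2) p) : diff f p v ∈ (f p).tangent :=
  have h0 : MDifferentiableAt (𝓡 2) 𝓘(ℝ, Entries)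
    (fun p => entries ((0 : (f p).tangent) : Mat)) p := mdifferentiableAt_const (c := (0 : Entries))
  ⟨isHermitian_diff (X := fun _ => 0) hf h0 v, mink_diff_eq_zero (X := fun _ => 0) hf h0 v⟩

/-- The pull-back of a metric as a bilinear form. -/
noncomputable def pullbackMetric (h : Metric S) (π : St → S) (p : St) :
    TangentSpace (𝓡 2) p →ₗ[ℝ] TangentSpace (𝓡 2) p →ₗ[ℝ] ℝ :=
  LinearMap.mk₂ ℝ
    (fun v w => h.inner (π p) (mfderiv (𝓡 2) (𝓡 2) π p v) (mfderiv (𝓡 2) (𝓡 2) π p w))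
    (fun _ _ _ => by simp) (fun _ _ _ => by simp) (fun _ _ _ => by simp) (fun _ _ _ => by simp)

theorem diff_add (f : St → H3) (p : St) (v w : TangentSpace (𝓡 2) p) :
    diff f p (v + w) = diff f p v + diff f p w :=
  congrArg Matrix.of (map_add (mfderiv (𝓡 2) 𝓘(ℝ, Entries) (fun p => entries (f p)) p) v w)

theorem diff_smul (f : St → H3) (p : St) (r : ℝ) (v : TangentSpace (𝓡 2) p) :
    diff f p (r • v) = r • diff f p v :=
  congrArg Matrix.of (map_smul (mfderiv (𝓡 2) 𝓘(ℝ, Entries) (fun p => entries (f p)) p) r v)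

/-- The pull-back by `f` of the metric of hyperbolic 3-space as a bilinear form. -/
noncomputable def pullbackMink (f : St → H3) (p : St) :
    TangentSpace (𝓡 2) p →ₗ[ℝ] TangentSpace (𝓡 2) p →ₗ[ℝ] ℝ :=
  LinearMap.mk₂ ℝ (fun v w => mink (diff f p v) (diff f p w))
    (fun _ _ _ => by rw [diff_add, mink_add_left]) (fun _ _ _ => by rw [diff_smul, mink_smul_left]; rfl)
    (fun _ _ _ => by rw [diff_add, mink_add_right])
    (fun _ _ _ => by rw [diff_smul, mink_smul_right]; rfl)

/-- The Gram matrix of a family of vectors for the metric pulled back by `π`. -/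
noncomputable def gramUp (h : Metric S) (π : St → S) (p : St) (e : Fin 2 → TangentSpace (𝓡 2) p) :
    Matrix (Fin 2) (Fin 2) ℝ :=
  Matrix.of fun i j =>
    h.inner (π p) (mfderiv (𝓡 2) (𝓡 2) π p (e i)) (mfderiv (𝓡 2) (𝓡 2) π p (e j))

/-- The Gram matrix of a family of vectors for the metric pulled back by `f`. -/
noncomputable def gramH3 (f : St → H3) (p : St) (e : Fin 2 → TangentSpace (𝓡 2) p) :
    Matrix (Fin 2) (Fin 2) ℝ :=
  Matrix.of fun i j => mink (diff f p (e i)) (diff f p (e j))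

variable {h : Metric S} {π : St → S} {f : St → H3} {X : ∀ p : St, (f p).tangent} {p : St}

theorem pullbackMetric_symm (v w : TangentSpace (𝓡 2) p) :
    pullbackMetric h π p v w = pullbackMetric h π p w v := h.symm _ _ _

theorem pullbackMetric_pos (hπ : Function.Injective (mfderiv (𝓡 2) (𝓡 2) π p))
    (v : TangentSpace (𝓡 2) p) (hv : v ≠ 0) : 0 < pullbackMetric h π p v v :=
  h.pos _ _ fun h0 => hv (hπ (by rw [h0, map_zero]))

theorem gramUp_det_pos (hπ : Function.Injective (mfderiv (𝓡 2) (𝓡 2) π p))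
    {e : Fin 2 → TangentSpace (𝓡 2) p} (he : LinearIndependent ℝ e) : 0 < (gramUp h π p e).det :=
  gram_det_pos (pullbackMetric h π p) pullbackMetric_symm (pullbackMetric_pos hπ) he

theorem schattenNormUp_eq (hπ : Function.Injective (mfderiv (𝓡 2) (𝓡 2) π p))
    (hf : MDifferentiableAt (𝓡 2) 𝓘(ℝ, Entries) (fun p => entries (f p)) p)
    (e : Module.Basis (Fin 2) ℝ (TangentSpace (𝓡 2) p)) :
    schattenNormUp h π f p = gramNorm (gramUp h π p e) (gramH3 f p e) :=
  schattenOne_eq_gramNorm (pullbackMetric h π p) (pullbackMink f p) pullbackMetric_symm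
    (pullbackMetric_pos hπ) (fun _ _ => mink_comm _ _)
    (fun v => tnorm_sq (f p) (diff_mem_tangent hf v)) e

theorem mdifferentiableAt_displacement
    (hf : MDifferentiableAt (𝓡 2) 𝓘(ℝ, Entries) (fun p => entries (f p)) p)
    (hX : MDifferentiableAt (𝓡 2) 𝓘(ℝ, Entries) (fun p => entries (X p)) p) (t : ℝ) :
    MDifferentiableAt (𝓡 2) 𝓘(ℝ, Entries) (fun p => entries (displacement f X t p)) p := by
  simp only [entries_displacement]
  obtain ⟨L, hL, -⟩ := hasFDerivAt_geoMap t (entries (f p), entries (X p))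
  exact MDifferentiableAt.comp p hL.differentiableAt.mdifferentiableAt (hf.prodMk_space hX)

theorem jacobi_smul (r t k : ℝ) (a b : Fin 3 → ℝ) :
    k • jacobi r t a b = jacobi r t (k • a) (k • b) := by
  ext i
  fin_cases i <;> simp [jacobi] <;> ring

theorem jacobi_sub (r t : ℝ) (a b c d : Fin 3 → ℝ) :
    jacobi r t a b - jacobi r t c d = jacobi r t (a - c) (b - d) := by
  ext i
  fin_cases i <;> simp [jacobi] <;> ring

/-- The Gram–Schmidt coefficients depend only on the metric of the surface, hence not on `t`. As
`jacobi` is linear in its initial values, orthonormalizing the source only changes those values. -/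
theorem exists_jacobi (hπ : Function.Injective (mfderiv (𝓡 2) (𝓡 2) π p))
    (hf : MDifferentiableAt (𝓡 2) 𝓘(ℝ, Entries) (fun p => entries (f p)) p)
    (hX : MDifferentiableAt (𝓡 2) 𝓘(ℝ, Entries) (fun p => entries (X p)) p)
    (e : Module.Basis (Fin 2) ℝ (TangentSpace (𝓡 2) p)) :
    ∃ a b c d : Fin 3 → ℝ,
      (∀ t, schattenNormUp h π (displacement f X t) p =
        traceNorm (jacobi (tnorm (X p)) t a b) (jacobi (tnorm (X p)) t c d)) ∧
      areaSq a c = (gramH3 f p e).det / (gramUp h π p e).det := by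
  obtain ⟨K, hK, hKX⟩ := exists_frame (f p) (X p)
  set G := gramUp h π p e with hG
  have hG10 : G 1 0 = G 0 1 := h.symm _ _ _
  have hG0 : 0 < G 0 0 := pullbackMetric_pos hπ _ (e.ne_zero 0)
  have hD : 0 < G.det := gramUp_det_pos hπ e.linearIndependent
  set k := (√(G 0 0))⁻¹
  set l := (√(G.det / G 0 0))⁻¹
  set m := G 0 1 / G 0 0
  have key := fun t => gramNorm_eq_traceNorm (G := G) (Q := gramH3 (displacement f X t) p e)
    hG10 hG0 hD (mink_diff_displacement hf hX hK hKX t (e 0) (e 0))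
    (mink_diff_displacement hf hX hK hKX t (e 0) (e 1))
    ((mink_comm _ _).trans (mink_diff_displacement hf hX hK hKX t (e 0) (e 1)))
    (mink_diff_displacement hf hX hK hKX t (e 1) (e 1))
  refine ⟨k • K (diff f p (e 0)), k • K (diffSection X p (e 0)),
    l • (K (diff f p (e 1)) - m • K (diff f p (e 0))),
    l • (K (diffSection X p (e 1)) - m • K (diffSection X p (e 0))), fun t => ?_, ?_⟩
  · rw [schattenNormUp_eq hπ (mdifferentiableAt_displacement hf hX t) e, (key t).1, jacobi_smul,
      jacobi_smul, jacobi_sub, jacobi_smul]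
  · have := (key 0).2
    rwa [jacobi_zero, jacobi_zero, displacement_zero] at this

theorem convexOn_schattenNormUp (hπ : Function.Injective (mfderiv (𝓡 2) (𝓡 2) π p))
    (hf : MDifferentiableAt (𝓡 2) 𝓘(ℝ, Entries) (fun p => entries (f p)) p)
    (hX : MDifferentiableAt (𝓡 2) 𝓘(ℝ, Entries) (fun p => entries (X p)) p) :
    ConvexOn ℝ univ fun t => schattenNormUp h π (displacement f X t) p := by
  have e : Module.Basis (Fin 2) ℝ (TangentSpace (𝓡 2) p) :=
    (EuclideanSpace.basisFun (Fin 2) ℝ).toBasis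
  obtain ⟨a, b, c, d, h1, -⟩ := exists_jacobi (h := h) hπ hf hX e
  simp only [h1]
  exact convexOn_traceNorm_jacobi (Real.sqrt_nonneg _) a b c d

theorem schattenNormUp_second_difference (hπ : Function.Injective (mfderiv (𝓡 2) (𝓡 2) π p))
    (hf : MDifferentiableAt (𝓡 2) 𝓘(ℝ, Entries) (fun p => entries (f p)) p)
    (hX : MDifferentiableAt (𝓡 2) 𝓘(ℝ, Entries) (fun p => entries (X p)) p)
    (e : Module.Basis (Fin 2) ℝ (TangentSpace (𝓡 2) p)) (t : ℝ) :
    2 * (√(schattenNormUp h π f p ^ 2 + mink (X p) (X p) *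
      √((gramH3 f p e).det / (gramUp h π p e).det) * t ^ 2) - schattenNormUp h π f p) ≤
      schattenNormUp h π (displacement f X t) p + schattenNormUp h π (displacement f X (-t)) p -
        2 * schattenNormUp h π f p := by
  obtain ⟨a, b, c, d, h1, h2⟩ := exists_jacobi (h := h) hπ hf hX e
  have h0 := h1 0
  rw [displacement_zero, jacobi_zero, jacobi_zero] at h0
  have hr2 : tnorm (X p) ^ 2 = mink (X p) (X p) := Real.sq_sqrt (tnorm_sq _ (X p).2)
  rw [h1, h1, h0, ← h2, ← hr2]
  exact traceNorm_jacobi_second_difference _ t a b c d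

end Pointwise

/-! ### The metric in charts -/

section Charts

variable {S : Type*} [TopologicalSpace S] [ChartedSpace E2 S] [IsManifold (𝓡 2) ∞ S]

/-- The standard basis of the model plane. -/
noncomputable def stdBasis (i : Fin 2) : E2 := EuclideanSpace.single i (1 : ℝ)

theorem linearIndependent_stdBasis : LinearIndependent ℝ stdBasis := by
  have h := (EuclideanSpace.basisFun (Fin 2) ℝ).toBasis.linearIndependent
  have h1 : stdBasis = ⇑(EuclideanSpace.basisFun (Fin 2) ℝ).toBasis := by
    ext i : 1
    simp [stdBasis]
  rw [h1]
  exact h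

theorem contMDiffOn_chartAt_symm' (x : S) :
    ContMDiffOn (𝓡 2) (𝓡 2) ∞ (chartAt E2 x).symm (chartAt E2 x).target :=
  contMDiffOn_chart_symm

theorem mdifferentiableAt_chartAt_symm {x : S} {y : E2} (hy : y ∈ (chartAt E2 x).target) :
    MDifferentiableAt (𝓡 2) (𝓡 2) (chartAt E2 x).symm y :=
  ((contMDiffOn_chartAt_symm' x).contMDiffAt ((chartAt E2 x).open_target.mem_nhds hy)
    ).mdifferentiableAt (by simp)

theorem mdifferentiableAt_chartAt {x z : S} (hz : z ∈ (chartAt E2 x).source) :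
    MDifferentiableAt (𝓡 2) (𝓡 2) (chartAt E2 x) z :=
  ((contMDiffOn_chart (I := 𝓡 2) (n := ∞) (x := x)).contMDiffAt
    ((chartAt E2 x).open_source.mem_nhds hz)).mdifferentiableAt (by simp)

theorem injective_mfderiv_chartAt_symm {x : S} {y : E2} (hy : y ∈ (chartAt E2 x).target) :
    Function.Injective (mfderiv (𝓡 2) (𝓡 2) (chartAt E2 x).symm y) := by
  have h1 := mfderiv_comp y (mdifferentiableAt_chartAt ((chartAt E2 x).map_target hy))
    (mdifferentiableAt_chartAt_symm hy)
  have h2 : (chartAt E2 x) ∘ (chartAt E2 x).symm =ᶠ[𝓝 y] id := by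
    filter_upwards [(chartAt E2 x).open_target.mem_nhds hy] with z hz
    exact (chartAt E2 x).right_inv hz
  rw [h2.mfderiv_eq, mfderiv_id] at h1
  intro v w hvw
  have h3 := congrArg (fun L => L v) h1
  have h4 := congrArg (fun L => L w) h1
  simp only [ContinuousLinearMap.comp_apply] at h3 h4
  rw [hvw, ← h4] at h3
  exact h3

/-- The coordinate vector fields along the inverse chart are its tangent map applied to constant
fields, so they are smooth; the metric, a smooth section of bilinear forms, is evaluated on them. -/
theorem contDiffOn_gram (h : Metric S) (x : S) (i j : Fin 2) :
    ContDiffOn ℝ ∞ (fun y => gram h x y i j) (chartAt E2 x).target := by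
  have hv : ∀ i : Fin 2, ContMDiffOn (𝓡 2) (𝓡 2).tangent ∞
      (fun y : E2 => (⟨(chartAt E2 x).symm y,
        mfderiv (𝓡 2) (𝓡 2) (chartAt E2 x).symm y (stdBasis i)⟩ : TangentBundle (𝓡 2) S))
      (chartAt E2 x).target := by
    intro i
    have h1 := (contMDiffOn_chartAt_symm' x).contMDiffOn_tangentMapWithin (m := ∞) (by simp)
      (chartAt E2 x).open_target.uniqueMDiffOn
    have h2 : ContMDiff (𝓡 2) (𝓡 2).tangent ∞
        (fun y : E2 => (⟨y, stdBasis i⟩ : TangentBundle (𝓡 2) E2)) :=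
      contMDiff_vectorSpace_iff_contDiff.2 contDiff_const
    refine (h1.comp h2.contMDiffOn (fun y hy => hy)).congr fun y hy => ?_
    simp only [Function.comp, tangentMapWithin]
    rw [mfderivWithin_of_isOpen (chartAt E2 x).open_target hy]
  intro y hy
  refine ContMDiffWithinAt.contDiffWithinAt ?_
  have : ContMDiffWithinAt (𝓡 2) ((𝓡 2).prod 𝓘(ℝ)) ∞
      (fun m ↦ Bundle.TotalSpace.mk' ℝ (E := Bundle.Trivial S ℝ) ((chartAt E2 x).symm m)
        (h.inner ((chartAt E2 x).symm m)
          (mfderiv (𝓡 2) (𝓡 2) (chartAt E2 x).symm m (stdBasis i))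
          (mfderiv (𝓡 2) (𝓡 2) (chartAt E2 x).symm m (stdBasis j)))) (chartAt E2 x).target y := by
    apply ContMDiffWithinAt.clm_bundle_apply₂ (F₁ := E2) (F₂ := E2)
    · exact ContMDiffAt.comp_contMDiffWithinAt y h.contMDiff.contMDiffAt
        (contMDiffOn_chartAt_symm' x y hy)
    · exact hv i y hy
    · exact hv j y hy
  simp only [Bundle.contMDiffWithinAt_totalSpace] at this
  exact this.2

theorem gram_eq_gramUp (h : Metric S) (x : S) (y : E2) :
    gram h x y = gramUp h (chartAt E2 x).symm y stdBasis := rfl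

theorem gram_det_pos_of_mem (h : Metric S) {x : S} {y : E2} (hy : y ∈ (chartAt E2 x).target) :
    0 < (gram h x y).det := by
  rw [gram_eq_gramUp]
  exact gramUp_det_pos (injective_mfderiv_chartAt_symm hy) linearIndependent_stdBasis

theorem gram_zero_zero_pos (h : Metric S) {x : S} {y : E2} (hy : y ∈ (chartAt E2 x).target) :
    0 < gram h x y 0 0 :=
  pullbackMetric_pos (π := (chartAt E2 x).symm) (injective_mfderiv_chartAt_symm hy) _
    (linearIndependent_stdBasis.ne_zero 0)

theorem contDiffOn_gram_det (h : Metric S) (x : S) :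
    ContDiffOn ℝ ∞ (fun y => (gram h x y).det) (chartAt E2 x).target := by
  simp only [Matrix.det_fin_two]
  exact ((contDiffOn_gram h x 0 0).mul (contDiffOn_gram h x 1 1)).sub
    ((contDiffOn_gram h x 0 1).mul (contDiffOn_gram h x 1 0))

/-- All tangent spaces are copies of `E2`; this moves an inner product along an equality of base
points. -/
theorem inner_congr (h : Metric S) {x x' : S} (hx : x = x') (v w : E2) :
    h.inner x (v : TangentSpace (𝓡 2) x) (w : TangentSpace (𝓡 2) x) =
      h.inner x' (v : TangentSpace (𝓡 2) x') (w : TangentSpace (𝓡 2) x') := by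
  subst hx; rfl

end Charts

/-! ### Local sections of the covering -/

section Lift

variable {S : Type*} [TopologicalSpace S] [ChartedSpace E2 S] [IsManifold (𝓡 2) ∞ S]
variable {St : Type*} [TopologicalSpace St] [ChartedSpace E2 St]

/-- The map `ψ` from the chart domain at `x` to the covering lifts the inverse of the chart. -/
structure IsLocalLift (π : St → S) (x : S) (ψ : E2 → St) (O : Set E2) : Prop where
  isOpen : IsOpen O
  subset : O ⊆ (chartAt E2 x).target
  smooth : ContMDiffOn (𝓡 2) (𝓡 2) ∞ ψ O
  lift : ∀ y ∈ O, π (ψ y) = (chartAt E2 x).symm y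

/-- Compose the inverse chart with a local inverse of `π`. Local lifts turn questions about the
Schatten norm on `S` into calculus in the plane. -/
theorem exists_isLocalLift {π : St → S} (hπ : IsLocalDiffeomorph (𝓡 2) (𝓡 2) ∞ π) (p : St) :
    ∃ ψ O, IsLocalLift π (π p) ψ O ∧ chartAt E2 (π p) (π p) ∈ O ∧
      ψ (chartAt E2 (π p) (π p)) = p := by
  set φ := chartAt E2 (π p)
  have hx : π p ∈ φ.source := mem_chart_source E2 (π p)
  have hp := hπ p
  refine ⟨fun y => hp.localInverse (φ.symm y), φ.target ∩ φ.symm ⁻¹' hp.localInverse.source,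
    ⟨?_, inter_subset_left, ?_, fun y hy => ?_⟩, ⟨φ.map_source hx, ?_⟩, ?_⟩
  · exact φ.symm.isOpen_inter_preimage hp.localInverse_open_source
  · exact hp.contmdiffOn_localInverse.comp
      ((contMDiffOn_chartAt_symm' (π p)).mono inter_subset_left) inter_subset_right
  · exact hp.localInverse_right_inv hy.2
  · rw [mem_preimage, φ.left_inv hx]; exact hp.localInverse_mem_source
  · change hp.localInverse (φ.symm (φ (π p))) = p
    rw [φ.left_inv hx, hp.localInverse_left_inv hp.localInverse_mem_target]

/-- The Gram matrix for `mink` of the partial derivatives of a map to the ambient space. -/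
noncomputable def gramE (u : E2 → Entries) (y : E2) : Matrix (Fin 2) (Fin 2) ℝ :=
  Matrix.of fun i j => minkL (fderiv ℝ u y (stdBasis i)) (fderiv ℝ u y (stdBasis j))

variable {π : St → S} {x : S} {ψ : E2 → St} {O : Set E2} {y : E2}

theorem IsLocalLift.mdifferentiableAt (hψ : IsLocalLift π x ψ O) (hy : y ∈ O) :
    MDifferentiableAt (𝓡 2) (𝓡 2) ψ y :=
  (hψ.smooth.contMDiffAt (hψ.isOpen.mem_nhds hy)).mdifferentiableAt (by simp)

theorem IsLocalLift.mfderiv_mfderiv (hψ : IsLocalLift π x ψ O)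
    (hπ : IsLocalDiffeomorph (𝓡 2) (𝓡 2) ∞ π) (hy : y ∈ O) (v : E2) :
    (mfderiv (𝓡 2) (𝓡 2) π (ψ y) (mfderiv (𝓡 2) (𝓡 2) ψ y v) : E2) =
      (mfderiv (𝓡 2) (𝓡 2) (chartAt E2 x).symm y v : E2) := by
  have h1 := mfderiv_comp y (hπ.mdifferentiable (by simp) (ψ y)) (hψ.mdifferentiableAt hy)
  have h2 : π ∘ ψ =ᶠ[𝓝 y] (chartAt E2 x).symm := by
    filter_upwards [hψ.isOpen.mem_nhds hy] with z hz using hψ.lift z hz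
  rw [h2.mfderiv_eq] at h1
  exact (congrArg (fun L : E2 →L[ℝ] E2 => L v) h1).symm

/-- The coordinate basis of the tangent space at a point in the image of a local lift. -/
theorem IsLocalLift.exists_basis (hψ : IsLocalLift π x ψ O)
    (hπ : IsLocalDiffeomorph (𝓡 2) (𝓡 2) ∞ π) (hy : y ∈ O) :
    ∃ e : Module.Basis (Fin 2) ℝ (TangentSpace (𝓡 2) (ψ y)),
      ∀ i, e i = mfderiv (𝓡 2) (𝓡 2) ψ y (stdBasis i) := by
  have hinj : Function.Injective (mfderiv (𝓡 2) (𝓡 2) ψ y) := by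
    intro v w hvw
    apply injective_mfderiv_chartAt_symm (hψ.subset hy)
    have h1 := hψ.mfderiv_mfderiv hπ hy v
    have h2 := hψ.mfderiv_mfderiv hπ hy w
    rw [hvw] at h1
    exact h1.symm.trans h2
  have hli : LinearIndependent ℝ fun i : Fin 2 => mfderiv (𝓡 2) (𝓡 2) ψ y (stdBasis i) :=
    linearIndependent_stdBasis.map' (mfderiv (𝓡 2) (𝓡 2) ψ y).toLinearMap
      (LinearMap.ker_eq_bot.2 hinj)
  have hcard : Fintype.card (Fin 2) = Module.finrank ℝ (TangentSpace (𝓡 2) (ψ y)) :=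
    (finrank_euclideanSpace_fin (𝕜 := ℝ) (n := 2)).symm ▸ Fintype.card_fin 2
  refine ⟨basisOfLinearIndependentOfCardEqFinrank hli hcard, fun i => ?_⟩
  simp

theorem IsLocalLift.gramUp_eq (hψ : IsLocalLift π x ψ O)
    (hπ : IsLocalDiffeomorph (𝓡 2) (𝓡 2) ∞ π) (hy : y ∈ O) (h : Metric S) :
    gramUp h π (ψ y) (fun i => mfderiv (𝓡 2) (𝓡 2) ψ y (stdBasis i)) = gram h x y := by
  ext i j
  have h1 := hψ.mfderiv_mfderiv hπ hy (stdBasis i)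
  have h2 := hψ.mfderiv_mfderiv hπ hy (stdBasis j)
  refine (inner_congr h (hψ.lift y hy) _ _).trans ?_
  rw [h1, h2]
  rfl

theorem IsLocalLift.gramH3_eq (hψ : IsLocalLift π x ψ O) (hy : y ∈ O) {f : St → H3}
    (hf : MDifferentiableAt (𝓡 2) 𝓘(ℝ, Entries) (fun p => entries (f p)) (ψ y)) :
    gramH3 f (ψ y) (fun i => mfderiv (𝓡 2) (𝓡 2) ψ y (stdBasis i)) =
      gramE (fun y => entries (f (ψ y))) y := by
  have h1 := mfderiv_comp y hf (hψ.mdifferentiableAt hy)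
  have h2 : ∀ v : E2, diff f (ψ y) (mfderiv (𝓡 2) (𝓡 2) ψ y v) =
      Matrix.of (fderiv ℝ (fun y => entries (f (ψ y))) y v) := by
    intro v
    rw [← mfderiv_eq_fderiv]
    exact congrArg (fun L : E2 →L[ℝ] Entries => Matrix.of (L v)) h1.symm
  ext i j
  simp only [gramH3, gramE, Matrix.of_apply, h2, minkL_apply]

theorem IsLocalLift.contDiffOn (hψ : IsLocalLift π x ψ O) {u : St → Entries}
    (hu : ContMDiff (𝓡 2) 𝓘(ℝ, Entries) ∞ u) : ContDiffOn ℝ ∞ (fun y => u (ψ y)) O :=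
  (hu.comp_contMDiffOn hψ.smooth).contDiffOn

theorem injective_mfderiv_of_isLocalDiffeomorph (hπ : IsLocalDiffeomorph (𝓡 2) (𝓡 2) ∞ π) (p : St) :
    Function.Injective (mfderiv (𝓡 2) (𝓡 2) π p) := by
  have := ((hπ p).mfderivToContinuousLinearEquiv (by simp)).injective
  exact this

/-- In the frame `dψ (∂ᵢ)` the metric pulled back by `π` has the Gram matrix of `h` in the chart,
because `π ∘ ψ` is the inverse chart. Continuity, smoothness and deck invariance of the norm are all
read off from this formula. -/
theorem IsLocalLift.schattenNormUp_eq (hψ : IsLocalLift π x ψ O)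
    (hπ : IsLocalDiffeomorph (𝓡 2) (𝓡 2) ∞ π) (hy : y ∈ O) (h : Metric S) {f : St → H3}
    (hf : ContMDiff (𝓡 2) 𝓘(ℝ, Entries) ∞ fun p => entries (f p)) :
    schattenNormUp h π f (ψ y) =
      gramNorm (gram h x y) (gramE (fun y => entries (f (ψ y))) y) := by
  have hf' := hf.mdifferentiable (by simp) (ψ y)
  obtain ⟨e, he⟩ := hψ.exists_basis hπ hy
  rw [SchattenEnergy.schattenNormUp_eq (injective_mfderiv_of_isLocalDiffeomorph hπ _) hf' e,
    funext he, hψ.gramUp_eq hπ hy, hψ.gramH3_eq hy hf']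

end Lift

/-! ### Invariance under deck transformations -/

theorem mink_eq_det (X Y : Mat) : mink X Y = (X.det + Y.det - (X + Y).det).re / 2 := by
  simp only [mink, Matrix.det_fin_two, Matrix.trace_fin_two, Matrix.mul_apply, Fin.sum_univ_two,
    Matrix.add_apply]
  congr 2
  ring

/-- The map `X ↦ A X Aᴴ` multiplies `det` by `|det A|² = 1`, and `mink` is the polarization of
`-det`. -/
theorem mink_pslAction (g : Matrix.ProjectiveSpecialLinearGroup (Fin 2) ℂ) (X Y : Mat) :
    mink (pslAction g X) (pslAction g Y) = mink X Y := by
  induction g using QuotientGroup.induction_on with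
  | H A =>
    have h : ∀ Z : Mat, (pslAction (QuotientGroup.mk A) Z).det = Z.det := by
      intro Z
      change ((A : Mat) * Z * (A : Mat)ᴴ).det = Z.det
      rw [Matrix.det_mul, Matrix.det_mul, Matrix.det_conjTranspose, A.det_coe]
      simp
    rw [mink_eq_det, mink_eq_det, ← map_add, h, h, h]

/-- The action of an isometry on entries. -/
noncomputable def pslL (g : Matrix.ProjectiveSpecialLinearGroup (Fin 2) ℂ) : Entries →L[ℝ] Entries :=
  LinearMap.toContinuousLinearMap
    { toFun := fun u => entries (pslAction g (Matrix.of u))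
      map_add' := fun u w => congrArg entries ((pslAction g).map_add (Matrix.of u) (Matrix.of w))
      map_smul' := fun r u => congrArg entries ((pslAction g).map_smul r (Matrix.of u)) }

theorem pslL_entries (g : Matrix.ProjectiveSpecialLinearGroup (Fin 2) ℂ) (A : Mat) :
    pslL g (entries A) = entries (pslAction g A) := rfl

theorem minkL_pslL (g : Matrix.ProjectiveSpecialLinearGroup (Fin 2) ℂ) (u w : Entries) :
    minkL (pslL g u) (pslL g w) = minkL u w := mink_pslAction g _ _

/-- The formula for `geoMap` uses only `mink` and linear combinations, so displacement commutes with
isometries. -/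
theorem geoMap_pslL (g : Matrix.ProjectiveSpecialLinearGroup (Fin 2) ℂ) (t : ℝ) (u w : Entries) :
    geoMap t (pslL g u, pslL g w) = pslL g (geoMap t (u, w)) := by
  simp only [geoMap, minkL_pslL, map_add, map_smul]

theorem gramE_pslL (g : Matrix.ProjectiveSpecialLinearGroup (Fin 2) ℂ) {u : E2 → Entries} {y : E2}
    (hu : DifferentiableAt ℝ u y) : gramE (fun y => pslL g (u y)) y = gramE u y := by
  have h1 : fderiv ℝ (fun y => pslL g (u y)) y = (pslL g).comp (fderiv ℝ u y) :=
    ((pslL g).hasFDerivAt.comp y hu.hasFDerivAt).fderiv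
  ext i j
  simp only [gramE, Matrix.of_apply, h1, ContinuousLinearMap.comp_apply, minkL_pslL]

theorem gramE_congr {u w : E2 → Entries} {y : E2} (h : u =ᶠ[𝓝 y] w) : gramE u y = gramE w y := by
  simp only [gramE, h.fderiv_eq]

section Deck

variable {S : Type*} [TopologicalSpace S] [ChartedSpace E2 S] [IsManifold (𝓡 2) ∞ S]
variable {St : Type*} [TopologicalSpace St] [ChartedSpace E2 St] [IsManifold (𝓡 2) ∞ St]
variable {π : St → S}

/-- Lift `π` through itself, once sending `p` to `p'` and once back; simple connectedness gives the
lifts, and uniqueness of lifts makes them inverse to each other. -/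
theorem exists_deck (hπ : IsUniversalCover π) {p p' : St} (hp : π p = π p') :
    ∃ γ : deckGroup π, γ.1 p = p' := by
  have := hπ.simplyConnected
  have : LocallyPathConnectedSpace St := ChartedSpace.locallyPathConnectedSpace E2 St
  have hc := hπ.isCoveringMap
  have hcont : Continuous π := hc.continuous
  have key : ∀ p p' : St, π p = π p' → ∃ F : C(St, St), F p = p' ∧ π ∘ F = π := by
    intro p p' h
    obtain ⟨F, hF, -⟩ := hc.existsUnique_continuousMap_lifts ⟨π, hcont⟩ p p' h.symm
    exact ⟨F, hF.1, hF.2⟩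
  obtain ⟨F, hF, hF'⟩ := key p p' hp
  obtain ⟨G, hG, hG'⟩ := key p' p hp.symm
  have huniq : ∀ (H : C(St, St)) (q : St), H q = q → π ∘ H = π → ∀ z, H z = z := by
    intro H q hq hH z
    exact congrFun (hc.eq_of_comp_eq H.continuous continuous_id hH q hq) z
  have hGF : ∀ z, G (F z) = z := huniq (G.comp F) p (by simp [hF, hG]) (by
    rw [ContinuousMap.coe_comp, ← Function.comp_assoc, hG', hF'])
  have hFG : ∀ z, F (G z) = z := huniq (F.comp G) p' (by simp [hF, hG]) (by
    rw [ContinuousMap.coe_comp, ← Function.comp_assoc, hF', hG'])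
  exact ⟨⟨⟨⟨F, G, hGF, hFG⟩, F.continuous, G.continuous⟩, fun z => congrFun hF' z⟩, hF⟩

/-- Local lifts through two points of a fibre differ by a deck transformation. -/
theorem IsLocalLift.eventuallyEq_deck (hπ : IsLocalDiffeomorph (𝓡 2) (𝓡 2) ∞ π) (γ : deckGroup π)
    {x : S} {ψ ψ' : E2 → St} {O O' : Set E2} {y : E2} (hψ : IsLocalLift π x ψ O)
    (hψ' : IsLocalLift π x ψ' O') (hy : y ∈ O) (hy' : y ∈ O') (h : γ.1 (ψ y) = ψ' y) :
    (fun z => γ.1 (ψ z)) =ᶠ[𝓝 y] ψ' := by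
  -- Both sides are continuous lifts of the inverse chart with the same value at `y`, and `π` is
  -- injective near that value.
  obtain ⟨e, he, hee⟩ := hπ.isLocalHomeomorph (ψ' y)
  have hinj : InjOn π e.source := hee ▸ e.injOn
  have hc : ContinuousAt ψ y := hψ.smooth.continuousOn.continuousAt (hψ.isOpen.mem_nhds hy)
  have hc' : ContinuousAt ψ' y := hψ'.smooth.continuousOn.continuousAt (hψ'.isOpen.mem_nhds hy')
  have hγ : ContinuousAt (fun z => γ.1 (ψ z)) y := γ.1.continuous.continuousAt.comp hc
  have hW := e.open_source.mem_nhds he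
  filter_upwards [hc'.preimage_mem_nhds hW, hγ.preimage_mem_nhds (h.symm ▸ hW),
    hψ.isOpen.mem_nhds hy, hψ'.isOpen.mem_nhds hy'] with z h1 h2 h3 h4
  refine hinj h2 h1 ?_
  rw [γ.2 (ψ z), hψ.lift z h3, hψ'.lift z h4]

/-- Near the point, `f ∘ ψ'` is `f ∘ ψ` followed by the isometry `ρ γ`, so both have the same Gram
matrix. Deck transformations are given only as homeomorphisms; comparing two local lifts avoids
differentiating them. -/
theorem schattenNormUp_eq_of_equivariant (hπ : IsUniversalCover π) (h : Metric S)
    {ρ : deckGroup π →* Matrix.ProjectiveSpecialLinearGroup (Fin 2) ℂ} {f : St → H3}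
    (hf : IsEquivariantMap π ρ f) {p p' : St} (hp : π p = π p') :
    schattenNormUp h π f p = schattenNormUp h π f p' := by
  have hd := hπ.isLocalDiffeomorph
  obtain ⟨γ, hγ⟩ := exists_deck hπ hp
  obtain ⟨ψ, O, hψ, hO, hψp⟩ := exists_isLocalLift hd p
  obtain ⟨ψ', O', hψ', hO', hψp'⟩ := exists_isLocalLift hd p'
  rw [← hp] at hψ' hO' hψp'
  set y := chartAt E2 (π p) (π p)
  have h1 := hψ.schattenNormUp_eq hd hO h hf.smooth
  have h2 := hψ'.schattenNormUp_eq hd hO' h hf.smooth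
  have h3 := hψ.eventuallyEq_deck hd γ hψ' hO hO' (by rw [hψp, hψp', hγ])
  have h4 : (fun z => entries (f (ψ' z))) =ᶠ[𝓝 y] fun z => pslL (ρ γ) (entries (f (ψ z))) := by
    filter_upwards [h3] with z hz
    rw [← hz, hf.equivariant, pslL_entries]
  have hu : DifferentiableAt ℝ (fun z => entries (f (ψ z))) y :=
    ((hψ.contDiffOn hf.smooth).contDiffAt (hψ.isOpen.mem_nhds hO)).differentiableAt (by simp)
  have h5 := (gramE_congr h4).trans (gramE_pslL (ρ γ) hu)
  rw [hψp] at h1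
  rw [hψp', h5] at h2
  exact h1.trans h2.symm

theorem schattenNorm_eq (hπ : IsUniversalCover π) (h : Metric S)
    {ρ : deckGroup π →* Matrix.ProjectiveSpecialLinearGroup (Fin 2) ℂ} {f : St → H3}
    (hf : IsEquivariantMap π ρ f) (p : St) :
    schattenNorm h hπ f (π p) = schattenNormUp h π f p :=
  schattenNormUp_eq_of_equivariant hπ h hf (Function.surjInv_eq hπ.surjective (π p))

theorem isEquivariantMap_displacement
    {ρ : deckGroup π →* Matrix.ProjectiveSpecialLinearGroup (Fin 2) ℂ} {f : St → H3}
    (hf : IsEquivariantMap π ρ f) {X : ∀ p : St, (f p).tangent} (hX : IsInvariantSection π ρ f X)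
    (t : ℝ) : IsEquivariantMap π ρ (displacement f X t) := by
  refine ⟨?_, fun γ p => ?_⟩
  · simp only [entries_displacement]
    have h0 : ContDiff ℝ ∞ fun z : Entries × Entries => (t, z) := contDiff_const.prodMk contDiff_id
    have h1 := (contDiff_geoMap (n := ∞) le_rfl).comp h0
    exact h1.contMDiff.comp (hf.smooth.prodMk_space hX.smooth)
  · have e1 : entries (f (γ.1 p)) = pslL (ρ γ) (entries (f p)) :=
      congrArg entries (hf.equivariant γ p)
    have e2 : entries (X (γ.1 p)) = pslL (ρ γ) (entries (X p)) :=
      congrArg entries (hX.invariant γ p)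
    have h1 := entries_displacement f X t (γ.1 p)
    rw [e1, e2, geoMap_pslL, ← entries_displacement] at h1
    exact h1

end Deck

/-! ### The area measure -/

section Area

variable {S : Type*} [TopologicalSpace S] [ChartedSpace E2 S] [IsManifold (𝓡 2) ∞ S]
  [MeasurableSpace S] [BorelSpace S]

/-- The density of the area measure in the preferred chart at `x`. -/
noncomputable def areaDensity (h : Metric S) (x : S) (y : E2) : ENNReal :=
  ENNReal.ofReal √((gram h x y).det)

theorem chartArea_apply (h : Metric S) (x : S) {A : Set S} (hA : MeasurableSet A) :
    chartArea h x A =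
      ∫⁻ y in (chartAt E2 x).symm ⁻¹' A ∩ (chartAt E2 x).target, areaDensity h x y := by
  have hm : MeasurableSet (chartAt E2 x).target := (chartAt E2 x).open_target.measurableSet
  have h1 : AEMeasurable (chartAt E2 x).symm (volume.restrict (chartAt E2 x).target) :=
    (chartAt E2 x).continuousOn_symm.aemeasurable hm
  rw [chartArea, Measure.map_apply_of_aemeasurable
    (h1.mono_ac (withDensity_absolutelyContinuous _ _)) hA, withDensity_apply',
    Measure.restrict_restrict' hm]
  rfl

theorem measurableSet_preimage_inter_target (x : S) {A : Set S} (hA : MeasurableSet A) :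
    MeasurableSet ((chartAt E2 x).symm ⁻¹' A ∩ (chartAt E2 x).target) := by
  have hm : MeasurableSet (chartAt E2 x).target := (chartAt E2 x).open_target.measurableSet
  have h1 := (continuousOn_iff_continuous_domRestrict.1 (chartAt E2 x).continuousOn_symm).measurable
    hA
  have h2 := hm.subtype_image h1
  convert h2 using 1
  ext y
  simp [and_comm]

theorem areaDensity_pos (h : Metric S) {x : S} {y : E2} (hy : y ∈ (chartAt E2 x).target) :
    0 < areaDensity h x y :=
  ENNReal.ofReal_pos.2 (Real.sqrt_pos.2 (gram_det_pos_of_mem h hy))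

theorem continuousOn_areaDensity (h : Metric S) (x : S) :
    ContinuousOn (areaDensity h x) (chartAt E2 x).target :=
  ENNReal.continuous_ofReal.comp_continuousOn
    (Real.continuous_sqrt.comp_continuousOn (contDiffOn_gram_det h x).continuousOn)

theorem area_pos_of_isOpen (h : Metric S) {U : Set S} (hU : IsOpen U) {x : S} (hx : x ∈ U) :
    0 < area h U := by
  refine lt_of_lt_of_le ?_ ((le_iSup (chartArea h) x) U)
  rw [chartArea_apply h x hU.measurableSet, pos_iff_ne_zero]
  have hm := measurableSet_preimage_inter_target x hU.measurableSet
  have hc := (continuousOn_areaDensity h x).mono (inter_subset_right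
    (s := (chartAt E2 x).symm ⁻¹' U))
  intro h0
  rw [lintegral_eq_zero_iff' (hc.aemeasurable hm), ae_eq_restrict_iff_indicator_ae_eq hm] at h0
  have h1 : ∀ᵐ y ∂(volume : Measure E2), y ∉ (chartAt E2 x).symm ⁻¹' U ∩ (chartAt E2 x).target := by
    filter_upwards [h0] with y hy hy'
    rw [indicator_of_mem hy', indicator_of_mem hy'] at hy
    exact (areaDensity_pos h hy'.2).ne' hy
  have h2 : volume ((chartAt E2 x).symm ⁻¹' U ∩ (chartAt E2 x).target) = 0 := by
    rw [ae_iff] at h1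
    simp only [not_not] at h1
    exact h1
  have ho : IsOpen ((chartAt E2 x).symm ⁻¹' U ∩ (chartAt E2 x).target) := by
    rw [inter_comm]
    exact (chartAt E2 x).symm.isOpen_inter_preimage hU
  refine (ho.measure_pos volume ⟨chartAt E2 x x, ?_, mem_chart_target E2 x⟩).ne' h2
  rw [mem_preimage, (chartAt E2 x).left_inv (mem_chart_source E2 x)]
  exact hx

theorem det_gram_comp (g : E2 →ₗ[ℝ] E2 →ₗ[ℝ] ℝ) (T : E2 →ₗ[ℝ] E2) :
    (Matrix.of fun i j => g (T (stdBasis i)) (T (stdBasis j))).det =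
      LinearMap.det T ^ 2 * (Matrix.of fun i j => g (stdBasis i) (stdBasis j)).det := by
  let b := (EuclideanSpace.basisFun (Fin 2) ℝ).toBasis
  have hb : ∀ i, b i = stdBasis i := fun i => by simp [b, stdBasis]
  set M := LinearMap.toMatrix b b T with hM
  have hT : ∀ j, T (stdBasis j) = M 0 j • stdBasis 0 + M 1 j • stdBasis 1 := by
    intro j
    rw [← b.sum_repr (T (stdBasis j)), Fin.sum_univ_two, ← hb, ← hb, ← hb]
    simp [hM, LinearMap.toMatrix_apply]
  rw [← LinearMap.det_toMatrix b, ← hM]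
  simp only [Matrix.det_fin_two, Matrix.of_apply, hT, map_add, map_smul, LinearMap.add_apply,
    LinearMap.smul_apply, smul_eq_mul]
  ring

/-- The change of charts. -/
theorem areaDensity_transition (h : Metric S) {x x' : S} {y : E2}
    (hy : y ∈ (chartAt E2 x).target) (hy' : (chartAt E2 x).symm y ∈ (chartAt E2 x').source) :
    ∃ T : E2 →L[ℝ] E2, HasFDerivAt (fun z => chartAt E2 x' ((chartAt E2 x).symm z)) T y ∧
      areaDensity h x y = ENNReal.ofReal |T.det| *
        areaDensity h x' (chartAt E2 x' ((chartAt E2 x).symm y)) := by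
  set φ := chartAt E2 x
  set φ' := chartAt E2 x'
  have h1 : HasMFDerivAt (𝓡 2) (𝓡 2) (φ' ∘ φ.symm) y _ :=
    ((mdifferentiableAt_chartAt hy').comp y (mdifferentiableAt_chartAt_symm hy)).hasMFDerivAt
  set T : E2 →L[ℝ] E2 := mfderiv (𝓡 2) (𝓡 2) (φ' ∘ φ.symm) y
  refine ⟨T, hasMFDerivAt_iff_hasFDerivAt.1 h1, ?_⟩
  have hz : φ' (φ.symm y) ∈ φ'.target := φ'.map_source hy'
  have hzz : φ'.symm (φ' (φ.symm y)) = φ.symm y := φ'.left_inv hy'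
  have h2 : HasMFDerivAt (𝓡 2) (𝓡 2) (φ'.symm ∘ (φ' ∘ φ.symm)) y _ :=
    HasMFDerivAt.comp y (mdifferentiableAt_chartAt_symm (x := x') hz).hasMFDerivAt h1
  have h3 : φ'.symm ∘ (φ' ∘ φ.symm) =ᶠ[𝓝 y] φ.symm := by
    have : φ.target ∩ φ.symm ⁻¹' φ'.source ∈ 𝓝 y :=
      (φ.symm.isOpen_inter_preimage φ'.open_source).mem_nhds ⟨hy, hy'⟩
    filter_upwards [this] with z hz
    exact φ'.left_inv hz.2
  have h4 := (h2.mfderiv.symm.trans h3.mfderiv_eq)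
  have h5 : ∀ v : E2, (mfderiv (𝓡 2) (𝓡 2) φ.symm y v : E2) =
      (mfderiv (𝓡 2) (𝓡 2) φ'.symm (φ' (φ.symm y)) (T v) : E2) := fun v =>
    (congrArg (fun L : E2 →L[ℝ] E2 => L v) h4).symm
  have h6 : (gram h x y).det = T.det ^ 2 * (gram h x' (φ' (φ.symm y))).det := by
    refine Eq.trans ?_ (det_gram_comp (pullbackMetric h φ'.symm (φ' (φ.symm y))) T.toLinearMap)
    congr 1
    ext i j
    refine Eq.trans (inner_congr h hzz.symm _ _) ?_
    erw [h5, h5]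
    rfl
  rw [areaDensity, areaDensity, h6, Real.sqrt_mul (sq_nonneg _), Real.sqrt_sq_eq_abs,
    ENNReal.ofReal_mul (abs_nonneg _)]

/-- By the change of variables formula the two chart measures agree on the overlap of the chart
domains, and the measure of the chart at `x'` sees only the part of `A` in its own domain. -/
theorem chartArea_le (h : Metric S) (x x' : S) {A : Set S} (hA : MeasurableSet A)
    (hAx : A ⊆ (chartAt E2 x).source) : chartArea h x' A ≤ chartArea h x A := by
  set φ := chartAt E2 x with hφ
  set φ' := chartAt E2 x' with hφ'
  set D := φ.symm ⁻¹' (A ∩ φ'.source) ∩ φ.target with hD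
  have hDm : MeasurableSet D :=
    measurableSet_preimage_inter_target x (hA.inter φ'.open_source.measurableSet)
  choose! T hT hT' using fun (y : E2) (hy : y ∈ D) =>
    areaDensity_transition h (x := x) (x' := x') (y := y) hy.2 hy.1.2
  have hinj : InjOn (fun z => φ' (φ.symm z)) D := fun y hy z hz hyz =>
    φ.symm.injOn hy.2 hz.2 (φ'.injOn hy.1.2 hz.1.2 hyz)
  have himg : (fun z => φ' (φ.symm z)) '' D = φ'.symm ⁻¹' A ∩ φ'.target := by
    ext z
    constructor
    · rintro ⟨y, hy, rfl⟩
      refine ⟨?_, φ'.map_source hy.1.2⟩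
      rw [mem_preimage, φ'.left_inv hy.1.2]
      exact hy.1.1
    · rintro ⟨hz, hz'⟩
      have hs := hAx hz
      refine ⟨φ (φ'.symm z), ⟨⟨?_, ?_⟩, φ.map_source hs⟩, ?_⟩
      · rw [φ.left_inv hs]; exact hz
      · rw [φ.left_inv hs]; exact φ'.map_target hz'
      · change φ' (φ.symm (φ (φ'.symm z))) = z
        rw [φ.left_inv hs, φ'.right_inv hz']
  rw [chartArea_apply h x' hA, chartArea_apply h x hA, ← hφ', ← himg,
    lintegral_image_eq_lintegral_abs_det_fderiv_mul volume hDm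
      (fun y hy => (hT y hy).hasFDerivWithinAt) hinj]
  refine (setLIntegral_congr_fun hDm fun y hy => (hT' y hy).symm).trans_le ?_
  exact lintegral_mono_set fun y hy => ⟨hy.1.1, hy.2⟩

theorem exists_nhds_chartArea_lt_top (h : Metric S) (x : S) :
    ∃ U : Set S, IsOpen U ∧ x ∈ U ∧ U ⊆ (chartAt E2 x).source ∧ chartArea h x U < ⊤ := by
  set φ := chartAt E2 x with hφ
  obtain ⟨r, hr, hB⟩ := Metric.nhds_basis_closedBall.mem_iff.1
    (φ.open_target.mem_nhds (mem_chart_target E2 x))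
  refine ⟨φ.source ∩ φ ⁻¹' Metric.ball (φ x) r, φ.isOpen_inter_preimage Metric.isOpen_ball,
    ⟨mem_chart_source E2 x, Metric.mem_ball_self hr⟩, inter_subset_left, ?_⟩
  rw [chartArea_apply h x (φ.isOpen_inter_preimage Metric.isOpen_ball).measurableSet]
  have hsub : φ.symm ⁻¹' (φ.source ∩ φ ⁻¹' Metric.ball (φ x) r) ∩ φ.target ⊆
      Metric.closedBall (φ x) r := by
    rintro y ⟨⟨-, hy⟩, hy'⟩
    rw [mem_preimage, φ.right_inv hy'] at hy
    exact Metric.ball_subset_closedBall hy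
  refine (lintegral_mono_set hsub).trans_lt ?_
  have hK := isCompact_closedBall (φ x) r
  obtain ⟨C, hC⟩ := hK.bddAbove_image ((Real.continuous_sqrt.comp_continuousOn
    (contDiffOn_gram_det h x).continuousOn).mono hB)
  have hle : ∫⁻ y in Metric.closedBall (φ x) r, areaDensity h x y ≤
      ∫⁻ _ in Metric.closedBall (φ x) r, ENNReal.ofReal C :=
    setLIntegral_mono' hK.isClosed.measurableSet fun y hy =>
      ENNReal.ofReal_le_ofReal (hC (mem_image_of_mem _ hy))
  refine hle.trans_lt ?_
  rw [setLIntegral_const]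
  exact ENNReal.mul_lt_top ENNReal.ofReal_lt_top hK.measure_lt_top

/-- A single finite sum, over a subcover by sets of finite chart area, dominates every chart measure
by `chartArea_le`, hence also their supremum. -/
theorem isFiniteMeasure_area [CompactSpace S] (h : Metric S) : IsFiniteMeasure (area h) := by
  choose U hUo hxU hUs hUf using exists_nhds_chartArea_lt_top h
  obtain ⟨t, ht⟩ := isCompact_univ.elim_finite_subcover U hUo
    (fun x _ => mem_iUnion.2 ⟨x, hxU x⟩)
  set μ : Measure S := ∑ x ∈ t, (chartArea h x).restrict (U x) with hμ
  have hle : area h ≤ μ := by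
    refine iSup_le fun x' => Measure.le_iff.2 fun A hA => ?_
    have h1 : A ⊆ ⋃ x ∈ t, A ∩ U x := by
      intro a ha
      obtain ⟨x, hx⟩ := mem_iUnion.1 (ht (mem_univ a))
      obtain ⟨hxt, hax⟩ := mem_iUnion.1 hx
      exact mem_iUnion₂.2 ⟨x, hxt, ha, hax⟩
    refine (measure_mono h1).trans ((measure_biUnion_finset_le t _).trans ?_)
    rw [hμ, Measure.finsetSum_apply]
    refine Finset.sum_le_sum fun x _ => ?_
    rw [Measure.restrict_apply hA]
    exact chartArea_le h x x' (hA.inter (hUo x).measurableSet) (inter_subset_right.trans (hUs x))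
  refine ⟨(hle univ).trans_lt ?_⟩
  rw [hμ, Measure.finsetSum_apply]
  exact ENNReal.sum_lt_top.2 fun x _ => by
    rw [Measure.restrict_apply MeasurableSet.univ, univ_inter]; exact hUf x

end Area

/-! ### Differentiation under the integral sign on a compact space -/

section Calculus

variable {S : Type*} [TopologicalSpace S] {E : Type*} [NormedAddCommGroup E] [NormedSpace ℝ E]

variable (E) in
/-- Near `(0, x)`, the function `G` is of the form `(t, z) ↦ Φ (t, θ z)` with a function `Φ` of
class `C^n` and a continuous map `θ` to `E`. -/
def SmoothlyFactorsAt (n : ℕ) (G : ℝ → S → ℝ) (x : S) : Prop :=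
  ∃ (Φ : ℝ × E → ℝ) (θ : S → E), (∀ᶠ z in 𝓝 x, ContinuousAt θ z) ∧
    ContDiffAt ℝ n Φ (0, θ x) ∧ ∀ᶠ z : ℝ × S in 𝓝 (0, x), G z.1 z.2 = Φ (z.1, θ z.2)

variable {n : ℕ} {G : ℝ → S → ℝ} {x : S}

theorem SmoothlyFactorsAt.continuousAt (h : SmoothlyFactorsAt E n G x) :
    ContinuousAt (fun z : ℝ × S => G z.1 z.2) (0, x) := by
  obtain ⟨Φ, θ, hθ, hΦ, hG⟩ := h
  have hΘ : ContinuousAt (fun z : ℝ × S => (z.1, θ z.2)) (0, x) :=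
    continuousAt_fst.prodMk (ContinuousAt.comp (f := Prod.snd) hθ.self_of_nhds continuousAt_snd)
  have h1 : ContinuousAt (fun z : ℝ × S => Φ (z.1, θ z.2)) (0, x) :=
    ContinuousAt.comp (f := fun z : ℝ × S => (z.1, θ z.2)) (x := ((0 : ℝ), x)) hΦ.continuousAt hΘ
  exact h1.congr (hG.mono fun z hz => hz.symm)

theorem SmoothlyFactorsAt.eventually_contDiffAt {Φ : ℝ × E → ℝ} {θ : S → E}
    (hθ : ∀ᶠ z in 𝓝 x, ContinuousAt θ z) (hΦ : ContDiffAt ℝ n Φ (0, θ x)) :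
    ∀ᶠ z : ℝ × S in 𝓝 (0, x), ContDiffAt ℝ n Φ (z.1, θ z.2) := by
  have hΘ : ContinuousAt (fun z : ℝ × S => (z.1, θ z.2)) (0, x) :=
    continuousAt_fst.prodMk (ContinuousAt.comp (f := Prod.snd) hθ.self_of_nhds continuousAt_snd)
  exact hΘ.eventually (hΦ.eventually (by simp))

theorem SmoothlyFactorsAt.eventually_continuousAt (h : SmoothlyFactorsAt E n G x) :
    ∀ᶠ z : ℝ × S in 𝓝 (0, x), ContinuousAt (G z.1) z.2 := by
  obtain ⟨Φ, θ, hθ, hΦ, hG⟩ := h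
  have hθ' : ∀ᶠ z : ℝ × S in 𝓝 (0, x), ContinuousAt θ z.2 :=
    (continuous_snd.tendsto ((0 : ℝ), x)).eventually hθ
  filter_upwards [hθ', eventually_contDiffAt hθ hΦ, hG.eventually_nhds] with z h1 h2 h3
  have h4 : ContinuousAt (fun w => Φ (z.1, θ w)) z.2 :=
    ContinuousAt.comp (f := fun w => (z.1, θ w)) h2.continuousAt (continuousAt_const.prodMk h1)
  refine h4.congr ?_
  have h5 : ContinuousAt (fun w => (z.1, w)) z.2 := continuousAt_const.prodMk continuousAt_id
  filter_upwards [h5.eventually h3] with w hw using hw.symm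

/-- The derivative in `t` factors through the same `θ`, with `Φ` replaced by its partial derivative
`fderiv ℝ Φ z (1, 0)`; one order of smoothness is lost. -/
theorem SmoothlyFactorsAt.deriv (h : SmoothlyFactorsAt E (n + 1) G x) :
    SmoothlyFactorsAt E n (fun t z => deriv (fun t => G t z) t) x ∧
      ∀ᶠ z : ℝ × S in 𝓝 (0, x),
        HasDerivAt (fun t => G t z.2) (deriv (fun t => G t z.2) z.1) z.1 := by
  obtain ⟨Φ, θ, hθ, hΦ, hG⟩ := h
  have key : ∀ᶠ z : ℝ × S in 𝓝 (0, x),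
      HasDerivAt (fun t => G t z.2) (fderiv ℝ Φ (z.1, θ z.2) (1, 0)) z.1 := by
    filter_upwards [eventually_contDiffAt hθ hΦ, hG.eventually_nhds] with z h2 h3
    have h4 : HasFDerivAt Φ (fderiv ℝ Φ (z.1, θ z.2)) (z.1, θ z.2) :=
      (h2.differentiableAt (by simp)).hasFDerivAt
    have h5 : HasDerivAt (fun t : ℝ => (t, θ z.2)) (1, 0) z.1 :=
      (hasDerivAt_id z.1).prodMk (hasDerivAt_const z.1 (θ z.2))
    have h6 : HasDerivAt (fun t => Φ (t, θ z.2)) _ z.1 := h4.comp_hasDerivAt z.1 h5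
    refine h6.congr_of_eventuallyEq ?_
    have h7 : ContinuousAt (fun t => (t, z.2)) z.1 := continuousAt_id.prodMk continuousAt_const
    exact h7.eventually h3
  refine ⟨⟨fun z => fderiv ℝ Φ z (1, 0), θ, hθ, ?_, ?_⟩, ?_⟩
  · exact (hΦ.fderiv_right (m := n) (by norm_cast)).clm_apply contDiffAt_const
  · filter_upwards [key] with z hz using hz.deriv
  · filter_upwards [key] with z hz
    rw [hz.deriv]
    exact hz

variable [CompactSpace S]

/-- The tube lemma: local bounds near `t = 0` become uniform over the compact space. -/
theorem eventually_forall_of_compactSpace {P : ℝ → S → Prop}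
    (h : ∀ x, ∀ᶠ z : ℝ × S in 𝓝 (0, x), P z.1 z.2) : ∀ᶠ t in 𝓝 (0 : ℝ), ∀ x, P t x := by
  have := isCompact_univ.eventually_forall_of_forall_eventually (x₀ := (0 : ℝ)) (P := P)
    fun x (_ : x ∈ (univ : Set S)) => h x
  filter_upwards [this] with t ht x using ht x (mem_univ x)

variable [MeasurableSpace S] [OpensMeasurableSpace S] (μ : Measure S) [IsFiniteMeasure μ]

theorem hasDerivAt_integral_of_smoothlyFactorsAt (hG : ∀ x, SmoothlyFactorsAt E (n + 1) G x) :
    ∀ᶠ t in 𝓝 (0 : ℝ), HasDerivAt (fun t => ∫ x, G t x ∂μ)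
      (∫ x, deriv (fun t => G t x) t ∂μ) t := by
  set G' : ℝ → S → ℝ := fun t x => deriv (fun t => G t x) t
  have hG' : ∀ x, SmoothlyFactorsAt E n G' x := fun x => (hG x).deriv.1
  have hint : ∀ {g : S → ℝ}, Continuous g → Integrable g μ := fun hg =>
    hg.integrable_of_hasCompactSupport (HasCompactSupport.of_compactSpace _)
  have hc0 : Continuous (G' 0) := continuous_iff_continuousAt.2 fun x =>
    (hG' x).eventually_continuousAt.self_of_nhds
  -- The dominating function: by continuity and compactness `|G' t x|` exceeds `|G' 0 x|` by at most
  -- `1` for all `x` and all small `t`.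
  have hb : ∀ᶠ t in 𝓝 (0 : ℝ), ∀ x, |G' t x| ≤ 1 + |G' 0 x| := by
    refine eventually_forall_of_compactSpace (P := fun t x => |G' t x| ≤ 1 + |G' 0 x|) fun x => ?_
    have h1 := (hG' x).continuousAt.abs
    have h2 : ContinuousAt (fun z : ℝ × S => 1 + |G' 0 z.2|) (0, x) :=
      continuousAt_const.add ((hc0.continuousAt.abs).comp continuousAt_snd)
    filter_upwards [h1.eventually_lt h2 (by simp)] with z hz using hz.le
  have hd : ∀ᶠ t in 𝓝 (0 : ℝ), ∀ x, HasDerivAt (fun t => G t x) (G' t x) t :=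
    eventually_forall_of_compactSpace (P := fun t x => HasDerivAt (fun t => G t x) (G' t x) t)
      fun x => (hG x).deriv.2
  have hcG : ∀ᶠ t in 𝓝 (0 : ℝ), Continuous (G t) := by
    have := eventually_forall_of_compactSpace (P := fun t x => ContinuousAt (G t) x)
      fun x => (hG x).eventually_continuousAt
    filter_upwards [this] with t ht using continuous_iff_continuousAt.2 ht
  have hcG' : ∀ᶠ t in 𝓝 (0 : ℝ), Continuous (G' t) := by
    have := eventually_forall_of_compactSpace (P := fun t x => ContinuousAt (G' t) x)
      fun x => (hG' x).eventually_continuousAt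
    filter_upwards [this] with t ht using continuous_iff_continuousAt.2 ht
  filter_upwards [hb.eventually_nhds, hd.eventually_nhds, hcG.eventually_nhds, hcG'] with
    t h1 h2 h3 h4
  refine (hasDerivAt_integral_of_dominated_loc_of_deriv_le (F := G) (F' := G')
    (bound := fun x => 1 + |G' 0 x|) (h1.and h2) (h3.mono fun s hs => hs.aestronglyMeasurable)
    (hint h3.self_of_nhds) h4.aestronglyMeasurable ?_ (hint (continuous_const.add hc0.abs)) ?_).2
  · exact Eventually.of_forall fun x s hs => hs.1 x
  · exact Eventually.of_forall fun x s hs => hs.2 x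

theorem differentiableAt_integral_of_smoothlyFactorsAt (hG : ∀ x, SmoothlyFactorsAt E 2 G x) :
    (∀ᶠ t in 𝓝 (0 : ℝ), DifferentiableAt ℝ (fun t => ∫ x, G t x ∂μ) t) ∧
      DifferentiableAt ℝ (deriv fun t => ∫ x, G t x ∂μ) 0 := by
  have h1 := hasDerivAt_integral_of_smoothlyFactorsAt μ hG
  have h2 := hasDerivAt_integral_of_smoothlyFactorsAt (n := 0) μ fun x => (hG x).deriv.1
  refine ⟨h1.mono fun t ht => ht.differentiableAt, ?_⟩
  refine h2.self_of_nhds.differentiableAt.congr_of_eventuallyEq ?_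
  filter_upwards [h1] with t ht using ht.deriv

end Calculus

/-- A quadratic lower bound for the symmetric second difference bounds the second derivative. -/
theorem le_deriv_deriv_of_second_difference {F : ℝ → ℝ} {c d : ℝ}
    (hF : ∀ᶠ t in 𝓝 (0 : ℝ), DifferentiableAt ℝ F t) (hd : HasDerivAt (deriv F) d 0)
    (h : ∀ᶠ t in 𝓝 (0 : ℝ), c * t ^ 2 ≤ F t + F (-t) - 2 * F 0) : c ≤ d := by
  by_contra! hlt
  have hneg : Tendsto (fun t : ℝ => -t) (𝓝 0) (𝓝 0) := by
    simpa using (continuous_neg (G := ℝ)).tendsto 0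
  -- Here `g` is the derivative of `H t = F t + F (-t) - 2 F 0 - c t²`. If `d < c`, then `g 0 = 0`
  -- and `g' 0 = 2 (d - c) < 0`, so `H` strictly decreases from `H 0 = 0`, contradicting `H ≥ 0`.
  set g : ℝ → ℝ := fun t => deriv F t - deriv F (-t) - 2 * c * t with hg
  have hd' : HasDerivAt (fun t => deriv F (-t)) (-d) 0 := by
    have h1 : HasDerivAt (deriv F) d (-0) := by rwa [neg_zero]
    exact (HasDerivAt.scomp (0 : ℝ) h1 (hasDerivAt_neg (0 : ℝ))).congr_deriv (by simp)
  have h1 : HasDerivAt g (d - -d - 2 * c * 1) 0 :=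
    (hd.sub hd').sub ((hasDerivAt_id' 0).const_mul (2 * c))
  have hg0 : g 0 = 0 := by simp [hg]
  have h2 : ∀ᶠ t in 𝓝[>] (0 : ℝ), g t < 0 := by
    have h3 := h1.tendsto_slope
    have h4 : ∀ᶠ t in 𝓝[≠] (0 : ℝ), slope g 0 t < 0 :=
      h3.eventually_lt_const (by linarith)
    have h5 : 𝓝[>] (0 : ℝ) ≤ 𝓝[≠] 0 := nhdsWithin_mono _ fun t ht => ne_of_gt ht
    filter_upwards [h5 h4, self_mem_nhdsWithin] with t ht ht0
    rw [slope_def_field, hg0, sub_zero, sub_zero, div_neg_iff] at ht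
    have ht0' : (0 : ℝ) < t := ht0
    rcases ht with ht | ht
    · linarith [ht.2]
    · exact ht.1
  obtain ⟨ε, hε, hall⟩ : ∃ ε > 0, ∀ t ∈ Ioo (0 : ℝ) ε, g t < 0 := by
    obtain ⟨ε, hε, hs⟩ := mem_nhdsGT_iff_exists_Ioo_subset.1 h2
    exact ⟨ε, hε, fun t ht => hs ht⟩
  obtain ⟨δ, hδ, hball⟩ := Metric.eventually_nhds_iff.1 (hF.and (h.and (hneg.eventually hF)))
  set m := min ε δ / 2 with hm
  have hmin : 0 < min ε δ := lt_min hε hδ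
  have hm0 : 0 < m := by positivity
  have hmε : m < ε := by have := min_le_left ε δ; linarith
  have hmδ : m < δ := by have := min_le_right ε δ; linarith
  have hin : ∀ t ∈ Icc 0 m, dist t 0 < δ := fun t ht => by
    rw [Real.dist_eq, sub_zero, abs_of_nonneg ht.1]; linarith [ht.2]
  set H : ℝ → ℝ := fun t => F t + F (-t) - 2 * F 0 - c * t ^ 2 with hH
  have hHd : ∀ t ∈ Icc 0 m, HasDerivAt H (g t) t := by
    intro t ht
    have h3 := hball (hin t ht)
    have h4 : HasDerivAt (fun t => F (-t)) (-deriv F (-t)) t := by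
      exact (HasDerivAt.scomp t h3.2.2.hasDerivAt (hasDerivAt_neg t)).congr_deriv (by simp)
    have h5 := ((h3.1.hasDerivAt.add h4).sub_const (2 * F 0)).sub
      (((hasDerivAt_id' t).pow 2).const_mul c)
    refine h5.congr_deriv ?_
    simp [hg]; ring
  have hanti : StrictAntiOn H (Icc 0 m) := by
    refine strictAntiOn_of_deriv_neg (convex_Icc 0 m)
      (fun t ht => (hHd t ht).continuousAt.continuousWithinAt) fun t ht => ?_
    rw [interior_Icc] at ht
    rw [(hHd t ⟨ht.1.le, ht.2.le⟩).deriv]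
    exact hall t ⟨ht.1, ht.2.trans hmε⟩
  have h6 := hanti (left_mem_Icc.2 hm0.le) (right_mem_Icc.2 hm0.le) hm0
  have h7 := (hball (hin m (right_mem_Icc.2 hm0.le))).2.1
  have h8 : H 0 = 0 := by simp [hH]; ring
  rw [h8] at h6
  simp only [hH] at h6
  linarith

/-! ### Regularity of the Schatten norm -/

theorem continuousAt_gramNorm {A : Type*} [TopologicalSpace A]
    {G Q : A → Matrix (Fin 2) (Fin 2) ℝ} {z : A} (hG : ContinuousAt G z) (hQ : ContinuousAt Q z)
    (hD : (G z).det ≠ 0) : ContinuousAt (fun z => gramNorm (G z) (Q z)) z := by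
  have hg : ∀ i j, ContinuousAt (fun z => G z i j) z := fun i j =>
    continuousAt_pi.1 (continuousAt_pi.1 hG i) j
  have hq : ∀ i j, ContinuousAt (fun z => Q z i j) z := fun i j =>
    continuousAt_pi.1 (continuousAt_pi.1 hQ i) j
  have hdG : ContinuousAt (fun z => (G z).det) z :=
    (continuous_id.matrix_det.continuousAt (x := G z)).comp hG
  have hdQ : ContinuousAt (fun z => (Q z).det) z :=
    (continuous_id.matrix_det.continuousAt (x := Q z)).comp hQ
  exact ((((((hg 1 1).mul (hq 0 0)).add ((hg 0 0).mul (hq 1 1))).sub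
    ((continuousAt_const.mul (hg 0 1)).mul (hq 0 1))).div hdG hD).add
    (continuousAt_const.mul (hdQ.div hdG hD).sqrt)).sqrt

/-- Positive definiteness of `Q` keeps both radicands positive, so the square roots are smooth. This
is where the immersion hypothesis gives differentiability of the energy. -/
theorem contDiffAt_gramNorm {A : Type*} [NormedAddCommGroup A] [NormedSpace ℝ A]
    {G Q : A → Matrix (Fin 2) (Fin 2) ℝ} {z : A} {n : WithTop ℕ∞}
    (hG : ∀ i j, ContDiffAt ℝ n (fun z => G z i j) z)
    (hQ : ∀ i j, ContDiffAt ℝ n (fun z => Q z i j) z)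
    (hG0 : 0 < G z 0 0) (hGD : 0 < (G z).det) (hQ01 : Q z 1 0 = Q z 0 1)
    (hG01 : G z 1 0 = G z 0 1) (hQ0 : 0 < Q z 0 0) (hQD : 0 < (Q z).det) :
    ContDiffAt ℝ n (fun z => gramNorm (G z) (Q z)) z := by
  have hdG : ContDiffAt ℝ n (fun z => (G z).det) z := by
    simp only [Matrix.det_fin_two]
    exact ((hG 0 0).mul (hG 1 1)).sub ((hG 0 1).mul (hG 1 0))
  have hdQ : ContDiffAt ℝ n (fun z => (Q z).det) z := by
    simp only [Matrix.det_fin_two]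
    exact ((hQ 0 0).mul (hQ 1 1)).sub ((hQ 0 1).mul (hQ 1 0))
  have hT : 0 < G z 1 1 * Q z 0 0 + G z 0 0 * Q z 1 1 - 2 * G z 0 1 * Q z 0 1 := by
    rw [Matrix.det_fin_two] at hGD hQD
    rw [hG01] at hGD
    rw [hQ01] at hQD
    generalize G z 0 0 = a at *
    generalize G z 0 1 = b at *
    generalize G z 1 1 = c at *
    generalize Q z 0 0 = p at *
    generalize Q z 0 1 = q at *
    generalize Q z 1 1 = r at *
    have h1 : a * p * (c * p + a * r - 2 * b * q) =
        p ^ 2 * (a * c - b * b) + (p * b - a * q) ^ 2 + a ^ 2 * (p * r - q * q) := by ring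
    have h2 : 0 < a * p * (c * p + a * r - 2 * b * q) := by rw [h1]; positivity
    exact (mul_pos_iff_of_pos_left (by positivity)).1 h2
  have hin : 0 < (G z 1 1 * Q z 0 0 + G z 0 0 * Q z 1 1 - 2 * G z 0 1 * Q z 0 1) / (G z).det +
      2 * √((Q z).det / (G z).det) := by positivity
  exact ((((((hG 1 1).mul (hQ 0 0)).add ((hG 0 0).mul (hQ 1 1))).sub
    ((contDiffAt_const.mul (hG 0 1)).mul (hQ 0 1))).div hdG hGD.ne').add
    (contDiffAt_const.mul ((hdQ.div hdG hGD.ne').sqrt (div_pos hQD hGD).ne'))).sqrt hin.ne'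

theorem mink_self_pos (x : H3) {v : Mat} (hv : v ∈ x.tangent) (h0 : v ≠ 0) : 0 < mink v v := by
  refine lt_of_le_of_ne (tnorm_sq x hv) fun h => h0 ?_
  obtain ⟨K, hK, -⟩ := exists_frame x 0
  have h1 := hK v v hv.1 hv.1
  rw [hv.2, ← h, Matrix.vec3_dotProduct] at h1
  have hK0 : K v = 0 := by
    have : ∀ i, K v i = 0 := by
      intro i
      fin_cases i <;> simp <;> nlinarith [sq_nonneg (K v 0), sq_nonneg (K v 1), sq_nonneg (K v 2)]
    exact funext this
  obtain ⟨a, b, c, d, rfl⟩ := hermitian_coords hv.1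
  -- Pairing `v` with its time reversal turns the Minkowski form into `a² + b² + c² + d²`, and this
  -- pairing vanishes because `K v = 0` and `mink x v = 0`.
  have hB : (!![((-a + b : ℝ) : ℂ), ⟨c, d⟩; ⟨c, -d⟩, ((-a - b : ℝ) : ℂ)] : Mat).IsHermitian := by
    ext i j
    fin_cases i <;> fin_cases j <;> apply Complex.ext <;> simp
  have h2 := hK _ _ hv.1 hB
  rw [hv.2, hK0, mink_coords, zero_dotProduct] at h2
  have ha : a = 0 := by nlinarith [sq_nonneg a, sq_nonneg b, sq_nonneg c, sq_nonneg d]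
  have hb : b = 0 := by nlinarith [sq_nonneg a, sq_nonneg b, sq_nonneg c, sq_nonneg d]
  have hc : c = 0 := by nlinarith [sq_nonneg a, sq_nonneg b, sq_nonneg c, sq_nonneg d]
  have hd : d = 0 := by nlinarith [sq_nonneg a, sq_nonneg b, sq_nonneg c, sq_nonneg d]
  subst ha hb hc hd
  ext i j
  fin_cases i <;> fin_cases j <;> apply Complex.ext <;> simp

/-! ### Smoothness in chart coordinates -/

section Local

variable {S : Type*} [TopologicalSpace S] [ChartedSpace E2 S] [IsManifold (𝓡 2) ∞ S]
variable {St : Type*} [TopologicalSpace St] [ChartedSpace E2 St]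
variable {π : St → S} {x : S} {ψ : E2 → St} {O : Set E2} {y : E2} {f : St → H3}
  {X : ∀ p : St, (f p).tangent}

theorem pullbackMink_pos {p : St} (hf : MDifferentiableAt (𝓡 2) 𝓘(ℝ, Entries) (fun p => entries (f p)) p)
    (hi : Function.Injective (diff f p)) (v : TangentSpace (𝓡 2) p) (hv : v ≠ 0) :
    0 < pullbackMink f p v v := by
  refine mink_self_pos (f p) (diff_mem_tangent hf v) fun h => hv (hi ?_)
  rw [h]
  have := diff_smul f p 0 (0 : TangentSpace (𝓡 2) p)
  rw [zero_smul, zero_smul] at this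
  exact this.symm

theorem IsLocalLift.gramE_pos (hψ : IsLocalLift π x ψ O)
    (hπ : IsLocalDiffeomorph (𝓡 2) (𝓡 2) ∞ π) (hy : y ∈ O)
    (hf : MDifferentiableAt (𝓡 2) 𝓘(ℝ, Entries) (fun p => entries (f p)) (ψ y))
    (hi : Function.Injective (diff f (ψ y))) :
    0 < gramE (fun y => entries (f (ψ y))) y 0 0 ∧
      0 < (gramE (fun y => entries (f (ψ y))) y).det := by
  obtain ⟨e, he⟩ := hψ.exists_basis hπ hy
  rw [← hψ.gramH3_eq hy hf, ← funext he]
  exact ⟨pullbackMink_pos hf hi _ (e.ne_zero 0), gram_det_pos (pullbackMink f (ψ y))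
    (fun _ _ => mink_comm _ _) (pullbackMink_pos hf hi) e.linearIndependent⟩

theorem continuousAt_gram (h : Metric S) (hy : y ∈ (chartAt E2 x).target) :
    ContinuousAt (gram h x) y :=
  continuousAt_pi.2 fun i => continuousAt_pi.2 fun j =>
    (contDiffOn_gram h x i j).continuousOn.continuousAt ((chartAt E2 x).open_target.mem_nhds hy)

theorem continuousAt_gramE {u : E2 → Entries} (hu : ContDiffAt ℝ ∞ u y) :
    ContinuousAt (gramE u) y := by
  have h1 : ContinuousAt (fderiv ℝ u) y := (hu.fderiv_right (m := 0) (by simp)).continuousAt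
  have h2 : ∀ i, ContinuousAt (fun y => fderiv ℝ u y (stdBasis i)) y := fun i =>
    h1.clm_apply continuousAt_const
  exact continuousAt_pi.2 fun i => continuousAt_pi.2 fun j =>
    ((minkL.continuous.continuousAt.comp (h2 i)).clm_apply (h2 j))

/-- The derivative of the slice `V (t, ·)` in direction `v` is the joint derivative in direction
`(0, v)`, so it is smooth in `t` and `y` together. -/
theorem contDiffAt_gramE_param {V : ℝ × E2 → Entries} {z : ℝ × E2} (hV : ContDiffAt ℝ ∞ V z)
    (i j : Fin 2) :
    ContDiffAt ℝ 2 (fun z : ℝ × E2 => gramE (fun y => V (z.1, y)) z.2 i j) z := by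
  have h1 : ContDiffAt ℝ 2 (fderiv ℝ V) z := hV.fderiv_right (m := 2) (by norm_cast)
  have h2 : ∀ v : E2, ContDiffAt ℝ 2 (fun z => fderiv ℝ V z (0, v)) z := fun v =>
    h1.clm_apply contDiffAt_const
  have h3 : ContDiffAt ℝ 2 (fun z => minkL (fderiv ℝ V z (0, stdBasis i))
      (fderiv ℝ V z (0, stdBasis j))) z :=
    (minkL.contDiff.contDiffAt.comp z (h2 _)).clm_apply (h2 _)
  refine h3.congr_of_eventuallyEq ?_
  have h4 : ∀ᶠ w in 𝓝 z, ContDiffAt ℝ 1 V w := (hV.of_le (by simp)).eventually (by simp)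
  filter_upwards [h4] with w hw
  have h5 : ∀ v : E2, fderiv ℝ (fun y => V (w.1, y)) w.2 v = fderiv ℝ V w (0, v) := by
    intro v
    have h6 : HasFDerivAt (fun y => (w.1, y)) (ContinuousLinearMap.inr ℝ ℝ E2) w.2 :=
      hasFDerivAt_prodMk_right w.1 w.2
    have h7 : HasFDerivAt V (fderiv ℝ V w) (w.1, w.2) :=
      (hw.differentiableAt (by simp)).hasFDerivAt
    have h8 : HasFDerivAt (fun y => V (w.1, y))
        (fderiv ℝ V w ∘L ContinuousLinearMap.inr ℝ ℝ E2) w.2 := h7.comp w.2 h6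
    rw [h8.fderiv]
    rfl
  simp only [gramE, Matrix.of_apply, h5]

theorem contDiffAt_geoMap_comp {u w : E2 → Entries} {t : ℝ} (hu : ContDiffAt ℝ ∞ u y)
    (hw : ContDiffAt ℝ ∞ w y) :
    ContDiffAt ℝ ∞ (fun z : ℝ × E2 => geoMap z.1 (u z.2, w z.2)) (t, y) := by
  have h1 : ContDiff ℝ ∞ fun z : ℝ × (Entries × Entries) => geoMap z.1 z.2 := contDiff_geoMap le_rfl
  generalize geoMap = g at *
  have h2 : ContDiffAt ℝ ∞ (fun z : ℝ × E2 => u z.2) (t, y) :=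
    ContDiffAt.comp (g := u) (t, y) hu contDiffAt_snd
  have h3 : ContDiffAt ℝ ∞ (fun z : ℝ × E2 => w z.2) (t, y) :=
    ContDiffAt.comp (g := w) (t, y) hw contDiffAt_snd
  exact h1.contDiffAt.comp (t, y) (contDiffAt_fst.prodMk (h2.prodMk h3))

end Local

/-! ### The Schatten norm as a function on the surface -/

section Global

variable {S : Type*} [TopologicalSpace S] [ChartedSpace E2 S] [IsManifold (𝓡 2) ∞ S]
variable {St : Type*} [TopologicalSpace St] [ChartedSpace E2 St] [IsManifold (𝓡 2) ∞ St]
variable {π : St → S} {ρ : deckGroup π →* Matrix.ProjectiveSpecialLinearGroup (Fin 2) ℂ}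
  {f : St → H3} {X : ∀ p : St, (f p).tangent} {x : S} {ψ : E2 → St} {O : Set E2}

theorem IsLocalLift.mem_nhds (hψ : IsLocalLift π x ψ O) (hx : chartAt E2 x x ∈ O) :
    {z | z ∈ (chartAt E2 x).source ∧ chartAt E2 x z ∈ O} ∈ 𝓝 x :=
  ((chartAt E2 x).isOpen_inter_preimage hψ.isOpen).mem_nhds ⟨mem_chart_source E2 x, hx⟩

theorem IsLocalLift.schattenNorm_eq (hψ : IsLocalLift π x ψ O) (hπ : IsUniversalCover π)
    (h : Metric S) (hf : IsEquivariantMap π ρ f) {z : S} (hz : z ∈ (chartAt E2 x).source)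
    (hzO : chartAt E2 x z ∈ O) :
    schattenNorm h hπ f z = schattenNormUp h π f (ψ (chartAt E2 x z)) := by
  have h1 := SchattenEnergy.schattenNorm_eq hπ h hf (ψ (chartAt E2 x z))
  rwa [hψ.lift _ hzO, (chartAt E2 x).left_inv hz] at h1

theorem continuous_schattenNorm (hπ : IsUniversalCover π) (h : Metric S)
    (hf : IsEquivariantMap π ρ f) : Continuous (schattenNorm h hπ f) := by
  refine continuous_iff_continuousAt.2 fun x => ?_
  obtain ⟨p, rfl⟩ := hπ.surjective x
  obtain ⟨ψ, O, hψ, hO, -⟩ := exists_isLocalLift hπ.isLocalDiffeomorph p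
  set φ := chartAt E2 (π p) with hφ
  have hx := mem_chart_source E2 (π p)
  have h1 := continuousAt_gramNorm (continuousAt_gram h (hψ.subset hO))
    (continuousAt_gramE ((hψ.contDiffOn hf.smooth).contDiffAt (hψ.isOpen.mem_nhds hO)))
    (gram_det_pos_of_mem h (hψ.subset hO)).ne'
  have h2 := ContinuousAt.comp (f := φ) h1 (φ.continuousAt hx)
  refine h2.congr ?_
  filter_upwards [hψ.mem_nhds hO] with z hz
  rw [hψ.schattenNorm_eq hπ h hf hz.1 hz.2,
    hψ.schattenNormUp_eq hπ.isLocalDiffeomorph hz.2 h hf.smooth]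
  rfl

/-- The factorization takes the chart as `θ` and `gramNorm` in coordinates as `Φ`. Smoothness is
asked only at `t = 0`, where the displacement is `f` itself, so it suffices that `f` be an
immersion. -/
theorem smoothlyFactorsAt_schattenNorm (hπ : IsUniversalCover π) (h : Metric S)
    (hf : IsEquivariantMap π ρ f) (hX : IsInvariantSection π ρ f X) (hi : IsImmersionMap f) (x : S) :
    SmoothlyFactorsAt E2 2 (fun t => schattenNorm h hπ (displacement f X t)) x := by
  obtain ⟨p, rfl⟩ := hπ.surjective x
  have hd := hπ.isLocalDiffeomorph
  obtain ⟨ψ, O, hψ, hO, -⟩ := exists_isLocalLift hd p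
  have hu := (hψ.contDiffOn hf.smooth).contDiffAt (hψ.isOpen.mem_nhds hO)
  have hw := (hψ.contDiffOn hX.smooth).contDiffAt (hψ.isOpen.mem_nhds hO)
  obtain ⟨V, hV, hVt⟩ : ∃ V : ℝ × E2 → Entries, ContDiffAt ℝ ∞ V (0, chartAt E2 (π p) (π p)) ∧
      ∀ t : ℝ, (fun y => entries (displacement f X t (ψ y))) = fun y => V (t, y) :=
    ⟨_, contDiffAt_geoMap_comp hu hw, fun t => funext fun y => entries_displacement f X t (ψ y)⟩
  have hV0 : (fun y => V (0, y)) = fun y => entries (f (ψ y)) := by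
    rw [← hVt 0, displacement_zero]
  have hg := hψ.gramE_pos hd hO (hf.smooth.mdifferentiable (by simp) _) (hi _)
  rw [← hV0] at hg
  have hgr : ∀ i j, ContDiffAt ℝ 2 (fun z : ℝ × E2 => gram h (π p) z.2 i j)
      (0, chartAt E2 (π p) (π p)) := fun i j =>
    ContDiffAt.comp (g := fun y => gram h (π p) y i j) ((0 : ℝ), chartAt E2 (π p) (π p))
      (((contDiffOn_gram h (π p) i j).contDiffAt
        ((chartAt E2 (π p)).open_target.mem_nhds (hψ.subset hO))).of_le (by norm_cast))
      contDiffAt_snd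
  refine ⟨fun z => gramNorm (gram h (π p) z.2) (gramE (fun y => V (z.1, y)) z.2),
    chartAt E2 (π p), ?_, ?_, ?_⟩
  · filter_upwards [(chartAt E2 (π p)).open_source.mem_nhds (mem_chart_source E2 (π p))] with z hz
      using (chartAt E2 (π p)).continuousAt hz
  · exact contDiffAt_gramNorm (G := fun z : ℝ × E2 => gram h (π p) z.2)
      (Q := fun z : ℝ × E2 => gramE (fun y => V (z.1, y)) z.2) hgr
      (fun i j => contDiffAt_gramE_param hV i j)
      (gram_zero_zero_pos h (hψ.subset hO)) (gram_det_pos_of_mem h (hψ.subset hO))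
      (minkL_comm _ _) (h.symm _ _ _) hg.1 hg.2
  · filter_upwards [(continuous_snd.tendsto ((0 : ℝ), π p)).eventually (hψ.mem_nhds hO)] with z hz
    have hft := isEquivariantMap_displacement hf hX z.1
    rw [hψ.schattenNorm_eq hπ h hft hz.1 hz.2, hψ.schattenNormUp_eq hd hz.2 h hft.smooth, hVt]

theorem convexOn_schattenNorm (hπ : IsUniversalCover π) (h : Metric S)
    (hf : IsEquivariantMap π ρ f) (hX : IsInvariantSection π ρ f X) (x : S) :
    ConvexOn ℝ univ fun t => schattenNorm h hπ (displacement f X t) x :=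
  convexOn_schattenNormUp (injective_mfderiv_of_isLocalDiffeomorph hπ.isLocalDiffeomorph _)
    (hf.smooth.mdifferentiable (by simp) _) (hX.smooth.mdifferentiable (by simp) _)

theorem schattenNorm_second_difference_nonneg (hπ : IsUniversalCover π) (h : Metric S)
    (hf : IsEquivariantMap π ρ f) (hX : IsInvariantSection π ρ f X) (x : S) (t : ℝ) :
    0 ≤ schattenNorm h hπ (displacement f X t) x + schattenNorm h hπ (displacement f X (-t)) x -
      2 * schattenNorm h hπ (displacement f X 0) x := by
  have h1 := (convexOn_schattenNorm hπ h hf hX x).2 (mem_univ t) (mem_univ (-t))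
    (by norm_num : (0 : ℝ) ≤ 1 / 2) (by norm_num : (0 : ℝ) ≤ 1 / 2) (by norm_num)
  simp only [smul_eq_mul] at h1
  rw [show (1 / 2 : ℝ) * t + 1 / 2 * -t = 0 by ring] at h1
  linarith

/-- The constant `c` solves `c (2 B + 1 + κ₀) = κ₀` and is at most `1`, so `(N + c t²)² = N² + c t²
(2 N + c t²) ≤ N² + κ t²`. -/
theorem add_mul_sq_le_sqrt {N B κ κ₀ t : ℝ} (hN : 0 ≤ N) (hNB : N ≤ B) (hκ₀ : 0 < κ₀)
    (hκ : κ₀ ≤ κ) (ht : t ^ 2 ≤ 1) :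
    N + κ₀ / (2 * B + 1 + κ₀) * t ^ 2 ≤ √(N ^ 2 + κ * t ^ 2) := by
  have hB : 0 < 2 * B + 1 + κ₀ := by linarith
  set c := κ₀ / (2 * B + 1 + κ₀) with hc
  have hc0 : 0 < c := div_pos hκ₀ hB
  have hcB : c * (2 * B + 1 + κ₀) = κ₀ := div_mul_cancel₀ _ hB.ne'
  have hc1 : c ≤ 1 := (div_le_one hB).2 (by linarith)
  apply Real.le_sqrt_of_sq_le
  have h1 : c * (2 * N + c) ≤ κ := by nlinarith
  have h2 : c * (2 * N + c * t ^ 2) ≤ κ := by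
    refine le_trans ?_ h1
    have : c * t ^ 2 ≤ c := by nlinarith
    nlinarith
  nlinarith [mul_le_mul_of_nonneg_right h2 (sq_nonneg t)]

/-- The coefficient `κ = |X|² √(det Q / det G)` is continuous at the point and positive there, as `X
p ≠ 0` and `f` is an immersion. On `U` it exceeds half its value at the point while the norm stays
below `B`, which makes the bound uniform. -/
theorem exists_second_difference_lower_bound (hπ : IsUniversalCover π) (h : Metric S)
    (hf : IsEquivariantMap π ρ f) (hX : IsInvariantSection π ρ f X) (hi : IsImmersionMap f)
    {p : St} (hp : X p ≠ 0) :
    ∃ U : Set S, IsOpen U ∧ π p ∈ U ∧ ∃ c : ℝ, 0 < c ∧ ∀ x ∈ U, ∀ t : ℝ, t ^ 2 ≤ 1 →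
      c * t ^ 2 ≤ schattenNorm h hπ (displacement f X t) x +
        schattenNorm h hπ (displacement f X (-t)) x -
          2 * schattenNorm h hπ (displacement f X 0) x := by
  have hd := hπ.isLocalDiffeomorph
  obtain ⟨ψ, O, hψ, hO, hψp⟩ := exists_isLocalLift hd p
  set φ := chartAt E2 (π p) with hφ
  have hx := mem_chart_source E2 (π p)
  set y := φ (π p)
  have hu := (hψ.contDiffOn hf.smooth).contDiffAt (hψ.isOpen.mem_nhds hO)
  have hw := (hψ.contDiffOn hX.smooth).contDiffAt (hψ.isOpen.mem_nhds hO)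
  set κ : E2 → ℝ := fun y => minkL (entries (X (ψ y))) (entries (X (ψ y))) *
    √((gramE (fun y => entries (f (ψ y))) y).det / (gram h (π p) y).det) with hκ
  have hGD := gram_det_pos_of_mem h (hψ.subset hO)
  have hκc : ContinuousAt κ y := by
    have h1 : ContinuousAt (fun y => (gramE (fun y => entries (f (ψ y))) y).det) y :=
      ContinuousAt.comp (f := gramE fun y => entries (f (ψ y)))
        (continuous_id.matrix_det.continuousAt) (continuousAt_gramE hu)
    have h2 : ContinuousAt (fun y => (gram h (π p) y).det) y :=
      ContinuousAt.comp (f := gram h (π p)) (continuous_id.matrix_det.continuousAt)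
        (continuousAt_gram h (hψ.subset hO))
    exact ((minkL.continuous.continuousAt.comp hw.continuousAt).clm_apply hw.continuousAt).mul
      (h1.div h2 hGD.ne').sqrt
  have hκ0 : 0 < κ y := by
    refine mul_pos ?_ (Real.sqrt_pos.2 (div_pos
      (hψ.gramE_pos hd hO (hf.smooth.mdifferentiable (by simp) _) (hi _)).2 hGD))
    rw [hψp]
    exact mink_self_pos (f p) (X p).2 fun h0 => hp (Subtype.ext h0)
  have hκc' : ContinuousAt (fun z => κ (φ z)) (π p) :=
    ContinuousAt.comp (f := φ) hκc (φ.continuousAt hx)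
  have hNc := (continuous_schattenNorm hπ h hf).continuousAt (x := π p)
  set B := schattenNorm h hπ f (π p) + 1
  have hev := (hκc'.eventually_const_lt (half_lt_self hκ0)).and
    ((hNc.eventually_lt_const (lt_add_one _)).and (hψ.mem_nhds hO))
  obtain ⟨U, hU, hUo, hpU⟩ := _root_.eventually_nhds_iff.1 hev
  have hNn : ∀ x, 0 ≤ schattenNorm h hπ f x := by
    intro x
    obtain ⟨q, rfl⟩ := hπ.surjective x
    have e : Module.Basis (Fin 2) ℝ (TangentSpace (𝓡 2) q) :=
      (EuclideanSpace.basisFun (Fin 2) ℝ).toBasis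
    rw [schattenNorm_eq hπ h hf, schattenNormUp_eq (injective_mfderiv_of_isLocalDiffeomorph hd q)
      (hf.smooth.mdifferentiable (by simp) _) e]
    exact Real.sqrt_nonneg _
  have hB : 0 < B := by have := hNn (π p); positivity
  refine ⟨U, hUo, hpU, 2 * (κ y / 2 / (2 * B + 1 + κ y / 2)), by positivity, fun x hxU t ht => ?_⟩
  obtain ⟨h1, h2, h3, h4⟩ := hU x hxU
  rw [displacement_zero, hψ.schattenNorm_eq hπ h (isEquivariantMap_displacement hf hX t) h3 h4,
    hψ.schattenNorm_eq hπ h (isEquivariantMap_displacement hf hX (-t)) h3 h4,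
    hψ.schattenNorm_eq hπ h hf h3 h4]
  have h5 := hNn x
  rw [hψ.schattenNorm_eq hπ h hf h3 h4] at h2 h5
  obtain ⟨e, he⟩ := hψ.exists_basis hd h4
  have hfd := hf.smooth.mdifferentiable (by simp) (ψ (φ x))
  have h6 := schattenNormUp_second_difference (h := h)
    (injective_mfderiv_of_isLocalDiffeomorph hd (ψ (φ x))) hfd
    (hX.smooth.mdifferentiable (by simp) _) e t
  rw [funext he, hψ.gramH3_eq h4 hfd, hψ.gramUp_eq hd h4] at h6
  have h7 := add_mul_sq_le_sqrt (t := t) h5 h2.le (half_pos hκ0) h1.le ht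
  have h8 : κ (φ x) = mink (X (ψ (φ x))) (X (ψ (φ x))) *
    √((gramE (fun y => entries (f (ψ y))) (φ x)).det / (gram h (π p) (φ x)).det) := rfl
  rw [← h8] at h6
  linarith

end Global

/-! ### Integration over the surface -/

section Energy

variable {S : Type*} [TopologicalSpace S] [CompactSpace S] [ChartedSpace E2 S]
  [IsManifold (𝓡 2) ∞ S] [MeasurableSpace S] [BorelSpace S]
variable {St : Type*} [TopologicalSpace St] [ChartedSpace E2 St] [IsManifold (𝓡 2) ∞ St]
variable {π : St → S} {ρ : deckGroup π →* Matrix.ProjectiveSpecialLinearGroup (Fin 2) ℂ}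
  {f : St → H3} {X : ∀ p : St, (f p).tangent}

theorem integrable_schattenNorm (hπ : IsUniversalCover π) (h : Metric S)
    (hf : IsEquivariantMap π ρ f) : Integrable (schattenNorm h hπ f) (area h) := by
  have := isFiniteMeasure_area h
  exact (continuous_schattenNorm hπ h hf).integrable_of_hasCompactSupport
    (HasCompactSupport.of_compactSpace _)

theorem convexOn_energy (hπ : IsUniversalCover π) (h : Metric S)
    (hf : IsEquivariantMap π ρ f) (hX : IsInvariantSection π ρ f X) :
    ConvexOn ℝ univ fun t => energy h hπ (displacement f X t) := by
  have hI : ∀ t, Integrable (schattenNorm h hπ (displacement f X t)) (area h) := fun t =>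
    integrable_schattenNorm hπ h (isEquivariantMap_displacement hf hX t)
  refine ⟨convex_univ, fun s _ t _ a b ha hb hab => ?_⟩
  simp only [energy, smul_eq_mul]
  rw [← integral_const_mul, ← integral_const_mul,
    ← integral_add ((hI s).const_mul a) ((hI t).const_mul b)]
  exact integral_mono (hI _) (((hI s).const_mul a).add ((hI t).const_mul b)) fun x =>
    (convexOn_schattenNorm hπ h hf hX x).2 (mem_univ s) (mem_univ t) ha hb hab

/-- On `U` the pointwise bound is strict, off `U` convexity keeps the second difference nonnegative,
and the nonempty open set `U` has positive area. -/
theorem exists_energy_second_difference_lower_bound (hπ : IsUniversalCover π) (h : Metric S)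
    (hf : IsEquivariantMap π ρ f) (hX : IsInvariantSection π ρ f X) (hi : IsImmersionMap f)
    {p : St} (hp : X p ≠ 0) :
    ∃ c : ℝ, 0 < c ∧ ∀ t : ℝ, t ^ 2 ≤ 1 →
      c * t ^ 2 ≤ energy h hπ (displacement f X t) + energy h hπ (displacement f X (-t)) -
        2 * energy h hπ (displacement f X 0) := by
  have := isFiniteMeasure_area h
  have hI : ∀ t, Integrable (schattenNorm h hπ (displacement f X t)) (area h) := fun t =>
    integrable_schattenNorm hπ h (isEquivariantMap_displacement hf hX t)
  obtain ⟨U, hU, hpU, c, hc, hcU⟩ := exists_second_difference_lower_bound hπ h hf hX hi hp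
  have hA : 0 < (area h).real U :=
    ENNReal.toReal_pos (area_pos_of_isOpen h hU hpU).ne' (measure_ne_top _ _)
  refine ⟨c * (area h).real U, mul_pos hc hA, fun t ht => ?_⟩
  have h1 : ∫ x, U.indicator (fun _ => c * t ^ 2) x ∂(area h) = c * (area h).real U * t ^ 2 := by
    rw [integral_indicator_const _ hU.measurableSet, smul_eq_mul]
    ring
  have h2 : Integrable (fun x => schattenNorm h hπ (displacement f X t) x +
      schattenNorm h hπ (displacement f X (-t)) x) (area h) := (hI t).add (hI (-t))
  simp only [energy]
  rw [← h1, ← integral_const_mul, ← integral_add (hI t) (hI (-t)),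
    ← integral_sub h2 ((hI 0).const_mul 2)]
  refine integral_mono ((integrable_const _).indicator hU.measurableSet)
    (h2.sub ((hI 0).const_mul 2)) fun x => ?_
  by_cases hx : x ∈ U
  · simpa [hx] using hcU x hx t ht
  · simpa [hx] using schattenNorm_second_difference_nonneg hπ h hf hX x t

end Energy

end SchattenEnergy

theorem mainTheorem6
    {S : Type*} [TopologicalSpace S] [T2Space S] [CompactSpace S] [ConnectedSpace S]
    [ChartedSpace SchattenEnergy.E2 S] [IsManifold (𝓡 2) ∞ S] [MeasurableSpace S] [BorelSpace S]
    {St : Type*} [TopologicalSpace St] [ChartedSpace SchattenEnergy.E2 St]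
    [IsManifold (𝓡 2) ∞ St]
    (h : SchattenEnergy.Metric S) (_hh : SchattenEnergy.IsHyperbolic h)
    (π : St → S) (hπ : SchattenEnergy.IsUniversalCover π)
    (ρ : SchattenEnergy.deckGroup π →* Matrix.ProjectiveSpecialLinearGroup (Fin 2) ℂ)
    (f : St → SchattenEnergy.H3) (_hf : SchattenEnergy.IsEquivariantMap π ρ f)
    (X : ∀ p : St, (f p).tangent) (_hX : SchattenEnergy.IsInvariantSection π ρ f X) :
    (∀ t : ℝ, SchattenEnergy.IsEquivariantMap π ρ (SchattenEnergy.displacement f X t) ∧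
      Integrable (SchattenEnergy.schattenNorm h hπ (SchattenEnergy.displacement f X t))
        (SchattenEnergy.area h)) ∧
    ConvexOn ℝ Set.univ
      (fun t : ℝ => SchattenEnergy.energy h hπ (SchattenEnergy.displacement f X t)) ∧
    (SchattenEnergy.IsImmersionMap f → (∃ p, X p ≠ 0) →
      (∀ᶠ t in 𝓝 (0 : ℝ), DifferentiableAt ℝ
        (fun t : ℝ => SchattenEnergy.energy h hπ (SchattenEnergy.displacement f X t)) t) ∧
      ∃ c : ℝ, 0 < c ∧ HasDerivAt
        (deriv fun t : ℝ => SchattenEnergy.energy h hπ (SchattenEnergy.displacement f X t))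
        c 0) := by
  refine ⟨fun t => ?_, SchattenEnergy.convexOn_energy hπ h _hf _hX, fun hi ⟨p, hp⟩ => ?_⟩
  · have hft := SchattenEnergy.isEquivariantMap_displacement _hf _hX t
    exact ⟨hft, SchattenEnergy.integrable_schattenNorm hπ h hft⟩
  · have := SchattenEnergy.isFiniteMeasure_area h
    obtain ⟨hd, hd2⟩ := SchattenEnergy.differentiableAt_integral_of_smoothlyFactorsAt
      (SchattenEnergy.area h)
      (SchattenEnergy.smoothlyFactorsAt_schattenNorm hπ h _hf _hX hi)
    obtain ⟨c, hc, hcF⟩ :=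
      SchattenEnergy.exists_energy_second_difference_lower_bound hπ h _hf _hX hi hp
    -- The value of the second derivative is whatever regularity provides; the second-difference
    -- bound shows that it is at least the positive constant `c`.
    refine ⟨hd, _, hc.trans_le (SchattenEnergy.le_deriv_deriv_of_second_difference hd
      hd2.hasDerivAt ?_), hd2.hasDerivAt⟩
    have h1 : ∀ᶠ t : ℝ in 𝓝 0, t ^ 2 < 1 :=
      (continuous_pow 2).continuousAt.eventually_lt_const (by norm_num)
    filter_upwards [h1] with t ht using hcF t ht.le
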